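/- Throughout, *double category* means pseudo double category: arrows compose strictly, while proarrows $m\colon x\mathrel{⇸}y$ have an external composition $\odot$ (written in diagrammatic order) and external identities $\mathrm{id}_x$ that are associative and unital up to coherent invertible globular cells. The finite and the unrestricted version of the result are stated simultaneously; in the finite version every set below ("index set", "apex") is finite, in the other one it is an arbitrary small set. **Strong coproducts.** Let $\mathbb D$ be a double category. For families of objects $(x_i)_{i\in I}$ and $(y_j)_{j\in J}$, a *span-indexed family of proarrows* $m\colon x\mathrel{⇸}y$ consists of a span $I\xleftarrow{l}A\xrightarrow{r}J$ of (finite) sets with apex $A$ and proarrows $m_a\colon x_{l(a)}\mathrel{⇸}y_{r(a)}$, $a\in A$. Such families compose, $(m\odot n)_{(a,b)}=m_a\odot n_b$, over the pullback of the spans; the identity family on $x$ is $(\mathrm{id}_{x_i})_{i\in I}$ over the identity span. The double category $\mathbb D$ *has strong (finite) coproducts* if it is equipped with * for each family of objects $x=(x_i)_{i\in I}$, a coproduct $\Sigma x$ in the category of objects and arrows of $\mathbb D$, with coprojections $\iota_i\colon x_i\to\Sigma x$; * for each span-indexed family $m\colon x\mathrel{⇸}y$, a proarrow $\Sigma m\colon\Sigma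 x\mathrel{⇸}\Sigma y$ and cells $\iota_a\colon m_a\to\Sigma m$ with left boundary $\iota_{l(a)}$ and right boundary $\iota_{r(a)}$, which are universal: for every proarrow $n\colon t\mathrel{⇸}t'$, all arrows $f_i\colon x_i\to t$ and $g_j\colon y_j\to t'$, and all cells $\gamma_a\colon m_a\to n$ with left boundary $f_{l(a)}$ and right boundary $g_{r(a)}$, there is exactly one cell $\Sigma m\to n$ whose boundaries are the arrows $\Sigma x\to t$ and $\Sigma y\to t'$ induced by $f$ and $g$ and whose composite with $\iota_a$ is $\gamma_a$ for every $a\in A$; such that the comparison cells $\Sigma(m\odot n)\to\Sigma m\odot\Sigma n$ and $\Sigma(\mathrm{id}_{x_i})_{i\in I}\to\mathrm{id}_{\Sigma x}$ induced by the universal property are all invertible. In that case coproducts over a fixed (finite) set $I$ (with proarrow families indexed by the identity span on $I$) form a pseudo double functor $\Sigma\colon\mathbb D^I\to\mathbb D$, where $\mathbb D^I$ has pointwise structure. A function $f_0\colon I\to J$ between (finite) sets gives by reindexing a double functor $\mathbb D^{f_0}\colon\mathbb D^J\to\mathbb D^I$ and, through the universal property, a natural transformation $$\Sigma(f_0)\colon\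 \Sigma\circ\mathbb D^{f_0}\Rightarrow\Sigma\colon\ \mathbb D^J\to\mathbb D .$$ Its component at a family of objects $x=(x_j)_{j\in J}$ is the arrow $\Sigma(f_0)_x\colon\Sigma_{i\in I}x_{f_0(i)}\to\Sigma_{j\in J}x_j$, and its component at a parallel family of proarrows $m=(m_j\colon x_j\mathrel{⇸}y_j)_{j\in J}$ is the cell $\Sigma(f_0)_m\colon\Sigma_{i\in I}m_{f_0(i)}\to\Sigma_{j\in J}m_j$ with boundaries $\Sigma(f_0)_x$ and $\Sigma(f_0)_y$; both restrict along the $i$-th coprojection to the $f_0(i)$-th coprojection. **Companions, conjoints, commuters.** A *companion* of an arrow $f\colon x\to y$ is a proarrow $f_!\colon x\mathrel{⇸}y$ with cells $\eta\colon\mathrm{id}_x\to f_!$ (boundaries $1_x,f$) and $\varepsilon\colon f_!\to\mathrm{id}_y$ (boundaries $f,1_y$) such that the composite of $\eta$ followed by $\varepsilon$ is $\mathrm{id}_f$ and $\eta\odot\varepsilon=1_{f_!}$ up to the unitors; a *conjoint* $f^*\colon y\mathrel{⇸}x$ is defined dually, with $\eta\colon\mathrm{id}_x\to f^*$ (boundaries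 $f,1_x$), $\varepsilon\colon f^*\to\mathrm{id}_y$ (boundaries $1_y,f$). A cell $\alpha\colon m\to n$ with left boundary $f$ and right boundary $g$ is a *commuter* if $f$ and $g$ have companions and the globular cell $\alpha_!\colon m\odot g_!\to f_!\odot n$ obtained by pasting $\alpha$ with $\eta$ of $f_!$ and $\varepsilon$ of $g_!$ is invertible; it is a *cocommuter* if $f$ and $g$ have conjoints and the analogous globular cell $\alpha^*\colon f^*\odot m\to n\odot g^*$ is invertible. **The double category $\mathbb{L}\mathrm{ax}_{\mathrm{ps}}(\mathbb D^J,\mathbb D)$** has lax double functors $\mathbb D^J\to\mathbb D$ as objects, natural transformations as arrows, pseudo protransformations as proarrows and modifications as cells. **Proposition.** Let $\mathbb D$ be a double category with strong (finite) coproducts. For any function $f_0\colon I\to J$ between (finite) sets, the natural transformation $\Sigma(f_0)\colon\Sigma\circ\mathbb D^{f_0}\Rightarrow\Sigma$ has both a companion $\Sigma(f_0)_!$ and a conjoint $\Sigma(f_0)^*$ in the double category $\mathbb{L}\mathrm{ax}_{\mathrm{ps}}(\mathbb D^J,\mathbb D)$; in particular these are pseudo protransformations. Moreover, for every $J$-indexed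 parallel family of proarrows $m=(m_j\colon x_j\mathrel{⇸}y_j)_{j\in J}$, the component cell $\Sigma(f_0)_m$ is both a commuter and a cocommuter; this includes that its boundary arrows $\Sigma(f_0)_x$ and $\Sigma(f_0)_y$ have companions and conjoints in $\mathbb D$. -/

import Mathlib

open CategoryTheory

universe w u v p c u₁ v₁ p₁ c₁ u₂ v₂ p₂ c₂ u₃ v₃ p₃ c₃


/-- A (pseudo) double category, that is, a pseudocategory internal to categories. The objects and
arrows are those of the category `D`; proarrows are indexed by their source and target; a cell
`α : Cell m n` goes from the proarrow `m` (top) to the proarrow `n` (bottom) and has a left and a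
right boundary arrow. Cells compose strictly in the vertical direction (`vcomp`), and weakly in the
horizontal direction (`hcomp`, defined when the boundaries match). -/
class DoubleCategory (D : Type u) extends Category.{v} D where
  Pro : D → D → Type p
  Cell : {x y w z : D} → Pro x y → Pro w z → Type c
  left : {x y w z : D} → {m : Pro x y} → {n : Pro w z} → Cell m n → (x ⟶ w)
  right : {x y w z : D} → {m : Pro x y} → {n : Pro w z} → Cell m n → (y ⟶ z)
  -- vertical category of proarrows and cells, with source and target functors
  cid : {x y : D} → (m : Pro x y) → Cell m m
  vcomp : {x y x' y' x'' y'' : D} → {m : Pro x y} → {n : Pro x' y'} → {k : Pro x'' y''} →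
    Cell m n → Cell n k → Cell m k
  left_cid : ∀ {x y : D} (m : Pro x y), left (cid m) = 𝟙 x
  right_cid : ∀ {x y : D} (m : Pro x y), right (cid m) = 𝟙 y
  left_vcomp : ∀ {x y x' y' x'' y'' : D} {m : Pro x y} {n : Pro x' y'} {k : Pro x'' y''}
    (α : Cell m n) (β : Cell n k), left (vcomp α β) = left α ≫ left β
  right_vcomp : ∀ {x y x' y' x'' y'' : D} {m : Pro x y} {n : Pro x' y'} {k : Pro x'' y''}
    (α : Cell m n) (β : Cell n k), right (vcomp α β) = right α ≫ right β
  cid_vcomp : ∀ {x y x' y' : D} {m : Pro x y} {n : Pro x' y'} (α : Cell m n),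
    vcomp (cid m) α = α
  vcomp_cid : ∀ {x y x' y' : D} {m : Pro x y} {n : Pro x' y'} (α : Cell m n),
    vcomp α (cid n) = α
  vcomp_assoc : ∀ {x y x' y' x'' y'' x₃ y₃ : D} {m : Pro x y} {n : Pro x' y'} {k : Pro x'' y''}
    {l : Pro x₃ y₃} (α : Cell m n) (β : Cell n k) (γ : Cell k l),
    vcomp (vcomp α β) γ = vcomp α (vcomp β γ)
  -- external identities
  unit : (x : D) → Pro x x
  unitCell : {x y : D} → (x ⟶ y) → Cell (unit x) (unit y)
  left_unitCell : ∀ {x y : D} (f : x ⟶ y), left (unitCell f) = f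
  right_unitCell : ∀ {x y : D} (f : x ⟶ y), right (unitCell f) = f
  unitCell_id : ∀ x : D, unitCell (𝟙 x) = cid (unit x)
  unitCell_comp : ∀ {x y z : D} (f : x ⟶ y) (g : y ⟶ z),
    unitCell (f ≫ g) = vcomp (unitCell f) (unitCell g)
  -- external composition
  pcomp : {x y z : D} → Pro x y → Pro y z → Pro x z
  hcomp : {x y z x' y' z' : D} → {m : Pro x y} → {n : Pro y z} → {m' : Pro x' y'} →
    {n' : Pro y' z'} → (α : Cell m m') → (β : Cell n n') → right α = left β →
    Cell (pcomp m n) (pcomp m' n')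
  left_hcomp : ∀ {x y z x' y' z' : D} {m : Pro x y} {n : Pro y z} {m' : Pro x' y'}
    {n' : Pro y' z'} (α : Cell m m') (β : Cell n n') (h : right α = left β),
    left (hcomp α β h) = left α
  right_hcomp : ∀ {x y z x' y' z' : D} {m : Pro x y} {n : Pro y z} {m' : Pro x' y'}
    {n' : Pro y' z'} (α : Cell m m') (β : Cell n n') (h : right α = left β),
    right (hcomp α β h) = right β
  hcomp_cid : ∀ {x y z : D} (m : Pro x y) (n : Pro y z) (h : right (cid m) = left (cid n)),
    hcomp (cid m) (cid n) h = cid (pcomp m n)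
  hcomp_vcomp : ∀ {x y z x' y' z' x'' y'' z'' : D} {m : Pro x y} {n : Pro y z} {m' : Pro x' y'}
    {n' : Pro y' z'} {m'' : Pro x'' y''} {n'' : Pro y'' z''} (α : Cell m m') (β : Cell n n')
    (α' : Cell m' m'') (β' : Cell n' n'') (h : right α = left β) (h' : right α' = left β')
    (h'' : right (vcomp α α') = left (vcomp β β')),
    hcomp (vcomp α α') (vcomp β β') h'' = vcomp (hcomp α β h) (hcomp α' β' h')
  -- associators
  assocHom : {x y z t : D} → (m : Pro x y) → (n : Pro y z) → (k : Pro z t) →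
    Cell (pcomp (pcomp m n) k) (pcomp m (pcomp n k))
  assocInv : {x y z t : D} → (m : Pro x y) → (n : Pro y z) → (k : Pro z t) →
    Cell (pcomp m (pcomp n k)) (pcomp (pcomp m n) k)
  left_assocHom : ∀ {x y z t : D} (m : Pro x y) (n : Pro y z) (k : Pro z t),
    left (assocHom m n k) = 𝟙 x
  right_assocHom : ∀ {x y z t : D} (m : Pro x y) (n : Pro y z) (k : Pro z t),
    right (assocHom m n k) = 𝟙 t
  assocHom_inv : ∀ {x y z t : D} (m : Pro x y) (n : Pro y z) (k : Pro z t),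
    vcomp (assocHom m n k) (assocInv m n k) = cid _
  assocInv_hom : ∀ {x y z t : D} (m : Pro x y) (n : Pro y z) (k : Pro z t),
    vcomp (assocInv m n k) (assocHom m n k) = cid _
  assoc_naturality : ∀ {x y z t x' y' z' t' : D} {m : Pro x y} {n : Pro y z} {k : Pro z t}
    {m' : Pro x' y'} {n' : Pro y' z'} {k' : Pro z' t'} (α : Cell m m') (β : Cell n n')
    (γ : Cell k k') (h : right α = left β) (h' : right β = left γ)
    (h₁ : right (hcomp α β h) = left γ) (h₂ : right α = left (hcomp β γ h')),
    vcomp (hcomp (hcomp α β h) γ h₁) (assocHom m' n' k') =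
      vcomp (assocHom m n k) (hcomp α (hcomp β γ h') h₂)
  -- unitors
  lunitHom : {x y : D} → (m : Pro x y) → Cell (pcomp (unit x) m) m
  lunitInv : {x y : D} → (m : Pro x y) → Cell m (pcomp (unit x) m)
  left_lunitHom : ∀ {x y : D} (m : Pro x y), left (lunitHom m) = 𝟙 x
  right_lunitHom : ∀ {x y : D} (m : Pro x y), right (lunitHom m) = 𝟙 y
  lunitHom_inv : ∀ {x y : D} (m : Pro x y), vcomp (lunitHom m) (lunitInv m) = cid _
  lunitInv_hom : ∀ {x y : D} (m : Pro x y), vcomp (lunitInv m) (lunitHom m) = cid _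
  lunit_naturality : ∀ {x y x' y' : D} {m : Pro x y} {m' : Pro x' y'} (α : Cell m m')
    (h : right (unitCell (left α)) = left α),
    vcomp (hcomp (unitCell (left α)) α h) (lunitHom m') = vcomp (lunitHom m) α
  runitHom : {x y : D} → (m : Pro x y) → Cell (pcomp m (unit y)) m
  runitInv : {x y : D} → (m : Pro x y) → Cell m (pcomp m (unit y))
  left_runitHom : ∀ {x y : D} (m : Pro x y), left (runitHom m) = 𝟙 x
  right_runitHom : ∀ {x y : D} (m : Pro x y), right (runitHom m) = 𝟙 y
  runitHom_inv : ∀ {x y : D} (m : Pro x y), vcomp (runitHom m) (runitInv m) = cid _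
  runitInv_hom : ∀ {x y : D} (m : Pro x y), vcomp (runitInv m) (runitHom m) = cid _
  runit_naturality : ∀ {x y x' y' : D} {m : Pro x y} {m' : Pro x' y'} (α : Cell m m')
    (h : right α = left (unitCell (right α))),
    vcomp (hcomp α (unitCell (right α)) h) (runitHom m') = vcomp (runitHom m) α
  -- coherence
  pentagon : ∀ {x y z t s : D} (m : Pro x y) (n : Pro y z) (k : Pro z t) (l : Pro t s)
    (h : right (assocHom m n k) = left (cid l)) (h' : right (cid m) = left (assocHom n k l)),
    vcomp (hcomp (assocHom m n k) (cid l) h)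
      (vcomp (assocHom m (pcomp n k) l) (hcomp (cid m) (assocHom n k l) h')) =
      vcomp (assocHom (pcomp m n) k l) (assocHom m n (pcomp k l))
  triangle : ∀ {x y z : D} (m : Pro x y) (n : Pro y z)
    (h : right (cid m) = left (lunitHom n)) (h' : right (runitHom m) = left (cid n)),
    vcomp (assocHom m (unit y) n) (hcomp (cid m) (lunitHom n) h) = hcomp (runitHom m) (cid n) h'

namespace DoubleCategory

infixr:80 " ≫ᵥ " => DoubleCategory.vcomp
infixr:85 " ⊙ " => DoubleCategory.pcomp

attribute [simp] left_cid right_cid left_vcomp right_vcomp cid_vcomp vcomp_cid vcomp_assoc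
  left_unitCell right_unitCell unitCell_id left_hcomp right_hcomp hcomp_cid
  left_assocHom right_assocHom assocHom_inv assocInv_hom
  left_lunitHom right_lunitHom lunitHom_inv lunitInv_hom
  left_runitHom right_runitHom runitHom_inv runitInv_hom

section Basic

variable {D : Type u} [DoubleCategory.{u, v, p, c} D]

theorem left_eq_id_of_inv {x y : D} {m n : Pro x y} {α : Cell m n} {β : Cell n m}
    (h : α ≫ᵥ β = cid m) (hα : left α = 𝟙 x) : left β = 𝟙 x := by
  have := congrArg left h
  simpa [hα] using this

theorem right_eq_id_of_inv {x y : D} {m n : Pro x y} {α : Cell m n} {β : Cell n m}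
    (h : α ≫ᵥ β = cid m) (hα : right α = 𝟙 y) : right β = 𝟙 y := by
  have := congrArg right h
  simpa [hα] using this

@[simp] theorem left_assocInv {x y z t : D} (m : Pro x y) (n : Pro y z) (k : Pro z t) :
    left (assocInv m n k) = 𝟙 x :=
  left_eq_id_of_inv (assocHom_inv m n k) (left_assocHom m n k)

@[simp] theorem right_assocInv {x y z t : D} (m : Pro x y) (n : Pro y z) (k : Pro z t) :
    right (assocInv m n k) = 𝟙 t :=
  right_eq_id_of_inv (assocHom_inv m n k) (right_assocHom m n k)

@[simp] theorem left_lunitInv {x y : D} (m : Pro x y) : left (lunitInv m) = 𝟙 x :=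
  left_eq_id_of_inv (lunitHom_inv m) (left_lunitHom m)

@[simp] theorem right_lunitInv {x y : D} (m : Pro x y) : right (lunitInv m) = 𝟙 y :=
  right_eq_id_of_inv (lunitHom_inv m) (right_lunitHom m)

@[simp] theorem left_runitInv {x y : D} (m : Pro x y) : left (runitInv m) = 𝟙 x :=
  left_eq_id_of_inv (runitHom_inv m) (left_runitHom m)

@[simp] theorem right_runitInv {x y : D} (m : Pro x y) : right (runitInv m) = 𝟙 y :=
  right_eq_id_of_inv (runitHom_inv m) (right_runitHom m)

/-- A cell is invertible if it is an isomorphism for vertical composition. -/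
def IsInvertible {x y x' y' : D} {m : Pro x y} {n : Pro x' y'} (α : Cell m n) : Prop :=
  ∃ β : Cell n m, α ≫ᵥ β = cid m ∧ β ≫ᵥ α = cid n

/-- A companion of an arrow `f : x ⟶ y`: a proarrow `f_! : x ⇸ y` with unit and counit cells. -/
structure Companion {x y : D} (f : x ⟶ y) where
  pro : Pro x y
  η : Cell (unit x) pro
  ε : Cell pro (unit y)
  left_η : left η = 𝟙 x
  right_η : right η = f
  left_ε : left ε = f
  right_ε : right ε = 𝟙 y
  /-- `η ⊙ ε = 1`, up to the unitors -/
  hcomp_eq : lunitInv pro ≫ᵥ hcomp η ε (right_η.trans left_ε.symm) ≫ᵥ runitHom pro = cid pro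
  vcomp_eq : η ≫ᵥ ε = unitCell f

/-- A conjoint of an arrow `f : x ⟶ y`: a proarrow `f^* : y ⇸ x` with unit and counit cells. -/
structure Conjoint {x y : D} (f : x ⟶ y) where
  pro : Pro y x
  η : Cell (unit x) pro
  ε : Cell pro (unit y)
  left_η : left η = f
  right_η : right η = 𝟙 x
  left_ε : left ε = 𝟙 y
  right_ε : right ε = f
  /-- `ε ⊙ η = 1`, up to the unitors -/
  hcomp_eq : runitInv pro ≫ᵥ hcomp ε η (right_ε.trans left_η.symm) ≫ᵥ lunitHom pro = cid pro
  vcomp_eq : η ≫ᵥ ε = unitCell f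

/-- The globular cell `α_! : m ⊙ g_! → f_! ⊙ n` obtained from a cell `α : m → n` with left and
right boundaries `f` and `g` by sliding the boundaries along chosen companions. -/
def companionReshape {x y w z : D} {m : Pro x y} {n : Pro w z} (α : Cell m n)
    (f : Companion (left α)) (g : Companion (right α)) : Cell (m ⊙ g.pro) (f.pro ⊙ n) :=
  hcomp (lunitInv m) (cid g.pro) (by simp) ≫ᵥ
    hcomp (hcomp f.η α f.right_η) g.ε (by rw [right_hcomp, g.left_ε]) ≫ᵥ runitHom (f.pro ⊙ n)

/-- The globular cell `α^* : f^* ⊙ m → n ⊙ g^*` obtained from a cell `α : m → n` with left and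
right boundaries `f` and `g` by sliding the boundaries along chosen conjoints. -/
def conjointReshape {x y w z : D} {m : Pro x y} {n : Pro w z} (α : Cell m n)
    (f : Conjoint (left α)) (g : Conjoint (right α)) : Cell (f.pro ⊙ m) (n ⊙ g.pro) :=
  runitInv (f.pro ⊙ m) ≫ᵥ
    hcomp (hcomp f.ε α f.right_ε) g.η (by rw [right_hcomp, g.left_η]) ≫ᵥ
      hcomp (lunitHom n) (cid g.pro) (by simp)

/-- A cell is a commuter if its boundary arrows have companions and the cell `α_!`, formed with
any choice of these, is invertible. -/
def IsCommuter {x y w z : D} {m : Pro x y} {n : Pro w z} (α : Cell m n) : Prop :=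
  Nonempty (Companion (left α)) ∧ Nonempty (Companion (right α)) ∧
    ∀ (f : Companion (left α)) (g : Companion (right α)), IsInvertible (companionReshape α f g)

/-- A cell is a cocommuter if its boundary arrows have conjoints and the cell `α^*`, formed with
any choice of these, is invertible. -/
def IsCocommuter {x y w z : D} {m : Pro x y} {n : Pro w z} (α : Cell m n) : Prop :=
  Nonempty (Conjoint (left α)) ∧ Nonempty (Conjoint (right α)) ∧
    ∀ (f : Conjoint (left α)) (g : Conjoint (right α)), IsInvertible (conjointReshape α f g)

end Basic

/-- The power `D^I` of a double category, with everything defined pointwise. -/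
instance piDoubleCategory (I : Type w) (D : Type u) [DoubleCategory.{u, v, p, c} D] :
    DoubleCategory.{max w u, max w v, max w p, max w c} (I → D) where
  toCategory := CategoryTheory.pi (fun _ => D)
  Pro x y := ∀ i, Pro (x i) (y i)
  Cell m n := ∀ i, Cell (m i) (n i)
  left α i := left (α i)
  right α i := right (α i)
  cid m i := cid (m i)
  vcomp α β i := α i ≫ᵥ β i
  left_cid m := funext fun i => left_cid (m i)
  right_cid m := funext fun i => right_cid (m i)
  left_vcomp α β := funext fun i => left_vcomp (α i) (β i)
  right_vcomp α β := funext fun i => right_vcomp (α i) (β i)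
  cid_vcomp α := funext fun i => cid_vcomp (α i)
  vcomp_cid α := funext fun i => vcomp_cid (α i)
  vcomp_assoc α β γ := funext fun i => vcomp_assoc (α i) (β i) (γ i)
  unit x i := unit (x i)
  unitCell f i := unitCell (f i)
  left_unitCell f := funext fun i => left_unitCell (f i)
  right_unitCell f := funext fun i => right_unitCell (f i)
  unitCell_id x := funext fun i => unitCell_id (x i)
  unitCell_comp f g := funext fun i => unitCell_comp (f i) (g i)
  pcomp m n i := m i ⊙ n i
  hcomp α β h i := hcomp (α i) (β i) (congrFun h i)
  left_hcomp α β h := funext fun i => left_hcomp (α i) (β i) (congrFun h i)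
  right_hcomp α β h := funext fun i => right_hcomp (α i) (β i) (congrFun h i)
  hcomp_cid m n _ := funext fun i => hcomp_cid (m i) (n i) _
  hcomp_vcomp α β α' β' h h' _ := funext fun i =>
    hcomp_vcomp (α i) (β i) (α' i) (β' i) (congrFun h i) (congrFun h' i) _
  assocHom m n k i := assocHom (m i) (n i) (k i)
  assocInv m n k i := assocInv (m i) (n i) (k i)
  left_assocHom m n k := funext fun i => left_assocHom (m i) (n i) (k i)
  right_assocHom m n k := funext fun i => right_assocHom (m i) (n i) (k i)
  assocHom_inv m n k := funext fun i => assocHom_inv (m i) (n i) (k i)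
  assocInv_hom m n k := funext fun i => assocInv_hom (m i) (n i) (k i)
  assoc_naturality α β γ h h' h₁ h₂ := funext fun i =>
    assoc_naturality (α i) (β i) (γ i) (congrFun h i) (congrFun h' i) (congrFun h₁ i)
      (congrFun h₂ i)
  lunitHom m i := lunitHom (m i)
  lunitInv m i := lunitInv (m i)
  left_lunitHom m := funext fun i => left_lunitHom (m i)
  right_lunitHom m := funext fun i => right_lunitHom (m i)
  lunitHom_inv m := funext fun i => lunitHom_inv (m i)
  lunitInv_hom m := funext fun i => lunitInv_hom (m i)
  lunit_naturality α h := funext fun i => lunit_naturality (α i) (congrFun h i)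
  runitHom m i := runitHom (m i)
  runitInv m i := runitInv (m i)
  left_runitHom m := funext fun i => left_runitHom (m i)
  right_runitHom m := funext fun i => right_runitHom (m i)
  runitHom_inv m := funext fun i => runitHom_inv (m i)
  runitInv_hom m := funext fun i => runitInv_hom (m i)
  runit_naturality α h := funext fun i => runit_naturality (α i) (congrFun h i)
  pentagon m n k l h h' := funext fun i =>
    pentagon (m i) (n i) (k i) (l i) (congrFun h i) (congrFun h' i)
  triangle m n h h' := funext fun i => triangle (m i) (n i) (congrFun h i) (congrFun h' i)

end DoubleCategory

open DoubleCategory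

/-- A lax double functor between double categories. -/
structure LaxDoubleFunctor (D : Type u₁) [DoubleCategory.{u₁, v₁, p₁, c₁} D]
    (E : Type u₂) [DoubleCategory.{u₂, v₂, p₂, c₂} E] extends D ⥤ E where
  mapPro : {x y : D} → Pro x y → Pro (obj x) (obj y)
  mapCell : {x y w z : D} → {m : Pro x y} → {n : Pro w z} → Cell m n → Cell (mapPro m) (mapPro n)
  left_mapCell : ∀ {x y w z : D} {m : Pro x y} {n : Pro w z} (α : Cell m n),
    left (mapCell α) = map (left α)
  right_mapCell : ∀ {x y w z : D} {m : Pro x y} {n : Pro w z} (α : Cell m n),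
    right (mapCell α) = map (right α)
  mapCell_cid : ∀ {x y : D} (m : Pro x y), mapCell (cid m) = cid (mapPro m)
  mapCell_vcomp : ∀ {x y x' y' x'' y'' : D} {m : Pro x y} {n : Pro x' y'} {k : Pro x'' y''}
    (α : Cell m n) (β : Cell n k), mapCell (α ≫ᵥ β) = mapCell α ≫ᵥ mapCell β
  -- composition and identity comparisons
  comp : {x y z : D} → (m : Pro x y) → (n : Pro y z) →
    Cell (mapPro m ⊙ mapPro n) (mapPro (m ⊙ n))
  left_comp : ∀ {x y z : D} (m : Pro x y) (n : Pro y z), left (comp m n) = 𝟙 (obj x)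
  right_comp : ∀ {x y z : D} (m : Pro x y) (n : Pro y z), right (comp m n) = 𝟙 (obj z)
  comp_naturality : ∀ {x y z x' y' z' : D} {m : Pro x y} {n : Pro y z} {m' : Pro x' y'}
    {n' : Pro y' z'} (α : Cell m m') (β : Cell n n') (h : right α = left β)
    (h' : right (mapCell α) = left (mapCell β)),
    hcomp (mapCell α) (mapCell β) h' ≫ᵥ comp m' n' = comp m n ≫ᵥ mapCell (hcomp α β h)
  idn : (x : D) → Cell (unit (obj x)) (mapPro (unit x))
  left_idn : ∀ x : D, left (idn x) = 𝟙 (obj x)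
  right_idn : ∀ x : D, right (idn x) = 𝟙 (obj x)
  idn_naturality : ∀ {x y : D} (f : x ⟶ y),
    unitCell (map f) ≫ᵥ idn y = idn x ≫ᵥ mapCell (unitCell f)
  -- coherence
  map_assoc : ∀ {x y z t : D} (m : Pro x y) (n : Pro y z) (k : Pro z t)
    (h : right (comp m n) = left (cid (mapPro k))) (h' : right (cid (mapPro m)) = left (comp n k)),
    hcomp (comp m n) (cid (mapPro k)) h ≫ᵥ comp (m ⊙ n) k ≫ᵥ mapCell (assocHom m n k) =
      assocHom (mapPro m) (mapPro n) (mapPro k) ≫ᵥ hcomp (cid (mapPro m)) (comp n k) h' ≫ᵥ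
        comp m (n ⊙ k)
  map_lunit : ∀ {x y : D} (m : Pro x y) (h : right (idn x) = left (cid (mapPro m))),
    hcomp (idn x) (cid (mapPro m)) h ≫ᵥ comp (unit x) m ≫ᵥ mapCell (lunitHom m) =
      lunitHom (mapPro m)
  map_runit : ∀ {x y : D} (m : Pro x y) (h : right (cid (mapPro m)) = left (idn y)),
    hcomp (cid (mapPro m)) (idn y) h ≫ᵥ comp m (unit y) ≫ᵥ mapCell (runitHom m) =
      runitHom (mapPro m)

namespace LaxDoubleFunctor

attribute [simp] left_mapCell right_mapCell mapCell_cid mapCell_vcomp left_comp right_comp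
  left_idn right_idn

variable {C : Type u₁} [DoubleCategory.{u₁, v₁, p₁, c₁} C]
  {D : Type u₂} [DoubleCategory.{u₂, v₂, p₂, c₂} D] {E : Type u₃} [DoubleCategory.{u₃, v₃, p₃, c₃} E]

/-- Composition of lax double functors, in diagrammatic order. -/
def compose (F : LaxDoubleFunctor C D) (G : LaxDoubleFunctor D E) : LaxDoubleFunctor C E where
  toFunctor := F.toFunctor ⋙ G.toFunctor
  mapPro m := G.mapPro (F.mapPro m)
  mapCell α := G.mapCell (F.mapCell α)
  left_mapCell α := by simp
  right_mapCell α := by simp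
  mapCell_cid m := by simp
  mapCell_vcomp α β := by simp
  comp m n := G.comp (F.mapPro m) (F.mapPro n) ≫ᵥ G.mapCell (F.comp m n)
  left_comp m n := by simp
  right_comp m n := by simp
  comp_naturality α β h h' := by
    rw [← vcomp_assoc, G.comp_naturality _ _ (by simp [h]), vcomp_assoc, vcomp_assoc,
      ← G.mapCell_vcomp, ← G.mapCell_vcomp, F.comp_naturality]
  idn x := G.idn (F.obj x) ≫ᵥ G.mapCell (F.idn x)
  left_idn x := by simp
  right_idn x := by simp
  idn_naturality f := by
    rw [vcomp_assoc, ← G.mapCell_vcomp, ← F.idn_naturality, G.mapCell_vcomp, ← vcomp_assoc,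
      ← vcomp_assoc, ← G.idn_naturality]
    rfl
  map_assoc m n k h h' := by
    have e₁ := hcomp_vcomp (G.comp (F.mapPro m) (F.mapPro n)) (cid (G.mapPro (F.mapPro k)))
      (G.mapCell (F.comp m n)) (G.mapCell (cid (F.mapPro k))) (by simp) (by simp) (by simp)
    have e₂ := hcomp_vcomp (cid (G.mapPro (F.mapPro m))) (G.comp (F.mapPro n) (F.mapPro k))
      (G.mapCell (cid (F.mapPro m))) (G.mapCell (F.comp n k)) (by simp) (by simp) (by simp)
    have e₃ := G.comp_naturality (F.comp m n) (cid (F.mapPro k)) (by simp) (by simp)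
    have e₄ := G.comp_naturality (cid (F.mapPro m)) (F.comp n k) (by simp) (by simp)
    have e₅ := G.map_assoc (F.mapPro m) (F.mapPro n) (F.mapPro k) (by simp) (by simp)
    have e₆ := congrArg G.mapCell (F.map_assoc m n k (by simp) (by simp))
    simp only [mapCell_cid, cid_vcomp, mapCell_vcomp] at e₁ e₂ e₃ e₄ e₅ e₆
    rw [e₁, e₂]
    simp only [vcomp_assoc]
    rw [← vcomp_assoc _ (G.comp _ _), e₃, vcomp_assoc, e₆, ← vcomp_assoc (G.comp _ _),
      ← vcomp_assoc, e₅, ← vcomp_assoc _ (G.comp (F.mapPro m) _), e₄]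
    simp only [vcomp_assoc]
  map_lunit m h := by
    have e₁ := hcomp_vcomp (G.idn _) (cid (G.mapPro (F.mapPro m)))
      (G.mapCell (F.idn _)) (G.mapCell (cid (F.mapPro m))) (by simp) (by simp) (by simp)
    have e₃ := G.comp_naturality (F.idn _) (cid (F.mapPro m)) (by simp) (by simp)
    have e₅ := G.map_lunit (F.mapPro m) (by simp)
    have e₆ := congrArg G.mapCell (F.map_lunit m (by simp))
    simp only [mapCell_cid, cid_vcomp, mapCell_vcomp] at e₁ e₃ e₅ e₆
    rw [e₁]
    simp only [vcomp_assoc]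
    rw [← vcomp_assoc _ (G.comp _ _), e₃, vcomp_assoc, e₆, e₅]
  map_runit m h := by
    have e₁ := hcomp_vcomp (cid (G.mapPro (F.mapPro m))) (G.idn _)
      (G.mapCell (cid (F.mapPro m))) (G.mapCell (F.idn _)) (by simp) (by simp) (by simp)
    have e₃ := G.comp_naturality (cid (F.mapPro m)) (F.idn _) (by simp) (by simp)
    have e₅ := G.map_runit (F.mapPro m) (by simp)
    have e₆ := congrArg G.mapCell (F.map_runit m (by simp))
    simp only [mapCell_cid, cid_vcomp, mapCell_vcomp] at e₁ e₃ e₅ e₆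
    rw [e₁]
    simp only [vcomp_assoc]
    rw [← vcomp_assoc _ (G.comp _ _), e₃, vcomp_assoc, e₆, e₅]

end LaxDoubleFunctor

/-- The (strict) double functor `D^f : D^J → D^I` reindexing families along `f : I → J`. -/
def reindex {D : Type u} [DoubleCategory.{u, v, p, c} D] {I J : Type w} (f : I → J) :
    LaxDoubleFunctor (J → D) (I → D) where
  obj x i := x (f i)
  map g i := g (f i)
  mapPro m i := m (f i)
  mapCell α i := α (f i)
  left_mapCell _ := rfl
  right_mapCell _ := rfl
  mapCell_cid _ := rfl
  mapCell_vcomp _ _ := rfl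
  comp m n := cid (D := I → D) (fun i => m (f i) ⊙ n (f i))
  left_comp m n := left_cid (D := I → D) _
  right_comp m n := right_cid (D := I → D) _
  comp_naturality α β h h' := (vcomp_cid (D := I → D) _).trans (cid_vcomp (D := I → D) _).symm
  idn x := cid (D := I → D) (fun i => unit (x (f i)))
  left_idn x := left_cid (D := I → D) _
  right_idn x := right_cid (D := I → D) _
  idn_naturality g := (vcomp_cid (D := I → D) _).trans (cid_vcomp (D := I → D) _).symm
  map_assoc m n k h h' := by
    funext i
    change hcomp (D := D) (cid _) (cid _) _ ≫ᵥ cid _ ≫ᵥ assocHom _ _ _ =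
      assocHom _ _ _ ≫ᵥ hcomp (cid _) (cid _) _ ≫ᵥ cid _
    simp
  map_lunit m h := by
    funext i
    change hcomp (D := D) (cid _) (cid _) _ ≫ᵥ cid _ ≫ᵥ lunitHom _ = lunitHom _
    simp
  map_runit m h := by
    funext i
    change hcomp (D := D) (cid _) (cid _) _ ≫ᵥ cid _ ≫ᵥ runitHom _ = runitHom _
    simp

/-- A natural transformation between lax double functors. -/
@[ext]
structure DoubleNatTrans {D : Type u₁} [DoubleCategory.{u₁, v₁, p₁, c₁} D]
    {E : Type u₂} [DoubleCategory.{u₂, v₂, p₂, c₂} E] (F G : LaxDoubleFunctor D E) where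
  app : (x : D) → (F.obj x ⟶ G.obj x)
  cell : {x y : D} → (m : Pro x y) → Cell (F.mapPro m) (G.mapPro m)
  left_cell : ∀ {x y : D} (m : Pro x y), left (cell m) = app x
  right_cell : ∀ {x y : D} (m : Pro x y), right (cell m) = app y
  naturality : ∀ {x y : D} (f : x ⟶ y), F.map f ≫ app y = app x ≫ G.map f
  cell_naturality : ∀ {x y w z : D} {m : Pro x y} {n : Pro w z} (α : Cell m n),
    F.mapCell α ≫ᵥ cell n = cell m ≫ᵥ G.mapCell α
  comp_cell : ∀ {x y z : D} (m : Pro x y) (n : Pro y z) (h : right (cell m) = left (cell n)),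
    F.comp m n ≫ᵥ cell (m ⊙ n) = hcomp (cell m) (cell n) h ≫ᵥ G.comp m n
  idn_cell : ∀ x : D, F.idn x ≫ᵥ cell (unit x) = unitCell (app x) ≫ᵥ G.idn x

namespace DoubleNatTrans

attribute [simp] left_cell right_cell

end DoubleNatTrans

section LaxPs

variable {D : Type u₁} [DoubleCategory.{u₁, v₁, p₁, c₁} D]
  {E : Type u₂} [DoubleCategory.{u₂, v₂, p₂, c₂} E]

/-- Lax double functors and natural transformations form a category, with everything defined
componentwise. -/
instance laxDoubleFunctorCategory : Category (LaxDoubleFunctor D E) where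
  Hom F G := DoubleNatTrans F G
  id F :=
    { app x := 𝟙 (F.obj x)
      cell m := cid (F.mapPro m)
      left_cell m := by simp
      right_cell m := by simp
      naturality f := by simp
      cell_naturality α := by simp
      comp_cell m n h := by simp
      idn_cell x := by simp }
  comp α β :=
    { app x := α.app x ≫ β.app x
      cell m := α.cell m ≫ᵥ β.cell m
      left_cell m := by simp
      right_cell m := by simp
      naturality f := by
        rw [← Category.assoc, α.naturality, Category.assoc, β.naturality, Category.assoc]
      cell_naturality γ := by
        rw [← vcomp_assoc, α.cell_naturality, vcomp_assoc, β.cell_naturality, vcomp_assoc]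
      comp_cell m n h := by
        rw [← vcomp_assoc, α.comp_cell _ _ (by simp), vcomp_assoc, β.comp_cell _ _ (by simp),
          ← vcomp_assoc, hcomp_vcomp]
      idn_cell x := by
        rw [← vcomp_assoc, α.idn_cell, vcomp_assoc, β.idn_cell, ← vcomp_assoc, unitCell_comp] }
  id_comp α := by ext <;> simp
  comp_id α := by ext <;> simp
  assoc α β γ := by ext <;> simp

@[simp] theorem laxDoubleFunctor_id_app (F : LaxDoubleFunctor D E) (x : D) :
    DoubleNatTrans.app (𝟙 F) x = 𝟙 (F.obj x) := rfl

@[simp] theorem laxDoubleFunctor_id_cell (F : LaxDoubleFunctor D E) {x y : D} (m : Pro x y) :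
    DoubleNatTrans.cell (𝟙 F) m = cid (F.mapPro m) := rfl

@[simp] theorem laxDoubleFunctor_comp_app {F G H : LaxDoubleFunctor D E} (α : F ⟶ G) (β : G ⟶ H)
    (x : D) : DoubleNatTrans.app (α ≫ β) x = DoubleNatTrans.app α x ≫ DoubleNatTrans.app β x := rfl

@[simp] theorem laxDoubleFunctor_comp_cell {F G H : LaxDoubleFunctor D E} (α : F ⟶ G) (β : G ⟶ H)
    {x y : D} (m : Pro x y) :
    DoubleNatTrans.cell (α ≫ β) m = DoubleNatTrans.cell α m ≫ᵥ DoubleNatTrans.cell β m := rfl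

end LaxPs

section Bicategory

/-- The objects of a double category, regarded as the objects of its underlying bicategory. -/
structure UBicat (E : Type u) where
  obj : E

/-- A globular cell: a cell whose boundary arrows are identities. -/
@[ext]
structure GlobCell {E : Type u} [DoubleCategory.{u, v, p, c} E] {x y : E} (m n : Pro x y) where
  val : Cell m n
  left_val : left val = 𝟙 x
  right_val : right val = 𝟙 y

attribute [simp] GlobCell.left_val GlobCell.right_val

instance globCellCategory {E : Type u} [DoubleCategory.{u, v, p, c} E] (x y : E) :
    Category (Pro x y) where
  Hom m n := GlobCell m n
  id m := ⟨cid m, left_cid m, right_cid m⟩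
  comp α β := ⟨α.val ≫ᵥ β.val, by simp, by simp⟩
  id_comp α := GlobCell.ext (cid_vcomp _)
  comp_id α := GlobCell.ext (vcomp_cid _)
  assoc α β γ := GlobCell.ext (vcomp_assoc _ _ _)


section

variable {E : Type u} [DoubleCategory.{u, v, p, c} E]

/-- Left whiskering of a globular cell. -/
def whiskL {x y z : E} (m : Pro x y) {n n' : Pro y z} (α : n ⟶ n') : m ⊙ n ⟶ m ⊙ n' :=
  GlobCell.mk (hcomp (cid m) α.val (by simp)) (by simp) (by simp)

/-- Right whiskering of a globular cell. -/
def whiskR {x y z : E} {m m' : Pro x y} (α : m ⟶ m') (n : Pro y z) : m ⊙ n ⟶ m' ⊙ n :=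
  GlobCell.mk (hcomp α.val (cid n) (by simp)) (by simp) (by simp)

/-- The associator as an isomorphism of proarrows. -/
def assocIso {x y z t : E} (m : Pro x y) (n : Pro y z) (k : Pro z t) :
    (m ⊙ n) ⊙ k ≅ m ⊙ n ⊙ k where
  hom := GlobCell.mk (assocHom m n k) (by simp) (by simp)
  inv := GlobCell.mk (assocInv m n k) (by simp) (by simp)
  hom_inv_id := GlobCell.ext (assocHom_inv m n k)
  inv_hom_id := GlobCell.ext (assocInv_hom m n k)

/-- The left unitor as an isomorphism of proarrows. -/
def lunitIso {x y : E} (m : Pro x y) : unit x ⊙ m ≅ m where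
  hom := GlobCell.mk (lunitHom m) (by simp) (by simp)
  inv := GlobCell.mk (lunitInv m) (by simp) (by simp)
  hom_inv_id := GlobCell.ext (lunitHom_inv m)
  inv_hom_id := GlobCell.ext (lunitInv_hom m)

/-- The right unitor as an isomorphism of proarrows. -/
def runitIso {x y : E} (m : Pro x y) : m ⊙ unit y ≅ m where
  hom := GlobCell.mk (runitHom m) (by simp) (by simp)
  inv := GlobCell.mk (runitInv m) (by simp) (by simp)
  hom_inv_id := GlobCell.ext (runitHom_inv m)
  inv_hom_id := GlobCell.ext (runitInv_hom m)

end

/-- The underlying bicategory of a double category: objects, proarrows and globular cells. -/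
instance underlyingBicategory (E : Type u) [DoubleCategory.{u, v, p, c} E] :
    Bicategory.{c, p} (UBicat E) where
  Hom x y := Pro x.obj y.obj
  id x := unit x.obj
  comp m n := pcomp m n
  homCategory x y := globCellCategory x.obj y.obj
  whiskerLeft m _ _ η := whiskL m η
  whiskerRight η n := whiskR η n
  associator m n k := assocIso m n k
  leftUnitor m := lunitIso m
  rightUnitor m := runitIso m
  whiskerLeft_id m n := GlobCell.ext (hcomp_cid _ _ _)
  whiskerLeft_comp m _ _ _ η θ := GlobCell.ext (by
    change hcomp (cid m) (η.val ≫ᵥ θ.val) _ = hcomp _ _ _ ≫ᵥ hcomp _ _ _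
    rw [← hcomp_vcomp _ _ _ _ _ _ (by simp)]
    simp)
  id_whiskerLeft {x y m n} η := GlobCell.ext (by
    change hcomp (cid (unit x.obj)) η.val _ = lunitHom m ≫ᵥ η.val ≫ᵥ lunitInv n
    have := lunit_naturality η.val (by simp)
    simp only [η.left_val, unitCell_id] at this
    rw [← vcomp_assoc, ← this]
    simp)
  comp_whiskerLeft m n k k' η := GlobCell.ext (by
    have e := assoc_naturality (cid m) (cid n) η.val (by simp) (by simp) (by simp) (by simp)
    have e' := congrArg (fun t => t ≫ᵥ assocInv m n k') e
    simp only [vcomp_assoc, hcomp_cid, assocHom_inv, vcomp_cid] at e'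
    exact e')
  id_whiskerRight m n := GlobCell.ext (hcomp_cid _ _ _)
  comp_whiskerRight η θ n := GlobCell.ext (by
    change hcomp (η.val ≫ᵥ θ.val) (cid n) _ = hcomp _ _ _ ≫ᵥ hcomp _ _ _
    rw [← hcomp_vcomp _ _ _ _ _ _ (by simp)]
    simp)
  whiskerRight_id {x y m n} η := GlobCell.ext (by
    change hcomp η.val (cid (unit y.obj)) _ = runitHom m ≫ᵥ η.val ≫ᵥ runitInv n
    have := runit_naturality η.val (by simp)
    simp only [η.right_val, unitCell_id] at this
    rw [← vcomp_assoc, ← this]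
    simp)
  whiskerRight_comp {_ _ _ _ m m'} η n k := GlobCell.ext (by
    change hcomp η.val (cid (n ⊙ k)) _ = assocInv m n k ≫ᵥ
      hcomp (hcomp η.val (cid n) _) (cid k) _ ≫ᵥ assocHom m' n k
    rw [assoc_naturality _ _ _ (by simp) (by simp) (by simp) (by simp), ← vcomp_assoc]
    simp)
  whisker_assoc m n n' η k := GlobCell.ext (by
    have e := assoc_naturality (cid m) η.val (cid k) (by simp) (by simp) (by simp) (by simp)
    have e' := congrArg (fun t => t ≫ᵥ assocInv m n' k) e
    simp only [vcomp_assoc, assocHom_inv, vcomp_cid] at e'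
    exact e')
  whisker_exchange η θ := GlobCell.ext (by
    change hcomp _ _ _ ≫ᵥ hcomp _ _ _ = hcomp _ _ _ ≫ᵥ hcomp _ _ _
    rw [← hcomp_vcomp _ _ _ _ _ _ (by simp), ← hcomp_vcomp _ _ _ _ _ _ (by simp)]
    simp)
  pentagon m n k l := GlobCell.ext (pentagon m n k l _ _)
  triangle m n := GlobCell.ext (triangle m n _ _)

end Bicategory

section LaxPs

variable {D : Type u₁} [DoubleCategory.{u₁, v₁, p₁, c₁} D]
  {E : Type u₂} [DoubleCategory.{u₂, v₂, p₂, c₂} E]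

open Bicategory

/-- The lax functor between underlying bicategories given by a lax double functor. -/
def LaxDoubleFunctor.toLaxFunctor (F : LaxDoubleFunctor D E) :
    LaxFunctor (UBicat D) (UBicat E) where
  obj x := ⟨F.obj x.obj⟩
  map m := F.mapPro m
  map₂ α := GlobCell.mk (F.mapCell α.val) (by simp) (by simp)
  map₂_id m := GlobCell.ext (F.mapCell_cid m)
  map₂_comp α β := GlobCell.ext (F.mapCell_vcomp α.val β.val)
  mapId x := GlobCell.mk (F.idn x.obj) (by simp) (by simp)
  mapComp m n := GlobCell.mk (F.comp m n) (by simp) (by simp)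
  mapComp_naturality_left α n := GlobCell.ext (by
    have e := F.comp_naturality α.val (cid n) (by simp) (by simp)
    simp only [F.mapCell_cid] at e
    exact e.symm)
  mapComp_naturality_right m _ _ α := GlobCell.ext (by
    have e := F.comp_naturality (cid m) α.val (by simp) (by simp)
    simp only [F.mapCell_cid] at e
    exact e.symm)
  map₂_associator m n k := GlobCell.ext (F.map_assoc m n k (by simp) (by simp))
  map₂_leftUnitor {x y} m := GlobCell.ext (by
    have e := F.map_lunit m (by simp)
    have e' := congrArg (fun t => lunitInv (F.mapPro m) ≫ᵥ t ≫ᵥ F.mapCell (lunitInv m)) e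
    simp only [vcomp_assoc, ← F.mapCell_vcomp, lunitHom_inv, F.mapCell_cid, vcomp_cid] at e'
    rw [← vcomp_assoc _ _ (F.mapCell _), lunitInv_hom, cid_vcomp] at e'
    exact e'.symm)
  map₂_rightUnitor {x y} m := GlobCell.ext (by
    have e := F.map_runit m (by simp)
    have e' := congrArg (fun t => runitInv (F.mapPro m) ≫ᵥ t ≫ᵥ F.mapCell (runitInv m)) e
    simp only [vcomp_assoc, ← F.mapCell_vcomp, runitHom_inv, F.mapCell_cid, vcomp_cid] at e'
    rw [← vcomp_assoc _ _ (F.mapCell _), runitInv_hom, cid_vcomp] at e'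
    exact e'.symm)

/-- A (pseudo) protransformation between lax double functors: a lax protransformation whose
naturality comparisons `nat m` are invertible. -/
structure Protransformation (F G : LaxDoubleFunctor D E) where
  app : (x : D) → Pro (F.obj x) (G.obj x)
  map : {x y : D} → (f : x ⟶ y) → Cell (app x) (app y)
  left_map : ∀ {x y : D} (f : x ⟶ y), left (map f) = F.map f
  right_map : ∀ {x y : D} (f : x ⟶ y), right (map f) = G.map f
  map_id : ∀ x : D, map (𝟙 x) = cid (app x)
  map_comp : ∀ {x y z : D} (f : x ⟶ y) (g : y ⟶ z), map (f ≫ g) = map f ≫ᵥ map g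
  nat : {x y : D} → (m : Pro x y) → Cell (app x ⊙ G.mapPro m) (F.mapPro m ⊙ app y)
  left_nat : ∀ {x y : D} (m : Pro x y), left (nat m) = 𝟙 (F.obj x)
  right_nat : ∀ {x y : D} (m : Pro x y), right (nat m) = 𝟙 (G.obj y)
  nat_invertible : ∀ {x y : D} (m : Pro x y), IsInvertible (nat m)
  nat_cell : ∀ {x y w z : D} {m : Pro x y} {n : Pro w z} (α : Cell m n)
    (h : right (F.mapCell α) = left (map (right α))) (h' : right (map (left α)) = left (G.mapCell α)),
    nat m ≫ᵥ hcomp (F.mapCell α) (map (right α)) h = hcomp (map (left α)) (G.mapCell α) h' ≫ᵥ nat n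
  nat_comp : ∀ {x y z : D} (m : Pro x y) (n : Pro y z)
    (h₁ : right (cid (app x)) = left (G.comp m n))
    (h₂ : right (nat m) = left (cid (G.mapPro n))) (h₃ : right (cid (F.mapPro m)) = left (nat n))
    (h₄ : right (F.comp m n) = left (cid (app z))),
    hcomp (cid (app x)) (G.comp m n) h₁ ≫ᵥ nat (m ⊙ n) =
      assocInv (app x) (G.mapPro m) (G.mapPro n) ≫ᵥ hcomp (nat m) (cid (G.mapPro n)) h₂ ≫ᵥ
        assocHom (F.mapPro m) (app y) (G.mapPro n) ≫ᵥ hcomp (cid (F.mapPro m)) (nat n) h₃ ≫ᵥ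
          assocInv (F.mapPro m) (F.mapPro n) (app z) ≫ᵥ hcomp (F.comp m n) (cid (app z)) h₄
  nat_unit : ∀ (x : D) (h₁ : right (cid (app x)) = left (G.idn x))
    (h₂ : right (F.idn x) = left (cid (app x))),
    hcomp (cid (app x)) (G.idn x) h₁ ≫ᵥ nat (unit x) =
      runitHom (app x) ≫ᵥ lunitInv (app x) ≫ᵥ hcomp (F.idn x) (cid (app x)) h₂

namespace Protransformation

attribute [simp] left_map right_map map_id map_comp left_nat right_nat

variable {F G H K : LaxDoubleFunctor D E}

/-- The transformation between lax functors of bicategories given by a protransformation. -/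
def toLaxTrans (τ : Protransformation F G) :
    Lax.LaxTrans F.toLaxFunctor G.toLaxFunctor where
  app x := τ.app x.obj
  naturality m := GlobCell.mk (τ.nat m) (τ.left_nat m) (τ.right_nat m)
  naturality_naturality α := GlobCell.ext (by
    have e := τ.nat_cell α.val (by simp) (by simp)
    simp only [α.left_val, α.right_val, τ.map_id] at e
    exact e)
  naturality_id x := GlobCell.ext (τ.nat_unit x.obj (by simp) (by simp))
  naturality_comp m n := GlobCell.ext (τ.nat_comp m n (by simp) (by simp) (by simp) (by simp))

end Protransformation

theorem DoubleCategory.IsInvertible.vcomp {x y x' y' x'' y'' : E} {m : Pro x y} {n : Pro x' y'} {k : Pro x'' y''}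
    {α : Cell m n} {β : Cell n k} (hα : IsInvertible α) (hβ : IsInvertible β) :
    IsInvertible (α ≫ᵥ β) := by
  obtain ⟨α', h₁, h₂⟩ := hα
  obtain ⟨β', h₃, h₄⟩ := hβ
  refine ⟨β' ≫ᵥ α', ?_, ?_⟩
  · rw [vcomp_assoc, ← vcomp_assoc β, h₃, cid_vcomp, h₁]
  · rw [vcomp_assoc, ← vcomp_assoc α', h₂, cid_vcomp, h₄]

theorem DoubleCategory.IsInvertible.whiskL {x y z : E} (m : Pro x y) {n n' : Pro y z} {α : Cell n n'}
    (hα : IsInvertible α) (h : right (cid m) = left α) :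
    IsInvertible (hcomp (cid m) α h) := by
  obtain ⟨α', h₁, h₂⟩ := hα
  have h' : right (cid m) = left α' := by
    rw [left_eq_id_of_inv h₁ (by rw [← h]; simp)]; simp
  refine ⟨hcomp (cid m) α' h', ?_, ?_⟩
  · rw [← hcomp_vcomp _ _ _ _ _ _ (by simp [← h, ← h'])]
    simp [h₁]
  · rw [← hcomp_vcomp _ _ _ _ _ _ (by simp [← h, ← h'])]
    simp [h₂]

theorem DoubleCategory.IsInvertible.whiskR {x y z : E} {m m' : Pro x y} {α : Cell m m'} (n : Pro y z)
    (hα : IsInvertible α) (h : right α = left (cid n)) :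
    IsInvertible (hcomp α (cid n) h) := by
  obtain ⟨α', h₁, h₂⟩ := hα
  have h' : right α' = left (cid n) := by
    rw [right_eq_id_of_inv h₁ (by rw [h]; simp)]; simp
  refine ⟨hcomp α' (cid n) h', ?_, ?_⟩
  · rw [← hcomp_vcomp _ _ _ _ _ _ (by simp [h, h'])]
    simp [h₁]
  · rw [← hcomp_vcomp _ _ _ _ _ _ (by simp [h, h'])]
    simp [h₂]

theorem isInvertible_assocHom {x y z t : E} (m : Pro x y) (n : Pro y z) (k : Pro z t) :
    IsInvertible (assocHom m n k) := ⟨_, assocHom_inv m n k, assocInv_hom m n k⟩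

theorem isInvertible_assocInv {x y z t : E} (m : Pro x y) (n : Pro y z) (k : Pro z t) :
    IsInvertible (assocInv m n k) := ⟨_, assocInv_hom m n k, assocHom_inv m n k⟩

/-- Pasting of two squares of cells along their common side. -/
theorem paste_squares {x₁ x₂ x₃ y₁ y₂ y₃ w₁ w₂ w₃ z₁ z₂ z₃ : E}
    {f : Pro x₁ y₁} {g : Pro x₂ y₂} {k : Pro x₃ y₃} {q : Pro x₁ x₂} {r : Pro x₂ x₃}
    {q' : Pro y₁ y₂} {r' : Pro y₂ y₃}
    {F : Pro w₁ z₁} {G : Pro w₂ z₂} {K : Pro w₃ z₃} {Q : Pro w₁ w₂} {R : Pro w₂ w₃}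
    {Q' : Pro z₁ z₂} {R' : Pro z₂ z₃}
    {s : Cell (q ⊙ g) (f ⊙ q')} {S : Cell (Q ⊙ G) (F ⊙ Q')}
    {t : Cell (r ⊙ k) (g ⊙ r')} {T : Cell (R ⊙ K) (G ⊙ R')}
    {a : Cell f F} {b : Cell g G} {c : Cell k K} {μ : Cell q Q} {ν : Cell r R}
    {μ' : Cell q' Q'} {ν' : Cell r' R'}
    {h₁ : right a = left μ'} {h₂ : right μ = left b} {h₃ : right b = left ν'}
    {h₄ : right ν = left c}
    (hs : s ≫ᵥ hcomp a μ' h₁ = hcomp μ b h₂ ≫ᵥ S) (ht : t ≫ᵥ hcomp b ν' h₃ = hcomp ν c h₄ ≫ᵥ T)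
    (hμ : right μ = left ν) (hμ' : right μ' = left ν')
    (ls : right (cid q) = left t) (lS : right (cid Q) = left T)
    (rs : right s = left (cid r')) (rS : right S = left (cid R'))
    (e₁ : right a = left (hcomp μ' ν' hμ')) (e₂ : right (hcomp μ ν hμ) = left c)
    (e₃ : right (hcomp μ b h₂) = left ν') (e₄ : right μ = left (hcomp ν c h₄)) :
    (assocHom q r k ≫ᵥ hcomp (cid q) t ls ≫ᵥ assocInv q g r' ≫ᵥ hcomp s (cid r') rs ≫ᵥ
      assocHom f q' r') ≫ᵥ hcomp a (hcomp μ' ν' hμ') e₁ =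
    hcomp (hcomp μ ν hμ) c e₂ ≫ᵥ (assocHom Q R K ≫ᵥ hcomp (cid Q) T lS ≫ᵥ assocInv Q G R' ≫ᵥ
      hcomp S (cid R') rS ≫ᵥ assocHom F Q' R') := by
  have a₁ := assoc_naturality a μ' ν' h₁ hμ' (by simp [hμ']) e₁
  have a₂ := assoc_naturality μ b ν' h₂ h₃ e₃ (by simp [h₂])
  have a₃ := assoc_naturality μ ν c hμ h₄ e₂ e₄
  have b₁ := hcomp_vcomp s (cid r') (hcomp a μ' h₁) ν' rs (by simp [hμ'])
    (by simpa [rs] using hμ')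
  have b₂ := hcomp_vcomp (hcomp μ b h₂) ν' S (cid R') e₃ rS (by simp [h₃, rS])
  have b₃ := hcomp_vcomp (cid q) t μ (hcomp b ν' h₃) ls (by simp [h₂]) (by simp [← ls, h₂])
  have b₄ := hcomp_vcomp μ (hcomp ν c h₄) (cid Q) T e₄ lS (by simp [hμ, ← lS])
  have a₂' : assocInv _ _ _ ≫ᵥ hcomp (hcomp μ b h₂) ν' e₃ =
      hcomp μ (hcomp b ν' h₃) (by simp [h₂]) ≫ᵥ assocInv _ _ _ := by
    have := congrArg (fun t => assocInv _ _ _ ≫ᵥ t ≫ᵥ assocInv _ _ _) a₂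
    simp only [vcomp_assoc, assocHom_inv, vcomp_cid] at this
    rw [← vcomp_assoc (assocInv _ _ _) (assocHom _ _ _), assocInv_hom, cid_vcomp] at this
    exact this
  simp only [cid_vcomp, vcomp_cid, hs, ht] at b₁ b₂ b₃ b₄
  simp only [vcomp_assoc]
  rw [← a₁, ← vcomp_assoc _ _ (assocHom _ _ _), ← b₁, b₂, vcomp_assoc,
    ← vcomp_assoc (assocInv _ _ _), a₂', vcomp_assoc, ← vcomp_assoc _ _ (assocInv _ _ _ ≫ᵥ _),
    ← b₃, b₄, vcomp_assoc, ← vcomp_assoc, ← a₃, vcomp_assoc]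

namespace Protransformation

variable {F G H K : LaxDoubleFunctor D E}

/-- The identity protransformation. -/
def idn (F : LaxDoubleFunctor D E) : Protransformation F F where
  app x := unit (F.obj x)
  map f := unitCell (F.map f)
  left_map f := by simp
  right_map f := by simp
  map_id x := by simp
  map_comp f g := by simp [unitCell_comp]
  nat m := lunitHom (F.mapPro m) ≫ᵥ runitInv (F.mapPro m)
  left_nat m := by simp
  right_nat m := by simp
  nat_invertible m := IsInvertible.vcomp ⟨_, lunitHom_inv _, lunitInv_hom _⟩
    ⟨_, runitInv_hom _, runitHom_inv _⟩
  nat_cell {x y w z m n} α h h' := by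
    have e₁ := runit_naturality (F.mapCell α) (by simp)
    have e₂ := lunit_naturality (F.mapCell α) (by simp)
    have e₃ := congrArg (fun t => runitInv _ ≫ᵥ t ≫ᵥ runitInv _) e₁
    simp only [F.left_mapCell, F.right_mapCell] at e₁ e₂ e₃
    simp only [vcomp_assoc, runitHom_inv, vcomp_cid] at e₃
    rw [← vcomp_assoc (runitInv _) (runitHom _), runitInv_hom, cid_vcomp] at e₃
    rw [vcomp_assoc, e₃, ← vcomp_assoc, ← e₂, vcomp_assoc]
  nat_comp m n h₁ h₂ h₃ h₄ := congrArg GlobCell.val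
    ((Lax.LaxTrans.id F.toLaxFunctor).naturality_comp (a := ⟨_⟩) (b := ⟨_⟩) (c := ⟨_⟩) m n)
  nat_unit x h₁ h₂ := congrArg GlobCell.val
    ((Lax.LaxTrans.id F.toLaxFunctor).naturality_id ⟨x⟩)

/-- The composite of protransformations. -/
def comp (σ : Protransformation F G) (τ : Protransformation G H) : Protransformation F H where
  app x := σ.app x ⊙ τ.app x
  map f := hcomp (σ.map f) (τ.map f) (by simp)
  left_map f := by simp
  right_map f := by simp
  map_id x := by simp
  map_comp f g := by
    rw [← hcomp_vcomp _ _ _ _ _ _ (by simp)]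
    simp
  nat {x y} m := assocHom (σ.app x) (τ.app x) (H.mapPro m) ≫ᵥ
    hcomp (cid (σ.app x)) (τ.nat m) (by simp) ≫ᵥ
      assocInv (σ.app x) (G.mapPro m) (τ.app y) ≫ᵥ
        hcomp (σ.nat m) (cid (τ.app y)) (by simp) ≫ᵥ
          assocHom (F.mapPro m) (σ.app y) (τ.app y)
  left_nat m := by simp
  right_nat m := by simp
  nat_invertible {x y} m := (isInvertible_assocHom _ _ _).vcomp
    (((τ.nat_invertible m).whiskL _ _).vcomp ((isInvertible_assocInv _ _ _).vcomp
      (((σ.nat_invertible m).whiskR _ _).vcomp (isInvertible_assocHom _ _ _))))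
  nat_cell {x y w z m n} α h h' := (paste_squares (σ.nat_cell α (by simp) (by simp))
    (τ.nat_cell α (by simp) (by simp)) (by simp) (by simp) (by simp) (by simp) (by simp) (by simp)
    (by simp) (by simp) (by simp) (by simp))
  nat_comp m n h₁ h₂ h₃ h₄ := congrArg GlobCell.val
    ((σ.toLaxTrans.vComp τ.toLaxTrans).naturality_comp (a := ⟨_⟩) (b := ⟨_⟩) (c := ⟨_⟩) m n)
  nat_unit x h₁ h₂ := congrArg GlobCell.val
    ((σ.toLaxTrans.vComp τ.toLaxTrans).naturality_id ⟨x⟩)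

end Protransformation

end LaxPs

section BicategoryLemmas

open Bicategory

variable {B : Type u} [Bicategory.{p, v} B]

theorem bicat_assoc_lemma {x₁ x₂ x₃ x₄ y₁ y₂ y₃ y₄ : B} {f : x₁ ⟶ y₁} {g : x₂ ⟶ y₂} {h : x₃ ⟶ y₃}
    {k : x₄ ⟶ y₄} {q : x₁ ⟶ x₂} {r : x₂ ⟶ x₃} {t : x₃ ⟶ x₄} {q' : y₁ ⟶ y₂} {r' : y₂ ⟶ y₃}
    {t' : y₃ ⟶ y₄} (σ : q ≫ g ⟶ f ≫ q') (τ : r ≫ h ⟶ g ≫ r') (ρ : t ≫ k ⟶ h ≫ t') :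
    (α_ q r t).hom ▷ k ≫ (α_ q (r ≫ t) k).hom ≫
      q ◁ ((α_ r t k).hom ≫ r ◁ ρ ≫ (α_ r h t').inv ≫ τ ▷ t' ≫ (α_ g r' t').hom) ≫
      (α_ q g (r' ≫ t')).inv ≫ σ ▷ (r' ≫ t') ≫ (α_ f q' (r' ≫ t')).hom =
    ((α_ (q ≫ r) t k).hom ≫ (q ≫ r) ◁ ρ ≫ (α_ (q ≫ r) h t').inv ≫
      ((α_ q r h).hom ≫ q ◁ τ ≫ (α_ q g r').inv ≫ σ ▷ r' ≫ (α_ f q' r').hom) ▷ t' ≫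
      (α_ f (q' ≫ r') t').hom) ≫ f ◁ (α_ q' r' t').hom := by
  bicategory

theorem bicat_lunit_lemma {x₁ x₂ y₁ y₂ : B} {f : x₁ ⟶ y₁} {g : x₂ ⟶ y₂} {q : x₁ ⟶ x₂}
    {q' : y₁ ⟶ y₂} (σ : q ≫ g ⟶ f ≫ q') :
    (λ_ q).hom ▷ g ≫ σ =
      ((α_ (𝟙 x₁) q g).hom ≫ (𝟙 x₁) ◁ σ ≫ (α_ (𝟙 x₁) f q').inv ≫
        ((λ_ f).hom ≫ (ρ_ f).inv) ▷ q' ≫ (α_ f (𝟙 y₁) q').hom) ≫ f ◁ (λ_ q').hom := by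
  bicategory

theorem bicat_runit_lemma {x₁ x₂ y₁ y₂ : B} {f : x₁ ⟶ y₁} {g : x₂ ⟶ y₂} {q : x₁ ⟶ x₂}
    {q' : y₁ ⟶ y₂} (σ : q ≫ g ⟶ f ≫ q') :
    (ρ_ q).hom ▷ g ≫ σ =
      ((α_ q (𝟙 x₂) g).hom ≫ q ◁ ((λ_ g).hom ≫ (ρ_ g).inv) ≫ (α_ q g (𝟙 y₂)).inv ≫
        σ ▷ (𝟙 y₂) ≫ (α_ f q' (𝟙 y₂)).hom) ≫ f ◁ (ρ_ q').hom := by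
  bicategory

end BicategoryLemmas

section LaxPs

variable {D : Type u₁} [DoubleCategory.{u₁, v₁, p₁, c₁} D]
  {E : Type u₂} [DoubleCategory.{u₂, v₂, p₂, c₂} E]

/-- A modification between protransformations, bounded by natural transformations. -/
@[ext]
structure Modification {F G H K : LaxDoubleFunctor D E} (σ : Protransformation F G)
    (τ : Protransformation H K) where
  src : F ⟶ H
  tgt : G ⟶ K
  app : (x : D) → Cell (σ.app x) (τ.app x)
  left_app : ∀ x : D, left (app x) = DoubleNatTrans.app src x
  right_app : ∀ x : D, right (app x) = DoubleNatTrans.app tgt x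
  app_map : ∀ {x y : D} (f : x ⟶ y), app x ≫ᵥ τ.map f = σ.map f ≫ᵥ app y
  app_nat : ∀ {x y : D} (m : Pro x y) (h : right (app x) = left (DoubleNatTrans.cell tgt m))
    (h' : right (DoubleNatTrans.cell src m) = left (app y)),
    hcomp (app x) (DoubleNatTrans.cell tgt m) h ≫ᵥ τ.nat m =
      σ.nat m ≫ᵥ hcomp (DoubleNatTrans.cell src m) (app y) h'

namespace Modification

attribute [simp] left_app right_app

variable {F G H K : LaxDoubleFunctor D E}

/-- The inverse of a modification with identity boundaries and invertible components. -/
def inverse {σ τ : Protransformation F G} (μ : Modification σ τ) (hs : μ.src = 𝟙 F)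
    (ht : μ.tgt = 𝟙 G) (ν : ∀ x, Cell (τ.app x) (σ.app x)) (h₁ : ∀ x, μ.app x ≫ᵥ ν x = cid _)
    (h₂ : ∀ x, ν x ≫ᵥ μ.app x = cid _) : Modification τ σ where
  src := 𝟙 F
  tgt := 𝟙 G
  app := ν
  left_app x := left_eq_id_of_inv (h₁ x) (by rw [left_app, hs]; rfl)
  right_app x := right_eq_id_of_inv (h₁ x) (by rw [right_app, ht]; rfl)
  app_map {x y} f := by
    have := congrArg (fun t => ν x ≫ᵥ t ≫ᵥ ν y) (μ.app_map f)
    simp only [vcomp_assoc, h₁, vcomp_cid] at this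
    rw [← vcomp_assoc (ν x) (μ.app x), h₂, cid_vcomp] at this
    exact this.symm
  app_nat {x y} m h h' := by
    have e := μ.app_nat m (by simp) (by simp)
    have hx : right (μ.app x) = left (cid (G.mapPro m)) := by
      rw [right_app, ht, left_cid]; rfl
    have hy : right (cid (F.mapPro m)) = left (μ.app y) := by
      rw [left_app, hs, right_cid]; rfl
    have e' : hcomp (μ.app x) (cid (G.mapPro m)) hx ≫ᵥ τ.nat m =
        σ.nat m ≫ᵥ hcomp (cid (F.mapPro m)) (μ.app y) hy := by
      simpa only [hs, ht, laxDoubleFunctor_id_cell] using e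
    simp only [laxDoubleFunctor_id_cell] at h h' ⊢
    have i₁ := hcomp_vcomp (ν x) (cid (G.mapPro m)) (μ.app x) (cid (G.mapPro m)) h hx
      (by simp [h₂])
    have i₂ := hcomp_vcomp (cid (F.mapPro m)) (μ.app y) (cid (F.mapPro m)) (ν y) hy h'
      (by simp [h₁])
    simp only [h₁, h₂, cid_vcomp, hcomp_cid] at i₁ i₂
    have := congrArg (fun t => hcomp (ν x) (cid (G.mapPro m)) h ≫ᵥ t ≫ᵥ
      hcomp (cid (F.mapPro m)) (ν y) h') e'
    simp only [vcomp_assoc, ← i₂, vcomp_cid] at this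
    rw [← vcomp_assoc _ (hcomp (μ.app x) _ _), ← i₁, cid_vcomp] at this
    exact this.symm

/-- The identity modification. -/
def cid (σ : Protransformation F G) : Modification σ σ where
  src := 𝟙 F
  tgt := 𝟙 G
  app x := DoubleCategory.cid (σ.app x)
  left_app x := by simp
  right_app x := by simp
  app_map f := by simp
  app_nat m h h' := by simp

/-- The vertical composite of modifications. -/
def vcomp {F' G' F'' G'' : LaxDoubleFunctor D E} {σ : Protransformation F G}
    {τ : Protransformation F' G'} {ρ : Protransformation F'' G''} (μ : Modification σ τ)
    (ν : Modification τ ρ) : Modification σ ρ where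
  src := μ.src ≫ ν.src
  tgt := μ.tgt ≫ ν.tgt
  app x := μ.app x ≫ᵥ ν.app x
  left_app x := by simp
  right_app x := by simp
  app_map f := by
    rw [vcomp_assoc, ν.app_map, ← vcomp_assoc, μ.app_map, vcomp_assoc]
  app_nat m h h' := by
    have i₁ := hcomp_vcomp (μ.app _) (DoubleNatTrans.cell μ.tgt m) (ν.app _)
      (DoubleNatTrans.cell ν.tgt m) (by simp) (by simp) h
    have i₂ := hcomp_vcomp (DoubleNatTrans.cell μ.src m) (μ.app _)
      (DoubleNatTrans.cell ν.src m) (ν.app _) (by simp) (by simp) h'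
    simp only [laxDoubleFunctor_comp_cell]
    rw [i₁, i₂, vcomp_assoc, ν.app_nat, ← vcomp_assoc, μ.app_nat, vcomp_assoc]

/-- The external identity modification on a natural transformation. -/
def unitCell (α : F ⟶ G) : Modification (Protransformation.idn F) (Protransformation.idn G) where
  src := α
  tgt := α
  app x := DoubleCategory.unitCell (DoubleNatTrans.app α x)
  left_app x := left_unitCell _
  right_app x := right_unitCell _
  app_map f := by
    change DoubleCategory.unitCell _ ≫ᵥ DoubleCategory.unitCell _ =
      DoubleCategory.unitCell _ ≫ᵥ DoubleCategory.unitCell _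
    rw [← unitCell_comp, ← unitCell_comp, DoubleNatTrans.naturality α f]
  app_nat {x y} m h h' := by
    have e₁ := lunit_naturality (DoubleNatTrans.cell α m) (by simp)
    have e₂ := runit_naturality (DoubleNatTrans.cell α m) (by simp)
    have e₃ := congrArg (fun t => runitInv _ ≫ᵥ t ≫ᵥ runitInv _) e₂
    simp only [DoubleNatTrans.left_cell, DoubleNatTrans.right_cell] at e₁ e₃
    simp only [vcomp_assoc, runitHom_inv, vcomp_cid] at e₃
    rw [← vcomp_assoc (runitInv _) (runitHom _), runitInv_hom, cid_vcomp] at e₃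
    have e₄ := congrArg (fun t => t ≫ᵥ runitInv _) e₁
    have e₅ := congrArg (fun t => lunitHom _ ≫ᵥ t) e₃
    simp only [vcomp_assoc] at e₄ e₅
    exact (e₄.trans e₅.symm).trans (vcomp_assoc _ _ _).symm

/-- The horizontal composite of modifications. -/
def hcomp {H' F₁ G₁ : LaxDoubleFunctor D E} {σ : Protransformation F G}
    {τ : Protransformation G H} {σ' : Protransformation F₁ G₁} {τ' : Protransformation G₁ H'}
    (μ : Modification σ σ') (ν : Modification τ τ') (hμν : μ.tgt = ν.src) :
    Modification (σ.comp τ) (σ'.comp τ') where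
  src := μ.src
  tgt := ν.tgt
  app x := DoubleCategory.hcomp (μ.app x) (ν.app x) (by rw [μ.right_app, ν.left_app, hμν])
  left_app x := (left_hcomp _ _ _).trans (μ.left_app x)
  right_app x := (right_hcomp _ _ _).trans (ν.right_app x)
  app_map f := by
    have e : right (σ.map f ≫ᵥ μ.app _) = left (τ.map f ≫ᵥ ν.app _) := by
      simp [hμν]
    have i₁ := hcomp_vcomp (μ.app _) (ν.app _) (σ'.map f) (τ'.map f)
      (by rw [μ.right_app, ν.left_app, hμν]) (by simp) (by rw [μ.app_map, ν.app_map]; exact e)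
    have i₂ := hcomp_vcomp (σ.map f) (τ.map f) (μ.app _) (ν.app _) (by simp)
      (by rw [μ.right_app, ν.left_app, hμν]) e
    simp only [μ.app_map, ν.app_map] at i₁
    exact i₁.symm.trans i₂
  app_nat {x y} m h h' := by
    have e₁ := (μ.app_nat m (by simp) (by simp)).symm
    have e₂ := (ν.app_nat m (by simp) (by simp)).symm
    simp only [hμν] at e₁
    exact (paste_squares e₁ e₂ (by simp [hμν]) (by simp [hμν]) (by simp) (by simp) (by simp)
      (by simp) (by simp) (by simp) (by simp) (by simp [hμν])).symm

/-- The associator modification. -/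
def assoc (σ : Protransformation F G) (τ : Protransformation G H) (ρ : Protransformation H K) :
    Modification ((σ.comp τ).comp ρ) (σ.comp (τ.comp ρ)) where
  src := 𝟙 F
  tgt := 𝟙 K
  app _ := assocHom _ _ _
  left_app _ := left_assocHom _ _ _
  right_app _ := right_assocHom _ _ _
  app_map _ := (assoc_naturality _ _ _ _ _ _ _).symm
  app_nat {x y} m _ _ := congrArg GlobCell.val
    ((bicat_assoc_lemma (B := UBicat E)
      (σ.toLaxTrans.naturality (a := ⟨x⟩) (b := ⟨y⟩) m)
      (τ.toLaxTrans.naturality (a := ⟨x⟩) (b := ⟨y⟩) m)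
      (ρ.toLaxTrans.naturality (a := ⟨x⟩) (b := ⟨y⟩) m)))

/-- The left unitor modification. -/
def lunit (σ : Protransformation F G) : Modification ((Protransformation.idn F).comp σ) σ where
  src := 𝟙 F
  tgt := 𝟙 G
  app x := lunitHom (σ.app x)
  left_app x := left_lunitHom _
  right_app x := right_lunitHom _
  app_map {x y} f := by
    have := lunit_naturality (σ.map f) (by simp)
    simp only [σ.left_map] at this
    exact this.symm
  app_nat {x y} m h h' := congrArg GlobCell.val
    (bicat_lunit_lemma (B := UBicat E) (σ.toLaxTrans.naturality (a := ⟨x⟩) (b := ⟨y⟩) m))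

/-- The right unitor modification. -/
def runit (σ : Protransformation F G) : Modification (σ.comp (Protransformation.idn G)) σ where
  src := 𝟙 F
  tgt := 𝟙 G
  app x := runitHom (σ.app x)
  left_app x := left_runitHom _
  right_app x := right_runitHom _
  app_map {x y} f := by
    have := runit_naturality (σ.map f) (by simp)
    simp only [σ.right_map] at this
    exact this.symm
  app_nat {x y} m h h' := congrArg GlobCell.val
    (bicat_runit_lemma (B := UBicat E) (σ.toLaxTrans.naturality (a := ⟨x⟩) (b := ⟨y⟩) m))

end Modification

/-- The double category of lax double functors, natural transformations, (pseudo)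
protransformations and modifications. -/
instance laxPs : DoubleCategory (LaxDoubleFunctor D E) where
  toCategory := laxDoubleFunctorCategory
  Pro F G := Protransformation F G
  Cell σ τ := Modification σ τ
  left μ := μ.src
  right μ := μ.tgt
  cid σ := Modification.cid σ
  vcomp μ ν := Modification.vcomp μ ν
  left_cid _ := rfl
  right_cid _ := rfl
  left_vcomp _ _ := rfl
  right_vcomp _ _ := rfl
  cid_vcomp μ := Modification.ext (Category.id_comp _) (Category.id_comp _)
    (funext fun _ => cid_vcomp _)
  vcomp_cid μ := Modification.ext (Category.comp_id _) (Category.comp_id _)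
    (funext fun _ => vcomp_cid _)
  vcomp_assoc μ ν ξ := Modification.ext (Category.assoc _ _ _) (Category.assoc _ _ _)
    (funext fun _ => vcomp_assoc _ _ _)
  unit F := Protransformation.idn F
  unitCell α := Modification.unitCell α
  left_unitCell _ := rfl
  right_unitCell _ := rfl
  unitCell_id F := Modification.ext rfl rfl (funext fun _ => unitCell_id _)
  unitCell_comp α β := Modification.ext rfl rfl (funext fun _ => unitCell_comp _ _)
  pcomp σ τ := σ.comp τ
  hcomp μ ν h := Modification.hcomp μ ν h
  left_hcomp _ _ _ := rfl
  right_hcomp _ _ _ := rfl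
  hcomp_cid σ τ h := Modification.ext rfl rfl (funext fun _ => hcomp_cid _ _ _)
  hcomp_vcomp _ _ _ _ _ _ _ := Modification.ext rfl rfl
    (funext fun _ => hcomp_vcomp _ _ _ _ _ _ _)
  assocHom σ τ ρ := Modification.assoc σ τ ρ
  assocInv σ τ ρ := (Modification.assoc σ τ ρ).inverse rfl rfl (fun _ => assocInv _ _ _)
    (fun _ => assocHom_inv _ _ _) (fun _ => assocInv_hom _ _ _)
  left_assocHom _ _ _ := rfl
  right_assocHom _ _ _ := rfl
  assocHom_inv _ _ _ := Modification.ext (Category.id_comp _) (Category.id_comp _)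
    (funext fun _ => assocHom_inv _ _ _)
  assocInv_hom _ _ _ := Modification.ext (Category.id_comp _) (Category.id_comp _)
    (funext fun _ => assocInv_hom _ _ _)
  assoc_naturality μ ν ξ h h' h₁ h₂ := Modification.ext
    ((Category.comp_id _).trans (Category.id_comp _).symm)
    ((Category.comp_id _).trans (Category.id_comp _).symm)
    (funext fun _ => assoc_naturality _ _ _ _ _ _ _)
  lunitHom σ := Modification.lunit σ
  lunitInv σ := (Modification.lunit σ).inverse rfl rfl (fun _ => lunitInv _)
    (fun _ => lunitHom_inv _) (fun _ => lunitInv_hom _)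
  left_lunitHom _ := rfl
  right_lunitHom _ := rfl
  lunitHom_inv _ := Modification.ext (Category.id_comp _) (Category.id_comp _)
    (funext fun _ => lunitHom_inv _)
  lunitInv_hom _ := Modification.ext (Category.id_comp _) (Category.id_comp _)
    (funext fun _ => lunitInv_hom _)
  lunit_naturality μ h := Modification.ext
    ((Category.comp_id _).trans (Category.id_comp _).symm)
    ((Category.comp_id _).trans (Category.id_comp _).symm)
    (funext fun x => by
      have := lunit_naturality (μ.app x) (by simp)
      simp only [μ.left_app] at this
      exact this)
  runitHom σ := Modification.runit σ
  runitInv σ := (Modification.runit σ).inverse rfl rfl (fun _ => runitInv _)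
    (fun _ => runitHom_inv _) (fun _ => runitInv_hom _)
  left_runitHom _ := rfl
  right_runitHom _ := rfl
  runitHom_inv _ := Modification.ext (Category.id_comp _) (Category.id_comp _)
    (funext fun _ => runitHom_inv _)
  runitInv_hom _ := Modification.ext (Category.id_comp _) (Category.id_comp _)
    (funext fun _ => runitInv_hom _)
  runit_naturality μ h := Modification.ext
    ((Category.comp_id _).trans (Category.id_comp _).symm)
    ((Category.comp_id _).trans (Category.id_comp _).symm)
    (funext fun x => by
      have := runit_naturality (μ.app x) (by simp)
      simp only [μ.right_app] at this
      exact this)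
  pentagon _ _ _ _ _ _ := Modification.ext
    (by change 𝟙 _ ≫ 𝟙 _ ≫ 𝟙 _ = 𝟙 _ ≫ 𝟙 _; simp) (by change 𝟙 _ ≫ 𝟙 _ ≫ 𝟙 _ = 𝟙 _ ≫ 𝟙 _; simp)
    (funext fun _ => pentagon _ _ _ _ _ _)
  triangle _ _ _ _ := Modification.ext (Category.id_comp _) (Category.id_comp _)
    (funext fun _ => triangle _ _ _ _)

end LaxPs

section Coproducts

/-- The two kinds of index sets: finite sets, or arbitrary (small) sets. -/
inductive IndexSize
  | finite
  | small

/-- `s.Admits I`: the set `I` is allowed as an index set. -/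
class IndexSize.Admits (s : IndexSize) (I : Type w) : Prop where
  finite_of_eq : s = IndexSize.finite → Finite I

instance IndexSize.admits_prod (s : IndexSize) (I J : Type w) [s.Admits I] [s.Admits J] :
    s.Admits (I × J) where
  finite_of_eq h := by
    have := IndexSize.Admits.finite_of_eq (I := I) h
    have := IndexSize.Admits.finite_of_eq (I := J) h
    infer_instance

instance IndexSize.admits_subtype (s : IndexSize) (I : Type w) [s.Admits I] (P : I → Prop) :
    s.Admits {i // P i} where
  finite_of_eq h := by
    have := IndexSize.Admits.finite_of_eq (I := I) h
    infer_instance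

variable {D : Type u} [DoubleCategory.{u, v, p, c} D]

/-- A family of proarrows `m_a : x_{l a} ⇸ y_{r a}` indexed by a span `I ← A → J`, where `x` and
`y` are families of objects indexed by `I` and `J`. -/
structure SpanFamily {I J : Type w} (x : I → D) (y : J → D) where
  apex : Type w
  l : apex → I
  r : apex → J
  pro : ∀ a, Pro (x (l a)) (y (r a))

/-- The family `m : x ⇸ y` of proarrows over a common index set, indexed by the identity span. -/
@[reducible]
def SpanFamily.parallel {I : Type w} {x y : I → D} (m : ∀ i, Pro (x i) (y i)) : SpanFamily x y where
  apex := I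
  l := id
  r := id
  pro := m

/-- The family of identity proarrows, indexed by the identity span. -/
@[reducible]
def SpanFamily.unit {I : Type w} (x : I → D) : SpanFamily x x :=
  SpanFamily.parallel fun i => DoubleCategory.unit (x i)

/-- Transport of a proarrow along an equality of source objects. -/
def castSrc {y y' z : D} (h : y = y') (n : Pro y z) : Pro y' z := h ▸ n

/-- Transport of a cell along an equality of source objects of its top proarrow. -/
def castSrcCell {y y' z w t : D} (h : y = y') {n : Pro y z} {k : Pro w t} (α : Cell n k) :
    Cell (castSrc h n) k :=
  Eq.rec (motive := fun _ h => Cell (castSrc h n) k) α h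

theorem left_castSrcCell {y y' z w t : D} (h : y = y') {n : Pro y z} {k : Pro w t}
    (α : Cell n k) : left (castSrcCell h α) = eqToHom h.symm ≫ left α := by
  subst h; simp [castSrcCell]; rfl

theorem right_castSrcCell {y y' z w t : D} (h : y = y') {n : Pro y z} {k : Pro w t}
    (α : Cell n k) : right (castSrcCell h α) = right α := by
  subst h; rfl

/-- The composite of span-indexed families of proarrows: the family of composites `m_a ⊙ n_b`,
indexed by the composite span, whose apex is the pullback. -/
@[reducible]
def SpanFamily.comp {I J K : Type w} {x : I → D} {y : J → D} {z : K → D} (m : SpanFamily x y)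
    (n : SpanFamily y z) : SpanFamily x z where
  apex := {q : m.apex × n.apex // m.r q.1 = n.l q.2}
  l q := m.l q.1.1
  r q := n.r q.1.2
  pro q := m.pro q.1.1 ⊙ castSrc (congrArg y q.2.symm) (n.pro q.1.2)

/-- A cell from a span-indexed family of proarrows to a single proarrow `n : t ⇸ t'`: arrows out of
the source and target families together with compatible cells `m_a → n`. -/
structure SpanCocone {I J : Type w} {x : I → D} {y : J → D} (m : SpanFamily x y) {t t' : D}
    (n : Pro t t') where
  fst : ∀ i, x i ⟶ t
  snd : ∀ j, y j ⟶ t'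
  cell : ∀ a, Cell (m.pro a) n
  left_cell : ∀ a, left (cell a) = fst (m.l a)
  right_cell : ∀ a, right (cell a) = snd (m.r a)

/-- (Colax) coproducts in a double category: chosen coproducts of families of objects and of
span-indexed families of proarrows, with their universal properties. This is a choice of universal
arrows from the families of objects and from the span-indexed families of proarrows (the objects
and proarrows of the double category of families in `D`) to the diagonal `D → DblFam D`, compatible
with sources and targets; that is, a (colax) left adjoint of the diagonal. -/
structure DoubleCoproducts (s : IndexSize) (D : Type u) [DoubleCategory.{u, v, p, c} D] where
  obj : {I : Type w} → [s.Admits I] → (I → D) → D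
  ι : {I : Type w} → [s.Admits I] → (x : I → D) → (i : I) → (x i ⟶ obj x)
  desc : {I : Type w} → [s.Admits I] → {x : I → D} → {t : D} → (∀ i, x i ⟶ t) → (obj x ⟶ t)
  ι_desc : ∀ {I : Type w} [s.Admits I] {x : I → D} {t : D} (f : ∀ i, x i ⟶ t) (i : I),
    ι x i ≫ desc f = f i
  hom_ext : ∀ {I : Type w} [s.Admits I] {x : I → D} {t : D} (f g : obj x ⟶ t),
    (∀ i, ι x i ≫ f = ι x i ≫ g) → f = g
  pro : {I J : Type w} → [s.Admits I] → [s.Admits J] → {x : I → D} → {y : J → D} →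
    (m : SpanFamily x y) → [s.Admits m.apex] → Pro (obj x) (obj y)
  ιCell : {I J : Type w} → [s.Admits I] → [s.Admits J] → {x : I → D} → {y : J → D} →
    (m : SpanFamily x y) → [s.Admits m.apex] → (a : m.apex) → Cell (m.pro a) (pro m)
  left_ιCell : ∀ {I J : Type w} [s.Admits I] [s.Admits J] {x : I → D} {y : J → D}
    (m : SpanFamily x y) [s.Admits m.apex] (a : m.apex), left (ιCell m a) = ι x (m.l a)
  right_ιCell : ∀ {I J : Type w} [s.Admits I] [s.Admits J] {x : I → D} {y : J → D}
    (m : SpanFamily x y) [s.Admits m.apex] (a : m.apex), right (ιCell m a) = ι y (m.r a)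
  descCell : {I J : Type w} → [s.Admits I] → [s.Admits J] → {x : I → D} → {y : J → D} →
    {m : SpanFamily x y} → [s.Admits m.apex] → {t t' : D} → {n : Pro t t'} →
    SpanCocone m n → Cell (pro m) n
  left_descCell : ∀ {I J : Type w} [s.Admits I] [s.Admits J] {x : I → D} {y : J → D}
    {m : SpanFamily x y} [s.Admits m.apex] {t t' : D} {n : Pro t t'} (γ : SpanCocone m n),
    left (descCell γ) = desc γ.fst
  right_descCell : ∀ {I J : Type w} [s.Admits I] [s.Admits J] {x : I → D} {y : J → D}
    {m : SpanFamily x y} [s.Admits m.apex] {t t' : D} {n : Pro t t'} (γ : SpanCocone m n),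
    right (descCell γ) = desc γ.snd
  ιCell_descCell : ∀ {I J : Type w} [s.Admits I] [s.Admits J] {x : I → D} {y : J → D}
    {m : SpanFamily x y} [s.Admits m.apex] {t t' : D} {n : Pro t t'} (γ : SpanCocone m n)
    (a : m.apex), ιCell m a ≫ᵥ descCell γ = γ.cell a
  cell_ext : ∀ {I J : Type w} [s.Admits I] [s.Admits J] {x : I → D} {y : J → D}
    {m : SpanFamily x y} [s.Admits m.apex] {t t' : D} {n : Pro t t'} (α β : Cell (pro m) n),
    left α = left β → right α = right β → (∀ a, ιCell m a ≫ᵥ α = ιCell m a ≫ᵥ β) → α = β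

namespace DoubleCoproducts

attribute [simp] ι_desc left_ιCell right_ιCell left_descCell right_descCell ιCell_descCell

variable {s : IndexSize} (S : DoubleCoproducts.{w} s D)

theorem desc_ι {I : Type w} [s.Admits I] (x : I → D) : S.desc (S.ι x) = 𝟙 (S.obj x) :=
  S.hom_ext _ _ fun i => by simp

theorem eqToHom_ι {I : Type w} [s.Admits I] (x : I → D) {i i' : I} (h : i = i') :
    eqToHom (congrArg x h) ≫ S.ι x i' = S.ι x i := by
  subst h; simp

section

variable {I J K : Type w} [s.Admits I] [s.Admits J] [s.Admits K] {x : I → D} {y : J → D}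
  {z : K → D}

/-- The comparison cell `Σ (m ⊙ n) → Σ m ⊙ Σ n` induced by the universal property. -/
def compComparison (m : SpanFamily x y) (n : SpanFamily y z) [s.Admits m.apex]
    [s.Admits n.apex] : Cell (S.pro (m.comp n)) (S.pro m ⊙ S.pro n) :=
  S.descCell
    { fst := S.ι x
      snd := S.ι z
      cell q := hcomp (S.ιCell m q.1.1)
        (castSrcCell (congrArg y q.2.symm) (S.ιCell n q.1.2)) (by
          refine (S.right_ιCell m q.1.1).trans (Eq.trans ?_ (left_castSrcCell _ _).symm)
          rw [S.left_ιCell]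
          exact (S.eqToHom_ι y q.2).symm)
      left_cell q := by rw [left_hcomp, S.left_ιCell]
      right_cell q := by rw [right_hcomp, right_castSrcCell, S.right_ιCell] }

theorem ι_compComparison (m : SpanFamily x y) (n : SpanFamily y z) [s.Admits m.apex]
    [s.Admits n.apex] (q : (m.comp n).apex) :
    S.ιCell (m.comp n) q ≫ᵥ S.compComparison m n = hcomp (S.ιCell m q.1.1)
      (castSrcCell (congrArg y q.2.symm) (S.ιCell n q.1.2)) (by
        refine (S.right_ιCell m q.1.1).trans (Eq.trans ?_ (left_castSrcCell _ _).symm)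
        rw [S.left_ιCell]
        exact (S.eqToHom_ι y q.2).symm) := by
  rw [compComparison, ιCell_descCell]

/-- The comparison cell `Σ id_x → id_{Σ x}` induced by the universal property. -/
def unitComparison (x : I → D) : Cell (S.pro (SpanFamily.unit x)) (unit (S.obj x)) :=
  S.descCell
    { fst := S.ι x
      snd := S.ι x
      cell i := unitCell (S.ι x i)
      left_cell _ := left_unitCell _
      right_cell _ := right_unitCell _ }

end

end DoubleCoproducts

/-- Strong coproducts in a double category: coproducts that commute with external composition and
external identities, in that all comparison cells are invertible. Equivalently, the left adjoint
of the diagonal is a (pseudo) double functor. For `s = IndexSize.finite`, the index sets and the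
apexes of the spans are finite. -/
structure StrongCoproducts (s : IndexSize) (D : Type u) [DoubleCategory.{u, v, p, c} D] extends
    DoubleCoproducts.{w} s D where
  comp_invertible : ∀ {I J K : Type w} [s.Admits I] [s.Admits J] [s.Admits K] {x : I → D}
    {y : J → D} {z : K → D} (m : SpanFamily x y) (n : SpanFamily y z) [s.Admits m.apex]
    [s.Admits n.apex], IsInvertible (toDoubleCoproducts.compComparison m n)
  unit_invertible : ∀ {I : Type w} [s.Admits I] (x : I → D),
    IsInvertible (toDoubleCoproducts.unitComparison x)

/-- The inverse of an invertible cell. -/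
noncomputable def DoubleCategory.IsInvertible.inv {x y x' y' : D} {m : Pro x y} {n : Pro x' y'}
    {α : Cell m n} (h : IsInvertible α) : Cell n m := h.choose

theorem DoubleCategory.IsInvertible.hom_inv {x y x' y' : D} {m : Pro x y} {n : Pro x' y'}
    {α : Cell m n} (h : IsInvertible α) : α ≫ᵥ h.inv = cid m := h.choose_spec.1

theorem DoubleCategory.IsInvertible.inv_hom {x y x' y' : D} {m : Pro x y} {n : Pro x' y'}
    {α : Cell m n} (h : IsInvertible α) : h.inv ≫ᵥ α = cid n := h.choose_spec.2

namespace DoubleCoproducts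

variable {s : IndexSize} (S : DoubleCoproducts.{w} s D) {I J : Type w} [s.Admits I] [s.Admits J]

/-- The coproduct of a family of arrows. -/
def sigmaMap {x y : I → D} (f : ∀ i, x i ⟶ y i) : S.obj x ⟶ S.obj y :=
  S.desc fun i => f i ≫ S.ι y i

/-- The coproduct of a family of cells. -/
def sigmaCell {x y x' y' : I → D} {m : ∀ i, Pro (x i) (y i)} {n : ∀ i, Pro (x' i) (y' i)}
    (α : ∀ i, Cell (m i) (n i)) :
    Cell (S.pro (SpanFamily.parallel m)) (S.pro (SpanFamily.parallel n)) :=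
  S.descCell
    { fst i := left (α i) ≫ S.ι x' i
      snd i := right (α i) ≫ S.ι y' i
      cell i := α i ≫ᵥ S.ιCell (SpanFamily.parallel n) i
      left_cell i := by simp
      right_cell i := by simp }

/-- The comparison `Σ (m ⊙ n) → Σ m ⊙ Σ n` for parallel families of proarrows. -/
def sigmaDelta {x y z : I → D} (m : ∀ i, Pro (x i) (y i)) (n : ∀ i, Pro (y i) (z i)) :
    Cell (S.pro (SpanFamily.parallel fun i => m i ⊙ n i))
      (S.pro (SpanFamily.parallel m) ⊙ S.pro (SpanFamily.parallel n)) :=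
  S.descCell
    { fst := S.ι x
      snd := S.ι z
      cell i := hcomp (S.ιCell (SpanFamily.parallel m) i) (S.ιCell (SpanFamily.parallel n) i)
        (by simp)
      left_cell i := by simp
      right_cell i := by simp }

@[simp] theorem ι_sigmaMap {x y : I → D} (f : ∀ i, x i ⟶ y i) (i : I) :
    S.ι x i ≫ S.sigmaMap f = f i ≫ S.ι y i := S.ι_desc _ i

@[simp] theorem left_sigmaCell {x y x' y' : I → D} {m : ∀ i, Pro (x i) (y i)}
    {n : ∀ i, Pro (x' i) (y' i)} (α : ∀ i, Cell (m i) (n i)) :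
    left (S.sigmaCell α) = S.sigmaMap fun i => left (α i) := S.left_descCell _

@[simp] theorem right_sigmaCell {x y x' y' : I → D} {m : ∀ i, Pro (x i) (y i)}
    {n : ∀ i, Pro (x' i) (y' i)} (α : ∀ i, Cell (m i) (n i)) :
    right (S.sigmaCell α) = S.sigmaMap fun i => right (α i) := S.right_descCell _

@[simp] theorem ι_sigmaCell {x y x' y' : I → D} {m : ∀ i, Pro (x i) (y i)}
    {n : ∀ i, Pro (x' i) (y' i)} (α : ∀ i, Cell (m i) (n i)) (i : I) :
    S.ιCell (SpanFamily.parallel m) i ≫ᵥ S.sigmaCell α =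
      α i ≫ᵥ S.ιCell (SpanFamily.parallel n) i := by
  rw [sigmaCell, ιCell_descCell]

@[simp] theorem left_sigmaDelta {x y z : I → D} (m : ∀ i, Pro (x i) (y i))
    (n : ∀ i, Pro (y i) (z i)) : left (S.sigmaDelta m n) = 𝟙 (S.obj x) :=
  (S.left_descCell _).trans (S.desc_ι x)

@[simp] theorem right_sigmaDelta {x y z : I → D} (m : ∀ i, Pro (x i) (y i))
    (n : ∀ i, Pro (y i) (z i)) : right (S.sigmaDelta m n) = 𝟙 (S.obj z) :=
  (S.right_descCell _).trans (S.desc_ι z)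

theorem ι_sigmaDelta {x y z : I → D} (m : ∀ i, Pro (x i) (y i)) (n : ∀ i, Pro (y i) (z i))
    (i : I) : S.ιCell (SpanFamily.parallel fun i => m i ⊙ n i) i ≫ᵥ S.sigmaDelta m n =
      hcomp (S.ιCell (SpanFamily.parallel m) i) (S.ιCell (SpanFamily.parallel n) i) (by simp) := by
  rw [sigmaDelta, ιCell_descCell]

@[simp] theorem left_unitComparison (x : I → D) : left (S.unitComparison x) = 𝟙 (S.obj x) :=
  (S.left_descCell _).trans (S.desc_ι x)

@[simp] theorem right_unitComparison (x : I → D) : right (S.unitComparison x) = 𝟙 (S.obj x) :=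
  (S.right_descCell _).trans (S.desc_ι x)

theorem ι_unitComparison (x : I → D) (i : I) :
    S.ιCell (SpanFamily.unit x) i ≫ᵥ S.unitComparison x = unitCell (S.ι x i) := by
  rw [unitComparison, ιCell_descCell]

/-- A cell out of a parallel coproduct is determined by its boundary and its components. -/
theorem parallel_ext {x y : I → D} {m : ∀ i, Pro (x i) (y i)} {t t' : D} {n : Pro t t'}
    {α β : Cell (S.pro (SpanFamily.parallel m)) n} (h : ∀ i, S.ιCell (SpanFamily.parallel m) i ≫ᵥ α =
      S.ιCell (SpanFamily.parallel m) i ≫ᵥ β) : α = β := by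
  refine S.cell_ext _ _ (S.hom_ext _ _ fun i => ?_) (S.hom_ext _ _ fun i => ?_) h
  · simpa using congrArg left (h i)
  · simpa using congrArg right (h i)

theorem sigmaCell_cid {x y : I → D} (m : ∀ i, Pro (x i) (y i)) :
    (S.sigmaCell fun i => cid (m i)) = cid (S.pro (SpanFamily.parallel m)) :=
  S.parallel_ext fun i => by rw [ι_sigmaCell, vcomp_cid, cid_vcomp]

theorem sigmaDelta_naturality {x y z x' y' z' : I → D} {m : ∀ i, Pro (x i) (y i)}
    {n : ∀ i, Pro (y i) (z i)} {m' : ∀ i, Pro (x' i) (y' i)} {n' : ∀ i, Pro (y' i) (z' i)}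
    (α : ∀ i, Cell (m i) (m' i)) (β : ∀ i, Cell (n i) (n' i))
    (h : ∀ i, right (α i) = left (β i)) (h' : right (S.sigmaCell α) = left (S.sigmaCell β)) :
    (S.sigmaCell fun i => hcomp (α i) (β i) (h i)) ≫ᵥ S.sigmaDelta m' n' =
      S.sigmaDelta m n ≫ᵥ hcomp (S.sigmaCell α) (S.sigmaCell β) h' := by
  refine S.parallel_ext fun i => ?_
  rw [← vcomp_assoc, ι_sigmaCell, ← vcomp_assoc, ι_sigmaDelta, vcomp_assoc, ι_sigmaDelta,
    ← hcomp_vcomp _ _ _ _ _ _ (by simp [h]), ← hcomp_vcomp _ _ _ _ _ _ (by simp [h])]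
  simp only [ι_sigmaCell]

theorem sigmaDelta_assoc {x y z t : I → D} (m : ∀ i, Pro (x i) (y i)) (n : ∀ i, Pro (y i) (z i))
    (k : ∀ i, Pro (z i) (t i)) :
    S.sigmaDelta (fun i => m i ⊙ n i) k ≫ᵥ
      hcomp (S.sigmaDelta m n) (cid (S.pro (SpanFamily.parallel k))) (by simp) ≫ᵥ
        assocHom _ _ _ =
    (S.sigmaCell fun i => assocHom (m i) (n i) (k i)) ≫ᵥ S.sigmaDelta m (fun i => n i ⊙ k i) ≫ᵥ
      hcomp (cid (S.pro (SpanFamily.parallel m))) (S.sigmaDelta n k) (by simp) := by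
  refine S.parallel_ext fun i => ?_
  have a := assoc_naturality (S.ιCell (SpanFamily.parallel m) i) (S.ιCell (SpanFamily.parallel n) i)
    (S.ιCell (SpanFamily.parallel k) i) (by simp) (by simp) (by simp) (by simp)
  have b₁ := hcomp_vcomp (S.ιCell (SpanFamily.parallel fun i => m i ⊙ n i) i)
    (S.ιCell (SpanFamily.parallel k) i) (S.sigmaDelta m n) (cid _) (by simp) (by simp) (by simp)
  have b₂ := hcomp_vcomp (S.ιCell (SpanFamily.parallel m) i)
    (S.ιCell (SpanFamily.parallel fun i => n i ⊙ k i) i)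
    (cid _) (S.sigmaDelta n k) (by simp) (by simp) (by simp)
  simp only [ι_sigmaDelta, vcomp_cid] at b₁ b₂
  rw [← vcomp_assoc, ι_sigmaDelta, ← vcomp_assoc, ← b₁, a, ← vcomp_assoc (S.ιCell _ i),
    ι_sigmaCell, vcomp_assoc,
    ← vcomp_assoc (S.ιCell (SpanFamily.parallel fun i => m i ⊙ n i ⊙ k i) i), ι_sigmaDelta, ← b₂]

theorem sigmaDelta_lunit {x y : I → D} (m : ∀ i, Pro (x i) (y i)) :
    S.sigmaDelta (fun i => unit (x i)) m ≫ᵥ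
      hcomp (S.unitComparison x) (cid (S.pro (SpanFamily.parallel m))) (by simp) ≫ᵥ
        lunitHom _ = S.sigmaCell fun i => lunitHom (m i) := by
  refine S.parallel_ext fun i => ?_
  have a := lunit_naturality (S.ιCell (SpanFamily.parallel m) i) (by simp)
  have b := hcomp_vcomp (S.ιCell (SpanFamily.unit x) i) (S.ιCell (SpanFamily.parallel m) i)
    (S.unitComparison x) (cid _) (by simp) (by simp) (by simp)
  simp only [ι_unitComparison, vcomp_cid] at b
  simp only [S.left_ιCell] at a
  rw [← vcomp_assoc, ι_sigmaDelta, ← vcomp_assoc, ← b, ι_sigmaCell]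
  exact a

theorem sigmaDelta_runit {x y : I → D} (m : ∀ i, Pro (x i) (y i)) :
    S.sigmaDelta m (fun i => unit (y i)) ≫ᵥ
      hcomp (cid (S.pro (SpanFamily.parallel m))) (S.unitComparison y) (by simp) ≫ᵥ
        runitHom _ = S.sigmaCell fun i => runitHom (m i) := by
  refine S.parallel_ext fun i => ?_
  have a := runit_naturality (S.ιCell (SpanFamily.parallel m) i) (by simp)
  have b := hcomp_vcomp (S.ιCell (SpanFamily.parallel m) i) (S.ιCell (SpanFamily.unit y) i)
    (cid _) (S.unitComparison y) (by simp) (by simp) (by simp)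
  simp only [ι_unitComparison, vcomp_cid] at b
  simp only [S.right_ιCell] at a
  rw [← vcomp_assoc, ι_sigmaDelta, ← vcomp_assoc, ← b, ι_sigmaCell]
  exact a

/-- The structure arrow `Σ_{i : I} x_{f i} → Σ_{j : J} x_j` whose `i`-th component is the coprojection
at `f i`. -/
def structArrow (f : I → J) (x : J → D) : S.obj (fun i => x (f i)) ⟶ S.obj x :=
  S.desc fun i => S.ι x (f i)

/-- The structure cell `Σ_{i : I} m_{f i} → Σ_{j : J} m_j` whose `i`-th component is the coprojection
at `f i`. -/
def structCell (f : I → J) {x y : J → D} (m : ∀ j, Pro (x j) (y j)) :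
    Cell (S.pro (SpanFamily.parallel fun i => m (f i))) (S.pro (SpanFamily.parallel m)) :=
  S.descCell
    { fst i := S.ι x (f i)
      snd i := S.ι y (f i)
      cell i := S.ιCell (SpanFamily.parallel m) (f i)
      left_cell i := S.left_ιCell (SpanFamily.parallel m) (f i)
      right_cell i := S.right_ιCell (SpanFamily.parallel m) (f i) }

@[simp] theorem ι_structArrow (f : I → J) (x : J → D) (i : I) :
    S.ι (fun i => x (f i)) i ≫ S.structArrow f x = S.ι x (f i) := S.ι_desc _ i

@[simp] theorem left_structCell (f : I → J) {x y : J → D} (m : ∀ j, Pro (x j) (y j)) :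
    left (S.structCell f m) = S.structArrow f x := S.left_descCell _

@[simp] theorem right_structCell (f : I → J) {x y : J → D} (m : ∀ j, Pro (x j) (y j)) :
    right (S.structCell f m) = S.structArrow f y := S.right_descCell _

@[simp] theorem ι_structCell (f : I → J) {x y : J → D} (m : ∀ j, Pro (x j) (y j)) (i : I) :
    S.ιCell (SpanFamily.parallel fun i => m (f i)) i ≫ᵥ S.structCell f m =
      S.ιCell (SpanFamily.parallel m) (f i) := by
  rw [structCell, ιCell_descCell]

theorem structCell_sigmaDelta (f : I → J) {x y z : J → D} (m : ∀ j, Pro (x j) (y j))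
    (n : ∀ j, Pro (y j) (z j)) :
    (S.structCell f fun j => m j ⊙ n j) ≫ᵥ S.sigmaDelta m n =
      S.sigmaDelta (fun i => m (f i)) (fun i => n (f i)) ≫ᵥ
        hcomp (S.structCell f m) (S.structCell f n) (by simp) := by
  refine S.parallel_ext fun i => ?_
  have e := S.ι_structCell f (fun j => m j ⊙ n j) i
  rw [← vcomp_assoc, e, ι_sigmaDelta, ← vcomp_assoc, ι_sigmaDelta,
    ← hcomp_vcomp _ _ _ _ _ _ (by simp)]
  simp only [ι_structCell]

theorem structCell_unitComparison (f : I → J) (x : J → D) :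
    (S.structCell f fun j => unit (x j)) ≫ᵥ S.unitComparison x =
      S.unitComparison (fun i => x (f i)) ≫ᵥ unitCell (S.structArrow f x) := by
  refine S.parallel_ext fun i => ?_
  have e := S.ι_structCell f (fun j => unit (x j)) i
  rw [← vcomp_assoc, e, ι_unitComparison, ← vcomp_assoc, ι_unitComparison,
    ← unitCell_comp, ι_structArrow]

end DoubleCoproducts

theorem conj_eq {x₁ y₁ x₂ y₂ x₃ y₃ x₄ y₄ x₅ y₅ x₆ y₆ : D} {a : Pro x₁ y₁} {b : Pro x₂ y₂}
    {c : Pro x₃ y₃} {d : Pro x₄ y₄} {e : Pro x₅ y₅} {g : Pro x₆ y₆} {f₁ : Cell a b} {f₂ : Cell b c}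
    {α : Cell c d} {σ : Cell a e} {g₁ : Cell e g} {g₂ : Cell g d}
    {f₁' : Cell b a} {f₂' : Cell c b} {g₁' : Cell g e} {g₂' : Cell d g}
    (h : f₁ ≫ᵥ f₂ ≫ᵥ α = σ ≫ᵥ g₁ ≫ᵥ g₂) (i₁ : f₂' ≫ᵥ f₂ = cid c) (i₂ : f₁' ≫ᵥ f₁ = cid b)
    (i₃ : g₂ ≫ᵥ g₂' = cid g) (i₄ : g₁ ≫ᵥ g₁' = cid e) :
    f₂' ≫ᵥ f₁' ≫ᵥ σ = α ≫ᵥ g₂' ≫ᵥ g₁' := by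
  have := congrArg (fun t => f₂' ≫ᵥ f₁' ≫ᵥ t ≫ᵥ g₂' ≫ᵥ g₁') h
  simp only [vcomp_assoc] at this
  rw [← vcomp_assoc f₁' f₁, i₂, cid_vcomp, ← vcomp_assoc f₂' f₂, i₁, cid_vcomp,
    ← vcomp_assoc g₂ g₂', i₃, cid_vcomp, i₄, vcomp_cid] at this
  exact this.symm

theorem swap_inv {x₁ y₁ x₂ y₂ x₃ y₃ x₄ y₄ : D} {a : Pro x₁ y₁} {b : Pro x₂ y₂}
    {c : Pro x₃ y₃} {d : Pro x₄ y₄} {σ : Cell a b} {δ : Cell b d} {δ' : Cell a c} {τ : Cell c d}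
    {μ : Cell d b} {μ' : Cell c a} (h : σ ≫ᵥ δ = δ' ≫ᵥ τ) (i₁ : μ' ≫ᵥ δ' = cid c)
    (i₂ : δ ≫ᵥ μ = cid b) : μ' ≫ᵥ σ = τ ≫ᵥ μ := by
  have := congrArg (fun t => μ' ≫ᵥ t ≫ᵥ μ) h
  simp only [vcomp_assoc] at this
  rwa [i₂, vcomp_cid, ← vcomp_assoc μ' δ', i₁, cid_vcomp] at this

theorem conj_eq' {x₁ y₁ x₂ y₂ x₃ y₃ x₄ y₄ : D} {a : Pro x₁ y₁} {b : Pro x₂ y₂}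
    {c : Pro x₃ y₃} {d : Pro x₄ y₄} {f₁ : Cell a b} {f₂ : Cell b c}
    {α : Cell c d} {σ : Cell a d} {f₁' : Cell b a} {f₂' : Cell c b}
    (h : f₁ ≫ᵥ f₂ ≫ᵥ α = σ) (i₁ : f₂' ≫ᵥ f₂ = cid c) (i₂ : f₁' ≫ᵥ f₁ = cid b) :
    f₂' ≫ᵥ f₁' ≫ᵥ σ = α := by
  rw [← h, ← vcomp_assoc f₁' f₁, i₂, cid_vcomp, ← vcomp_assoc f₂' f₂, i₁, cid_vcomp]

namespace StrongCoproducts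

variable {s : IndexSize} (S : StrongCoproducts.{w} s D) {I J : Type w} [s.Admits I] [s.Admits J]

theorem sigmaDelta_invertible {x y z : I → D} (m : ∀ i, Pro (x i) (y i))
    (n : ∀ i, Pro (y i) (z i)) : IsInvertible (S.sigmaDelta m n) := by
  let c₁ : SpanCocone (SpanFamily.parallel fun i => m i ⊙ n i) (S.pro ((SpanFamily.parallel m).comp (SpanFamily.parallel n))) :=
    { fst := S.ι x
      snd := S.ι z
      cell i := S.ιCell ((SpanFamily.parallel m).comp (SpanFamily.parallel n)) ⟨(i, i), rfl⟩
      left_cell i := S.left_ιCell ((SpanFamily.parallel m).comp (SpanFamily.parallel n)) ⟨(i, i), rfl⟩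
      right_cell i := S.right_ιCell ((SpanFamily.parallel m).comp (SpanFamily.parallel n)) ⟨(i, i), rfl⟩ }
  let P := S.pro (SpanFamily.parallel fun i => m i ⊙ n i)
  let γ : ∀ q : ((SpanFamily.parallel m).comp (SpanFamily.parallel n)).apex, { α : Cell (((SpanFamily.parallel m).comp (SpanFamily.parallel n)).pro q) P //
      left α = S.ι x (((SpanFamily.parallel m).comp (SpanFamily.parallel n)).l q) ∧ right α = S.ι z (((SpanFamily.parallel m).comp (SpanFamily.parallel n)).r q) } := fun q =>
    match q with
    | ⟨(i, j), h⟩ => by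
      change i = j at h
      subst h
      exact ⟨S.ιCell (SpanFamily.parallel fun i => m i ⊙ n i) i,
        S.left_ιCell (SpanFamily.parallel fun i => m i ⊙ n i) i,
        S.right_ιCell (SpanFamily.parallel fun i => m i ⊙ n i) i⟩
  let c₂ : SpanCocone ((SpanFamily.parallel m).comp (SpanFamily.parallel n)) P :=
    { fst := S.ι x
      snd := S.ι z
      cell q := (γ q).1
      left_cell q := (γ q).2.1
      right_cell q := (γ q).2.2 }
  have hγ : ∀ i, (γ ⟨(i, i), rfl⟩).1 = S.ιCell (SpanFamily.parallel fun i => m i ⊙ n i) i :=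
    fun i => rfl
  have e₁ : S.descCell c₁ ≫ᵥ S.descCell c₂ = cid _ := S.parallel_ext fun i => by
    rw [← vcomp_assoc, S.ιCell_descCell, vcomp_cid]
    exact (S.ιCell_descCell c₂ ⟨(i, i), rfl⟩).trans (hγ i)
  have e₂ : S.descCell c₂ ≫ᵥ S.descCell c₁ = cid _ := by
    refine S.cell_ext _ _ ?_ ?_ fun q => ?_
    · rw [left_vcomp, S.left_descCell, S.left_descCell, left_cid]
      change S.desc (S.ι x) ≫ S.desc (S.ι x) = _
      simp [S.desc_ι]
    · rw [right_vcomp, S.right_descCell, S.right_descCell, right_cid]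
      change S.desc (S.ι z) ≫ S.desc (S.ι z) = _
      simp [S.desc_ι]
    · rw [← vcomp_assoc, S.ιCell_descCell, vcomp_cid]
      obtain ⟨⟨i, j⟩, h⟩ := q
      change i = j at h
      subst h
      exact S.ιCell_descCell c₁ i
  have e₃ : S.sigmaDelta m n = S.descCell c₁ ≫ᵥ S.compComparison (SpanFamily.parallel m) (SpanFamily.parallel n) :=
    S.parallel_ext fun i => by
      rw [S.ι_sigmaDelta, ← vcomp_assoc, S.ιCell_descCell]
      exact (S.ι_compComparison (SpanFamily.parallel m) (SpanFamily.parallel n)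
        ⟨(i, i), rfl⟩).symm
  rw [e₃]
  exact IsInvertible.vcomp ⟨_, e₁, e₂⟩ (S.comp_invertible (SpanFamily.parallel m) (SpanFamily.parallel n))

/-- The coproduct double functor `Σ : D^I → D`, given by coproducts of families of objects, arrows,
proarrows and cells over the index set `I`, with comparison cells inverse to the ones induced by
the universal property. -/
noncomputable def sigma (I : Type w) [s.Admits I] : LaxDoubleFunctor (I → D) D where
  obj x := S.obj x
  map f := S.sigmaMap f
  map_id x := S.hom_ext _ _ fun i => by
    rw [S.ι_sigmaMap, Category.comp_id]
    exact Category.id_comp _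
  map_comp {x y z} f g := S.hom_ext _ _ fun i => by
    rw [S.ι_sigmaMap, ← Category.assoc, S.ι_sigmaMap, Category.assoc, S.ι_sigmaMap]
    exact Category.assoc _ _ _
  mapPro m := S.pro (SpanFamily.parallel m)
  mapCell α := S.sigmaCell α
  left_mapCell α := S.left_sigmaCell α
  right_mapCell α := S.right_sigmaCell α
  mapCell_cid m := S.parallel_ext fun i => by
    rw [S.ι_sigmaCell, vcomp_cid]
    exact cid_vcomp _
  mapCell_vcomp α β := S.parallel_ext fun i => by
    rw [S.ι_sigmaCell, ← vcomp_assoc, S.ι_sigmaCell, vcomp_assoc, S.ι_sigmaCell]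
    exact vcomp_assoc _ _ _
  comp m n := (S.sigmaDelta_invertible m n).inv
  left_comp m n := left_eq_id_of_inv (S.sigmaDelta_invertible m n).hom_inv (S.left_sigmaDelta m n)
  right_comp m n :=
    right_eq_id_of_inv (S.sigmaDelta_invertible m n).hom_inv (S.right_sigmaDelta m n)
  comp_naturality {x y z x' y' z' m n m' n'} α β h h' := by
    have e := S.sigmaDelta_naturality α β (fun i => congrFun h i) h'
    have := congrArg (fun t => (S.sigmaDelta_invertible m n).inv ≫ᵥ t ≫ᵥ
      (S.sigmaDelta_invertible m' n').inv) e
    simp only [vcomp_assoc, IsInvertible.hom_inv, vcomp_cid] at this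
    rw [← vcomp_assoc _ (S.sigmaDelta m n), IsInvertible.inv_hom, cid_vcomp] at this
    exact this.symm
  idn x := (S.unit_invertible x).inv
  left_idn x := left_eq_id_of_inv (S.unit_invertible x).hom_inv (S.left_unitComparison x)
  right_idn x := right_eq_id_of_inv (S.unit_invertible x).hom_inv (S.right_unitComparison x)
  idn_naturality {x y} f := by
    have e : S.unitComparison x ≫ᵥ unitCell (S.sigmaMap f) =
        (S.sigmaCell fun i => unitCell (f i)) ≫ᵥ S.unitComparison y := by
      refine S.parallel_ext fun i => ?_
      rw [← vcomp_assoc, S.ι_unitComparison, ← vcomp_assoc, S.ι_sigmaCell, vcomp_assoc,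
        S.ι_unitComparison, ← unitCell_comp, ← unitCell_comp, S.ι_sigmaMap]
    have := congrArg (fun t => (S.unit_invertible x).inv ≫ᵥ t ≫ᵥ (S.unit_invertible y).inv) e
    simp only [vcomp_assoc, IsInvertible.hom_inv, vcomp_cid] at this
    rw [← vcomp_assoc _ (S.unitComparison x), IsInvertible.inv_hom, cid_vcomp] at this
    exact this
  map_assoc {x y z t} m n k h h' := by
    have e := S.sigmaDelta_assoc m n k
    have c₁ := hcomp_vcomp (S.sigmaDelta_invertible m n).inv (cid (S.pro (SpanFamily.parallel k)))
      (S.sigmaDelta m n) (cid _) h (by simp) (by simp [IsInvertible.inv_hom])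
    have c₂ := hcomp_vcomp (cid (S.pro (SpanFamily.parallel m))) (S.sigmaDelta n k) (cid _)
      (S.sigmaDelta_invertible n k).inv (by simp) h' (by simp [IsInvertible.hom_inv])
    simp only [IsInvertible.inv_hom, IsInvertible.hom_inv, cid_vcomp, hcomp_cid] at c₁ c₂
    have c₃ := (S.sigmaDelta_invertible (fun i => m i ⊙ n i) k).inv_hom
    have c₄ := (S.sigmaDelta_invertible m (fun i => n i ⊙ k i)).hom_inv
    exact conj_eq e c₁.symm c₃ c₂.symm c₄
  map_lunit m h := by
    have e := S.sigmaDelta_lunit m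
    have c₁ := hcomp_vcomp (S.unit_invertible _).inv (cid (S.pro (SpanFamily.parallel m)))
      (S.unitComparison _) (cid _) h (by simp) (by simp [IsInvertible.inv_hom])
    simp only [IsInvertible.inv_hom, cid_vcomp, hcomp_cid] at c₁
    exact conj_eq' e c₁.symm (S.sigmaDelta_invertible _ m).inv_hom
  map_runit m h := by
    have e := S.sigmaDelta_runit m
    have c₁ := hcomp_vcomp (cid (S.pro (SpanFamily.parallel m))) (S.unit_invertible _).inv (cid _)
      (S.unitComparison _) h (by simp) (by simp [IsInvertible.inv_hom])
    simp only [IsInvertible.inv_hom, cid_vcomp, hcomp_cid] at c₁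
    exact conj_eq' e c₁.symm (S.sigmaDelta_invertible m _).inv_hom

/-- The natural transformation `Σ(f) : Σ ∘ D^f ⇒ Σ` induced by a function `f : I → J` through the
universal property of coproducts; its components are the structure arrows and structure cells. -/
noncomputable def sigmaTrans (f : I → J) : (reindex (D := D) f).compose (S.sigma I) ⟶ S.sigma J :=
  DoubleNatTrans.mk (F := (reindex (D := D) f).compose (S.sigma I)) (G := S.sigma J)
    (fun x => S.structArrow f x)
    (fun m => S.structCell f m)
    (fun m => S.left_structCell f m)
    (fun m => S.right_structCell f m)
    (fun {x y} g => S.hom_ext _ _ fun i => by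
      change S.ι (fun i => x (f i)) i ≫ S.sigmaMap (fun i => g (f i)) ≫ S.structArrow f y =
        S.ι (fun i => x (f i)) i ≫ S.structArrow f x ≫ S.sigmaMap g
      rw [← Category.assoc, S.ι_sigmaMap, Category.assoc, S.ι_structArrow, ← Category.assoc,
        S.ι_structArrow, S.ι_sigmaMap])
    (fun {x y w z m n} α => by
      change (S.sigmaCell fun i => α (f i)) ≫ᵥ S.structCell f n =
        S.structCell f m ≫ᵥ S.sigmaCell α
      refine S.parallel_ext fun i => ?_
      rw [← vcomp_assoc, S.ι_sigmaCell, vcomp_assoc, S.ι_structCell, ← vcomp_assoc,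
        S.ι_structCell, S.ι_sigmaCell])
    (fun {x y z} m n h => by
      change ((S.sigmaDelta_invertible (fun i => m (f i)) (fun i => n (f i))).inv ≫ᵥ
        S.sigmaCell (fun i => cid (m (f i) ⊙ n (f i)))) ≫ᵥ S.structCell f (fun j => m j ⊙ n j) =
        hcomp (S.structCell f m) (S.structCell f n) _ ≫ᵥ (S.sigmaDelta_invertible m n).inv
      rw [S.sigmaCell_cid, vcomp_cid]
      exact swap_inv (S.structCell_sigmaDelta f m n) (IsInvertible.inv_hom _)
        (IsInvertible.hom_inv _))
    (fun x => by
      change ((S.unit_invertible (fun i => x (f i))).inv ≫ᵥ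
        S.sigmaCell (fun i => cid (unit (x (f i))))) ≫ᵥ S.structCell f (fun j => unit (x j)) =
        unitCell (S.structArrow f x) ≫ᵥ (S.unit_invertible x).inv
      rw [S.sigmaCell_cid, vcomp_cid]
      exact swap_inv (S.structCell_unitComparison f x) (IsInvertible.inv_hom _)
        (IsInvertible.hom_inv _))

end StrongCoproducts

end Coproducts

/-!
The coprojections of a coproduct of proarrows are jointly opcartesian: cells out of the coproduct,
with given boundaries, are families of cells out of the summands. Strongness of the coproducts says
that external identities and external composites of coproduct cocones are again jointly
opcartesian. Hence the coproduct of the external identities `id_{x (f i)}` over the span `(1, f)`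
inherits from its summands the structure of a companion of `Σ(f)_x`, and the coproduct over `(f, 1)`
that of a conjoint.

Given companions, a cell `α` slides to the globular cell `α_!`, naturally in `α`. Naturality with
respect to the coprojections exhibits the slide of `Σ(f)_m` as the comparison of two jointly
opcartesian families, induced by the slides of identity cells. These are invertible, so `Σ(f)_m` is
a commuter. The statement about conjoints is the same one in the horizontal opposite, where
proarrows are reversed.

Finally, a natural transformation all of whose component cells are commuters has a companion among
pseudo protransformations: take companions componentwise, with the inverses of the slid cells as
naturality comparisons; the coherence laws are the functoriality of sliding.
-/

namespace DoubleCategory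

section Calculus

variable {D : Type u} [DoubleCategory.{u, v, p, c} D]

theorem hcomp_congr {x y z x' y' z' : D} {m : Pro x y} {n : Pro y z} {m' : Pro x' y'}
    {n' : Pro y' z'} {α α' : Cell m m'} {β β' : Cell n n'} (hα : α = α') (hβ : β = β')
    (h : right α = left β) : hcomp α β h = hcomp α' β' (by rw [← hα, ← hβ, h]) := by
  subst hα hβ; rfl

theorem hcomp_vcomp_hcomp {x y z x' y' z' x'' y'' z'' : D} {m : Pro x y} {n : Pro y z}
    {m' : Pro x' y'} {n' : Pro y' z'} {m'' : Pro x'' y''} {n'' : Pro y'' z''} (α : Cell m m')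
    (β : Cell n n') (α' : Cell m' m'') (β' : Cell n' n'') (h : right α = left β)
    (h' : right α' = left β') :
    hcomp α β h ≫ᵥ hcomp α' β' h' = hcomp (α ≫ᵥ α') (β ≫ᵥ β') (by simp [h, h']) :=
  (hcomp_vcomp _ _ _ _ _ _ _).symm

theorem hcomp_vcomp_hcomp_assoc {x y z x' y' z' x'' y'' z'' s t : D} {m : Pro x y} {n : Pro y z}
    {m' : Pro x' y'} {n' : Pro y' z'} {m'' : Pro x'' y''} {n'' : Pro y'' z''} {k : Pro s t}
    (α : Cell m m') (β : Cell n n') (α' : Cell m' m'') (β' : Cell n' n'') (h : right α = left β)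
    (h' : right α' = left β') (γ : Cell (m'' ⊙ n'') k) :
    hcomp α β h ≫ᵥ hcomp α' β' h' ≫ᵥ γ = hcomp (α ≫ᵥ α') (β ≫ᵥ β') (by simp [h, h']) ≫ᵥ γ := by
  rw [← vcomp_assoc, hcomp_vcomp_hcomp]

theorem hcomp_eq_cid {x y z : D} {m : Pro x y} {n : Pro y z} {α : Cell m m} {β : Cell n n}
    (hα : α = cid m) (hβ : β = cid n) (h : right α = left β) : hcomp α β h = cid (m ⊙ n) :=
  (hcomp_congr hα hβ h).trans (hcomp_cid m n _)

theorem vcomp_eq_assoc {x₁ y₁ x₂ y₂ x₃ y₃ x₄ y₄ : D} {m₁ : Pro x₁ y₁} {m₂ : Pro x₂ y₂}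
    {m₃ : Pro x₃ y₃} {m₄ : Pro x₄ y₄} {α : Cell m₁ m₂} {β : Cell m₂ m₃} {γ : Cell m₁ m₃}
    (h : α ≫ᵥ β = γ) (δ : Cell m₃ m₄) : α ≫ᵥ β ≫ᵥ δ = γ ≫ᵥ δ := by
  rw [← vcomp_assoc, h]

theorem vcomp_eq_vcomp_assoc {x₁ y₁ x₂ y₂ x₃ y₃ x₄ y₄ x₅ y₅ : D} {m₁ : Pro x₁ y₁}
    {m₂ : Pro x₂ y₂} {m₃ : Pro x₃ y₃} {m₄ : Pro x₄ y₄} {m₅ : Pro x₅ y₅} {α : Cell m₁ m₂}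
    {β : Cell m₂ m₃} {α' : Cell m₁ m₅} {β' : Cell m₅ m₃} (h : α ≫ᵥ β = α' ≫ᵥ β')
    (δ : Cell m₃ m₄) : α ≫ᵥ β ≫ᵥ δ = α' ≫ᵥ β' ≫ᵥ δ := by
  rw [vcomp_eq_assoc h, vcomp_assoc]

@[simp] theorem assocHom_inv_assoc {x y z t s s' : D} (m : Pro x y) (n : Pro y z) (k : Pro z t)
    {l : Pro s s'} (δ : Cell _ l) : assocHom m n k ≫ᵥ assocInv m n k ≫ᵥ δ = δ := by
  rw [vcomp_eq_assoc (assocHom_inv _ _ _), cid_vcomp]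

@[simp] theorem assocInv_hom_assoc {x y z t s s' : D} (m : Pro x y) (n : Pro y z) (k : Pro z t)
    {l : Pro s s'} (δ : Cell _ l) : assocInv m n k ≫ᵥ assocHom m n k ≫ᵥ δ = δ := by
  rw [vcomp_eq_assoc (assocInv_hom _ _ _), cid_vcomp]

@[simp] theorem lunitHom_inv_assoc {x y s s' : D} (m : Pro x y)
    {l : Pro s s'} (δ : Cell _ l) : lunitHom m ≫ᵥ lunitInv m ≫ᵥ δ = δ := by
  rw [vcomp_eq_assoc (lunitHom_inv _), cid_vcomp]

@[simp] theorem lunitInv_hom_assoc {x y s s' : D} (m : Pro x y)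
    {l : Pro s s'} (δ : Cell _ l) : lunitInv m ≫ᵥ lunitHom m ≫ᵥ δ = δ := by
  rw [vcomp_eq_assoc (lunitInv_hom _), cid_vcomp]

@[simp] theorem runitInv_hom_assoc {x y s s' : D} (m : Pro x y)
    {l : Pro s s'} (δ : Cell _ l) : runitInv m ≫ᵥ runitHom m ≫ᵥ δ = δ := by
  rw [vcomp_eq_assoc (runitInv_hom _), cid_vcomp]

theorem lunitHom_natural {x y x' y' : D} {m : Pro x y} {m' : Pro x' y'} (α : Cell m m')
    {f : x ⟶ x'} (h : left α = f) :
    lunitHom m ≫ᵥ α = hcomp (unitCell f) α (by simp [h]) ≫ᵥ lunitHom m' := by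
  subst h; exact (lunit_naturality α (by simp)).symm

theorem runitHom_natural {x y x' y' : D} {m : Pro x y} {m' : Pro x' y'} (α : Cell m m')
    {f : y ⟶ y'} (h : right α = f) :
    runitHom m ≫ᵥ α = hcomp α (unitCell f) (by simp [h]) ≫ᵥ runitHom m' := by
  subst h; exact (runit_naturality α (by simp)).symm

theorem lunitInv_natural {x y x' y' : D} {m : Pro x y} {m' : Pro x' y'} (α : Cell m m')
    {f : x ⟶ x'} (h : left α = f) :
    α ≫ᵥ lunitInv m' = lunitInv m ≫ᵥ hcomp (unitCell f) α (by simp [h]) := by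
  have := congrArg (fun t => lunitInv m ≫ᵥ t ≫ᵥ lunitInv m') (lunitHom_natural α h)
  simpa using this

theorem runitInv_natural {x y x' y' : D} {m : Pro x y} {m' : Pro x' y'} (α : Cell m m')
    {f : y ⟶ y'} (h : right α = f) :
    α ≫ᵥ runitInv m' = runitInv m ≫ᵥ hcomp α (unitCell f) (by simp [h]) := by
  have := congrArg (fun t => runitInv m ≫ᵥ t ≫ᵥ runitInv m') (runitHom_natural α h)
  simpa using this

theorem assocHom_natural {x y z t x' y' z' t' : D} {m : Pro x y} {n : Pro y z} {k : Pro z t}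
    {m' : Pro x' y'} {n' : Pro y' z'} {k' : Pro z' t'} (α : Cell m m') (β : Cell n n')
    (γ : Cell k k') (h : right α = left β) (h' : right β = left γ) :
    hcomp (hcomp α β h) γ (by simp [h']) ≫ᵥ assocHom m' n' k' =
      assocHom m n k ≫ᵥ hcomp α (hcomp β γ h') (by simp [h]) :=
  assoc_naturality _ _ _ _ _ _ _

theorem assocInv_natural {x y z t x' y' z' t' : D} {m : Pro x y} {n : Pro y z} {k : Pro z t}
    {m' : Pro x' y'} {n' : Pro y' z'} {k' : Pro z' t'} (α : Cell m m') (β : Cell n n')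
    (γ : Cell k k') (h : right α = left β) (h' : right β = left γ) :
    hcomp α (hcomp β γ h') (by simp [h]) ≫ᵥ assocInv m' n' k' =
      assocInv m n k ≫ᵥ hcomp (hcomp α β h) γ (by simp [h']) := by
  have := congrArg (fun t => assocInv m n k ≫ᵥ t ≫ᵥ assocInv m' n' k')
    (assocHom_natural α β γ h h')
  simpa using this.symm

theorem lunitHom_unit (x : D) : lunitHom (unit x) = runitHom (unit x) :=
  congrArg GlobCell.val (Bicategory.unitors_equal (B := UBicat D) (a := ⟨x⟩))

theorem lunitInv_unit (x : D) : lunitInv (unit x) = runitInv (unit x) :=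
  congrArg GlobCell.val (Bicategory.unitors_inv_equal (B := UBicat D) (a := ⟨x⟩))

theorem runitHom_pcomp {x y z : D} (m : Pro x y) (n : Pro y z) :
    runitHom (m ⊙ n) = assocHom m n (unit z) ≫ᵥ hcomp (cid m) (runitHom n) (by simp) :=
  congrArg GlobCell.val (Bicategory.rightUnitor_comp (B := UBicat D) (a := ⟨x⟩) (b := ⟨y⟩)
    (c := ⟨z⟩) m n)

theorem runitHom_vcomp_lunitInv_pcomp {x y z : D} (m : Pro x y) (n : Pro y z) :
    runitHom (m ⊙ n) ≫ᵥ lunitInv (m ⊙ n) = assocHom m n (unit z) ≫ᵥ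
      hcomp (cid m) (runitHom n ≫ᵥ lunitInv n) (by simp) ≫ᵥ assocInv m (unit y) n ≫ᵥ
        hcomp (runitHom m ≫ᵥ lunitInv m) (cid n) (by simp) ≫ᵥ assocHom (unit x) m n := by
  have : ∀ {B : Type u} [Bicategory.{c, p} B] {x y z : B} (m : x ⟶ y) (n : y ⟶ z),
      (Bicategory.rightUnitor (m ≫ n)).hom ≫ (Bicategory.leftUnitor (m ≫ n)).inv =
      (Bicategory.associator m n (𝟙 z)).hom ≫ Bicategory.whiskerLeft m
        ((Bicategory.rightUnitor n).hom ≫ (Bicategory.leftUnitor n).inv) ≫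
        (Bicategory.associator m (𝟙 y) n).inv ≫ Bicategory.whiskerRight
        ((Bicategory.rightUnitor m).hom ≫ (Bicategory.leftUnitor m).inv) n ≫
        (Bicategory.associator (𝟙 x) m n).hom := by
    intros; bicategory
  exact congrArg GlobCell.val (this (B := UBicat D) (x := ⟨x⟩) (y := ⟨y⟩) (z := ⟨z⟩) m n)

theorem IsInvertible.of_vcomp_left {x₁ y₁ x₂ y₂ x₃ y₃ : D} {m₁ : Pro x₁ y₁} {m₂ : Pro x₂ y₂}
    {m₃ : Pro x₃ y₃} {α : Cell m₁ m₂} {β : Cell m₂ m₃} (hα : IsInvertible α)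
    (hαβ : IsInvertible (α ≫ᵥ β)) : IsInvertible β := by
  obtain ⟨α', αα', α'α⟩ := hα
  have β_eq : β = α' ≫ᵥ α ≫ᵥ β := by rw [vcomp_eq_assoc α'α, cid_vcomp]
  rw [β_eq]
  exact .vcomp ⟨α, α'α, αα'⟩ hαβ

end Calculus

section Companions

variable {D : Type u} [DoubleCategory.{u, v, p, c} D]

namespace Companion

attribute [simp] left_η right_η left_ε right_ε

theorem hcomp_η_ε {x y : D} {f : x ⟶ y} (F : Companion f) :
    hcomp F.η F.ε (by simp) = lunitHom F.pro ≫ᵥ runitInv F.pro := by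
  have := congrArg (fun t => lunitHom F.pro ≫ᵥ t ≫ᵥ runitInv F.pro) F.hcomp_eq
  simpa using this

theorem ext_of_η {x y s t : D} {f : x ⟶ y} (F : Companion f) {k : Pro s t} {α β : Cell F.pro k}
    (hr : right α = right β) (h : F.η ≫ᵥ α = F.η ≫ᵥ β) : α = β := by
  have eq_unit_vcomp : ∀ γ : Cell F.pro k, γ = lunitInv F.pro ≫ᵥ hcomp (F.η ≫ᵥ γ)
      (F.ε ≫ᵥ unitCell (right γ)) (by simp) ≫ᵥ runitHom k := fun γ => by
    rw [← hcomp_vcomp_hcomp _ _ _ _ (by simp) (by simp), vcomp_assoc, ← runitHom_natural γ rfl,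
      ← vcomp_assoc, ← vcomp_assoc, vcomp_assoc (lunitInv F.pro), F.hcomp_eq, cid_vcomp]
  rw [eq_unit_vcomp α, eq_unit_vcomp β]
  simp only [h, hr]

/-- The cell between companions induced by a commutative square of arrows. -/
def lift {x y x' y' : D} {f : x ⟶ y} {f' : x' ⟶ y'} (F : Companion f) (F' : Companion f')
    (a : x ⟶ x') (b : y ⟶ y') (h : a ≫ f' = f ≫ b) : Cell F.pro F'.pro :=
  lunitInv F.pro ≫ᵥ hcomp (unitCell a ≫ᵥ F'.η) (F.ε ≫ᵥ unitCell b) (by simp [h]) ≫ᵥ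
    runitHom F'.pro

section

variable {x y x' y' : D} {f : x ⟶ y} {f' : x' ⟶ y'} (F : Companion f) (F' : Companion f')
    (a : x ⟶ x') (b : y ⟶ y') (h : a ≫ f' = f ≫ b)

@[simp] theorem left_lift : left (F.lift F' a b h) = a := by simp [lift]

@[simp] theorem right_lift : right (F.lift F' a b h) = b := by simp [lift]

theorem η_lift : F.η ≫ᵥ F.lift F' a b h = unitCell a ≫ᵥ F'.η := by
  rw [lift, ← vcomp_assoc, lunitInv_natural F.η F.left_η, vcomp_assoc, hcomp_vcomp_hcomp_assoc]
  have e : F.η ≫ᵥ F.ε ≫ᵥ unitCell b = unitCell (a ≫ f') := by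
    rw [← vcomp_assoc, F.vcomp_eq, ← unitCell_comp, h]
  simp only [e, unitCell_id, cid_vcomp]
  rw [← runitHom_natural (unitCell a ≫ᵥ F'.η) (by simp), lunitInv_unit, runitInv_hom_assoc]

theorem lift_ε : F.lift F' a b h ≫ᵥ F'.ε = F.ε ≫ᵥ unitCell b := by
  refine F.ext_of_η (by simp) ?_
  rw [vcomp_eq_assoc (F.η_lift F' a b h), vcomp_eq_assoc F.vcomp_eq, vcomp_assoc, F'.vcomp_eq,
    ← unitCell_comp, ← unitCell_comp, h]

theorem lift_eq {α : Cell F.pro F'.pro} (hr : right α = b)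
    (hη : F.η ≫ᵥ α = unitCell a ≫ᵥ F'.η) : F.lift F' a b h = α :=
  F.ext_of_η (by simp [hr]) (by rw [η_lift, hη])

theorem lift_id : F.lift F (𝟙 x) (𝟙 y) (by simp) = cid F.pro :=
  F.lift_eq F _ _ _ (by simp) (by simp)

theorem lift_comp {x'' y'' : D} {f'' : x'' ⟶ y''} (F'' : Companion f'') (a' : x' ⟶ x'')
    (b' : y' ⟶ y'') (h' : a' ≫ f'' = f' ≫ b') :
    F.lift F' a b h ≫ᵥ F'.lift F'' a' b' h' =
      F.lift F'' (a ≫ a') (b ≫ b') (by rw [Category.assoc, h', ← Category.assoc, h,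
        Category.assoc]) :=
  (F.lift_eq F'' _ _ _ (by simp) (by
    rw [← vcomp_assoc, F.η_lift, vcomp_assoc, F'.η_lift, ← vcomp_assoc, unitCell_comp])).symm

theorem isInvertible_lift {F F' : Companion f} :
    IsInvertible (F.lift F' (𝟙 x) (𝟙 y) (by simp)) :=
  ⟨F'.lift F (𝟙 x) (𝟙 y) (by simp), by rw [lift_comp]; simpa using F.lift_id,
    by rw [lift_comp]; simpa using F'.lift_id⟩

end

theorem pcomp_ext {x y z s t : D} {g : y ⟶ z} (G : Companion g) {m : Pro x y} {k : Pro s t}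
    {α β : Cell (m ⊙ G.pro) k} (hr : right α = right β)
    (h : hcomp (cid m) G.η (by simp) ≫ᵥ α = hcomp (cid m) G.η (by simp) ≫ᵥ β) : α = β := by
  have e : hcomp (runitInv m) (cid G.pro) (by simp) ≫ᵥ
      hcomp (hcomp (cid m) G.η (by simp)) G.ε (by simp) ≫ᵥ runitHom (m ⊙ G.pro) = cid _ := by
    have e₁ := congrArg (· ≫ᵥ assocInv _ _ _) (assocHom_natural (cid m) G.η G.ε (by simp) (by simp))
    have e₂ := triangle m G.pro (by simp) (by simp)
    have e₃ : hcomp (cid m) (hcomp G.η G.ε (by simp)) (by simp) =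
        hcomp (cid m) (lunitHom G.pro) (by simp) ≫ᵥ hcomp (cid m) (runitInv G.pro) (by simp) := by
      rw [hcomp_vcomp_hcomp]
      exact hcomp_congr (by simp) G.hcomp_η_ε _
    simp only [vcomp_assoc, assocHom_inv, vcomp_cid] at e₁
    rw [e₁, e₃]
    simp only [vcomp_assoc]
    rw [vcomp_eq_assoc e₂, hcomp_vcomp_hcomp_assoc, runitHom_pcomp, assocInv_hom_assoc,
      hcomp_vcomp_hcomp, hcomp_vcomp_hcomp]
    simp
  have eq_vcomp_counit : ∀ γ : Cell (m ⊙ G.pro) k, γ = hcomp (runitInv m) (cid G.pro) (by simp) ≫ᵥ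
      hcomp (hcomp (cid m) G.η (by simp) ≫ᵥ γ) (G.ε ≫ᵥ unitCell (right γ)) (by simp) ≫ᵥ
        runitHom k := fun γ => by
    rw [← hcomp_vcomp_hcomp _ _ _ _ (by simp) (by simp), vcomp_assoc, ← runitHom_natural γ rfl,
      ← vcomp_assoc, ← vcomp_assoc, vcomp_assoc (hcomp _ _ _), e, cid_vcomp]
  rw [eq_vcomp_counit α, eq_vcomp_counit β]
  simp only [h, hr]

/-- For companions `F` of `f` and `G` of `g`, the globular cell `m ⊙ g_! → f_! ⊙ n` obtained from
a cell `α : m → n` by sliding its boundary arrows `f` and `g` along their companions: the cell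
`α_!` (`companionReshape`) with the boundary arrows of `α` known only up to equality. -/
def slide {x y w z : D} {f : x ⟶ w} {g : y ⟶ z} (F : Companion f) (G : Companion g)
    {m : Pro x y} {n : Pro w z} (α : Cell m n) (hl : left α = f) (hr : right α = g) :
    Cell (m ⊙ G.pro) (F.pro ⊙ n) :=
  hcomp (lunitInv m) (cid G.pro) (by simp) ≫ᵥ
    hcomp (hcomp F.η α (by simp [hl])) G.ε (by simp [hr]) ≫ᵥ runitHom (F.pro ⊙ n)

section Slide

variable {x y w z : D} {f : x ⟶ w} {g : y ⟶ z} (F : Companion f) (G : Companion g)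
  {m : Pro x y} {n : Pro w z} (α : Cell m n) (hl : left α = f) (hr : right α = g)

@[simp] theorem left_slide : left (F.slide G α hl hr) = 𝟙 x := by simp [slide]

@[simp] theorem right_slide : right (F.slide G α hl hr) = 𝟙 z := by simp [slide]

theorem slide_eq_hcomp_vcomp_runitHom : F.slide G α hl hr =
    hcomp (lunitInv m ≫ᵥ hcomp F.η α (by simp [hl])) G.ε (by simp [hr]) ≫ᵥ runitHom _ := by
  rw [slide, hcomp_vcomp_hcomp_assoc, hcomp_congr rfl (cid_vcomp _)]

theorem hcomp_η_slide : hcomp (cid m) G.η (by simp) ≫ᵥ F.slide G α hl hr =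
    runitHom m ≫ᵥ lunitInv m ≫ᵥ hcomp F.η α (by simp [hl]) := by
  rw [slide_eq_hcomp_vcomp_runitHom, hcomp_vcomp_hcomp_assoc,
    hcomp_congr (cid_vcomp _) G.vcomp_eq, ← runitHom_natural _ (by simp [hr])]

theorem slide_hcomp_ε : F.slide G α hl hr ≫ᵥ hcomp F.ε (cid n) (by simp) =
    hcomp α G.ε (by simp [hr]) ≫ᵥ runitHom n ≫ᵥ lunitInv n := by
  have unit_counit : (lunitInv m ≫ᵥ hcomp F.η α (by simp [hl])) ≫ᵥ hcomp F.ε (cid n) (by simp) =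
      α ≫ᵥ lunitInv n := by
    rw [vcomp_assoc, hcomp_vcomp_hcomp, hcomp_congr F.vcomp_eq (vcomp_cid _),
      ← lunitInv_natural α hl]
  rw [slide_eq_hcomp_vcomp_runitHom, vcomp_assoc, runitHom_natural _ (f := 𝟙 z) (by simp),
    hcomp_vcomp_hcomp_assoc, hcomp_congr unit_counit (β' := G.ε ≫ᵥ unitCell (𝟙 z)) rfl,
    ← hcomp_vcomp_hcomp _ _ _ _ (by simp [hr]) (by simp), vcomp_assoc,
    ← runitHom_natural _ (by simp)]

variable {F G α}

theorem eq_slide {Φ : Cell (m ⊙ G.pro) (F.pro ⊙ n)} (hΦ : right Φ = 𝟙 z)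
    (h : hcomp (cid m) G.η (by simp) ≫ᵥ Φ =
      runitHom m ≫ᵥ lunitInv m ≫ᵥ hcomp F.η α (by simp [hl])) : Φ = F.slide G α hl hr :=
  G.pcomp_ext (by simp [hΦ]) (by rw [h, hcomp_η_slide])

theorem slide_natural {x' y' w' z' : D} {f' : x' ⟶ w'} {g' : y' ⟶ z'} {F' : Companion f'}
    {G' : Companion g'} {m' : Pro x' y'} {n' : Pro w' z'} {α' : Cell m' n'}
    (hl' : left α' = f') (hr' : right α' = g') {σ : Cell m m'} {τ : Cell n n'}
    {φ : Cell F.pro F'.pro} {ψ : Cell G.pro G'.pro} (e : σ ≫ᵥ α' = α ≫ᵥ τ)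
    (hφ : F.η ≫ᵥ φ = unitCell (left σ) ≫ᵥ F'.η) (hψ : ψ ≫ᵥ G'.ε = G.ε ≫ᵥ unitCell (right τ))
    (hσψ : right σ = left ψ) (hφτ : right φ = left τ) :
    hcomp σ ψ hσψ ≫ᵥ F'.slide G' α' hl' hr' = F.slide G α hl hr ≫ᵥ hcomp φ τ hφτ := by
  have upper : σ ≫ᵥ lunitInv m' ≫ᵥ hcomp F'.η α' (by simp [hl']) =
      (lunitInv m ≫ᵥ hcomp F.η α (by simp [hl])) ≫ᵥ hcomp φ τ hφτ := by
    rw [vcomp_eq_vcomp_assoc (lunitInv_natural σ rfl), hcomp_vcomp_hcomp, vcomp_assoc,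
      hcomp_vcomp_hcomp, hcomp_congr hφ.symm e]
  rw [slide_eq_hcomp_vcomp_runitHom, slide_eq_hcomp_vcomp_runitHom, hcomp_vcomp_hcomp_assoc,
    hcomp_congr upper hψ, vcomp_assoc _ (runitHom _), runitHom_natural _ (right_hcomp φ τ hφτ),
    hcomp_vcomp_hcomp_assoc]

theorem slide_unitCell (F : Companion f) :
    F.slide F (unitCell f) (by simp) (by simp) = lunitHom F.pro ≫ᵥ runitInv F.pro := by
  refine (eq_slide _ _ (by simp) ?_).symm
  have unit_η := lunitHom_natural F.η F.left_η
  simp only [unitCell_id] at unit_η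
  rw [← vcomp_eq_vcomp_assoc unit_η, runitInv_natural F.η F.right_η, lunitInv_unit, lunitHom_unit]

end Slide

theorem slide_hcomp {x y z x' y' z' : D} {f : x ⟶ x'} {g : y ⟶ y'} {k : z ⟶ z'}
    (F : Companion f) (G : Companion g) (K : Companion k) {m : Pro x y} {n : Pro y z}
    {m' : Pro x' y'} {n' : Pro y' z'} {α : Cell m m'} {β : Cell n n'} (hα : left α = f)
    (hα' : right α = g) (hβ : left β = g) (hβ' : right β = k) :
    F.slide K (hcomp α β (by rw [hα', hβ])) (by simp [hα]) (by simp [hβ']) =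
      assocHom m n K.pro ≫ᵥ hcomp (cid m) (G.slide K β hβ hβ') (by simp) ≫ᵥ
        assocInv m G.pro n' ≫ᵥ hcomp (F.slide G α hα hα') (cid n') (by simp) ≫ᵥ
          assocHom F.pro m' n' := by
  refine (eq_slide _ _ (by simp) ?_).symm
  have assoc_upper := assocHom_natural (cid m) (cid n) K.η (by simp) (by simp)
  simp only [hcomp_cid] at assoc_upper
  have slide_β : hcomp (cid m) (hcomp (cid n) K.η (by simp)) (by simp) ≫ᵥ
      hcomp (cid m) (G.slide K β hβ hβ') (by simp) =
        hcomp (cid m) (runitHom n ≫ᵥ lunitInv n) (by simp) ≫ᵥ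
          hcomp (cid m) (hcomp G.η β (by simp [hβ])) (by simp) := by
    rw [hcomp_vcomp_hcomp, hcomp_vcomp_hcomp]
    exact hcomp_congr rfl (by rw [hcomp_η_slide, vcomp_assoc]) _
  have assoc_middle := assocInv_natural (cid m) G.η β (by simp) (by simp [hβ])
  have slide_α : hcomp (hcomp (cid m) G.η (by simp)) β (by simp [hβ]) ≫ᵥ
      hcomp (F.slide G α hα hα') (cid n') (by simp) =
        hcomp (runitHom m ≫ᵥ lunitInv m) (cid n) (by simp) ≫ᵥ
          hcomp (hcomp F.η α (by simp [hα])) β (by simp [hα', hβ]) := by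
    rw [hcomp_vcomp_hcomp, hcomp_vcomp_hcomp]
    exact hcomp_congr (by rw [hcomp_η_slide, vcomp_assoc]) (by simp) _
  rw [vcomp_eq_assoc assoc_upper, vcomp_assoc, vcomp_eq_vcomp_assoc slide_β,
    vcomp_eq_vcomp_assoc assoc_middle, vcomp_eq_vcomp_assoc slide_α,
    assocHom_natural F.η α β (by simp [hα]) (by rw [hα', hβ]), ← vcomp_assoc (runitHom (m ⊙ n)),
    runitHom_vcomp_lunitInv_pcomp]
  simp only [vcomp_assoc]

theorem isInvertible_slide_iff {x y w z : D} {f : x ⟶ w} {g : y ⟶ z} (F F' : Companion f)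
    (G G' : Companion g) {m : Pro x y} {n : Pro w z} {α : Cell m n} (hl : left α = f)
    (hr : right α = g) :
    IsInvertible (F.slide G α hl hr) ↔ IsInvertible (F'.slide G' α hl hr) := by
  suffices isInvertible_of_isInvertible : ∀ (F F' : Companion f) (G G' : Companion g),
      IsInvertible (F.slide G α hl hr) → IsInvertible (F'.slide G' α hl hr) from
    ⟨isInvertible_of_isInvertible F F' G G', isInvertible_of_isInvertible F' F G' G⟩
  intro F F' G G' h
  have change_companions := slide_natural (F := F) (F' := F') (G := G) (G' := G') hl hr hl hr
    (σ := cid m) (τ := cid n) (φ := F.lift F' (𝟙 x) (𝟙 w) (by simp))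
    (ψ := G.lift G' (𝟙 y) (𝟙 z) (by simp)) (by simp) (by simp [η_lift]) (by simp [lift_ε])
    (by simp) (by simp)
  exact .of_vcomp_left (isInvertible_lift.whiskL m _)
    (change_companions ▸ h.vcomp (isInvertible_lift.whiskR n _))

theorem isCommuter_iff {x y w z : D} {f : x ⟶ w} {g : y ⟶ z} (F : Companion f)
    (G : Companion g) {m : Pro x y} {n : Pro w z} {α : Cell m n} (hl : left α = f)
    (hr : right α = g) : IsCommuter α ↔ IsInvertible (F.slide G α hl hr) := by
  subst hl hr
  exact ⟨fun h => h.2.2 F G,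
    fun h => ⟨⟨F⟩, ⟨G⟩, fun F' G' => (isInvertible_slide_iff F F' G G' rfl rfl).1 h⟩⟩

end Companion

end Companions

/-- The horizontal opposite of a double category: the same arrows and cells, with reversed
proarrows. -/
def HOp (D : Type u) : Type u := D

instance hOpDoubleCategory (D : Type u) [DoubleCategory.{u, v, p, c} D] :
    DoubleCategory.{u, v, p, c} (HOp D) where
  toCategory := inferInstanceAs (Category D)
  Pro x y := Pro (D := D) y x
  Cell m n := Cell (D := D) m n
  left α := right (D := D) α
  right α := left (D := D) α
  cid m := cid (D := D) m
  vcomp α β := vcomp (D := D) α β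
  left_cid m := right_cid (D := D) m
  right_cid m := left_cid (D := D) m
  left_vcomp α β := right_vcomp (D := D) α β
  right_vcomp α β := left_vcomp (D := D) α β
  cid_vcomp α := cid_vcomp (D := D) α
  vcomp_cid α := vcomp_cid (D := D) α
  vcomp_assoc α β γ := vcomp_assoc (D := D) α β γ
  unit x := unit (D := D) x
  unitCell f := unitCell (D := D) f
  left_unitCell f := right_unitCell (D := D) f
  right_unitCell f := left_unitCell (D := D) f
  unitCell_id x := unitCell_id (D := D) x
  unitCell_comp f g := unitCell_comp (D := D) f g
  pcomp m n := pcomp (D := D) n m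
  hcomp α β h := hcomp (D := D) β α h.symm
  left_hcomp α β h := right_hcomp (D := D) β α h.symm
  right_hcomp α β h := left_hcomp (D := D) β α h.symm
  hcomp_cid m n h := hcomp_cid (D := D) n m h.symm
  hcomp_vcomp α β α' β' h h' h'' :=
    hcomp_vcomp (D := D) β α β' α' h.symm h'.symm h''.symm
  assocHom m n k := assocInv (D := D) k n m
  assocInv m n k := assocHom (D := D) k n m
  left_assocHom m n k := right_assocInv (D := D) k n m
  right_assocHom m n k := left_assocInv (D := D) k n m
  assocHom_inv m n k := assocInv_hom (D := D) k n m
  assocInv_hom m n k := assocHom_inv (D := D) k n m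
  assoc_naturality α β γ h h' _ _ := assocInv_natural (D := D) γ β α h'.symm h.symm
  lunitHom m := runitHom (D := D) m
  lunitInv m := runitInv (D := D) m
  left_lunitHom m := right_runitHom (D := D) m
  right_lunitHom m := left_runitHom (D := D) m
  lunitHom_inv m := runitHom_inv (D := D) m
  lunitInv_hom m := runitInv_hom (D := D) m
  lunit_naturality α h := runit_naturality (D := D) α h.symm
  runitHom m := lunitHom (D := D) m
  runitInv m := lunitInv (D := D) m
  left_runitHom m := right_lunitHom (D := D) m
  right_runitHom m := left_lunitHom (D := D) m
  runitHom_inv m := lunitHom_inv (D := D) m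
  runitInv_hom m := lunitInv_hom (D := D) m
  runit_naturality α h := lunit_naturality (D := D) α h.symm
  pentagon {x y z t s} m n k l _ _ := congrArg GlobCell.val
    (Bicategory.pentagon_inv (B := UBicat D) (a := ⟨s⟩) (b := ⟨t⟩) (c := ⟨z⟩) (d := ⟨y⟩) (e := ⟨x⟩)
      l k n m)
  triangle {x y z} m n _ _ := congrArg GlobCell.val
    (Bicategory.triangle_assoc_comp_right (B := UBicat D) (a := ⟨z⟩) (b := ⟨y⟩) (c := ⟨x⟩) n m)

section Conjoints

variable {D : Type u} [DoubleCategory.{u, v, p, c} D]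

namespace Conjoint

attribute [simp] left_η right_η left_ε right_ε

/-- A conjoint of an arrow is a companion of it in the horizontal opposite. -/
def toHOp {x y : D} {f : x ⟶ y} (F : Conjoint f) :
    Companion (D := HOp D) (x := x) (y := y) f where
  pro := F.pro
  η := F.η
  ε := F.ε
  left_η := F.right_η
  right_η := F.left_η
  left_ε := F.right_ε
  right_ε := F.left_ε
  hcomp_eq := F.hcomp_eq
  vcomp_eq := F.vcomp_eq

/-- A companion of an arrow in the horizontal opposite is a conjoint of it. -/
def ofHOp {x y : D} {f : x ⟶ y} (F : Companion (D := HOp D) (x := x) (y := y) f) :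
    Conjoint f where
  pro := F.pro
  η := F.η
  ε := F.ε
  left_η := F.right_η
  right_η := F.left_η
  left_ε := F.right_ε
  right_ε := F.left_ε
  hcomp_eq := F.hcomp_eq
  vcomp_eq := F.vcomp_eq

section

variable {x y x' y' : D} {f : x ⟶ y} {f' : x' ⟶ y'} (F : Conjoint f) (F' : Conjoint f')
    (a : x ⟶ x') (b : y ⟶ y') (h : a ≫ f' = f ≫ b)

/-- The cell between conjoints induced by a commutative square of arrows. -/
def lift : Cell F.pro F'.pro := F.toHOp.lift F'.toHOp a b h

@[simp] theorem left_lift : left (F.lift F' a b h) = b := F.toHOp.right_lift F'.toHOp a b h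

@[simp] theorem right_lift : right (F.lift F' a b h) = a := F.toHOp.left_lift F'.toHOp a b h

theorem η_lift : F.η ≫ᵥ F.lift F' a b h = unitCell a ≫ᵥ F'.η := F.toHOp.η_lift F'.toHOp a b h

theorem lift_ε : F.lift F' a b h ≫ᵥ F'.ε = F.ε ≫ᵥ unitCell b := F.toHOp.lift_ε F'.toHOp a b h

theorem lift_id : F.lift F (𝟙 x) (𝟙 y) (by simp) = cid F.pro := F.toHOp.lift_id

theorem lift_comp {x'' y'' : D} {f'' : x'' ⟶ y''} (F'' : Conjoint f'') (a' : x' ⟶ x'')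
    (b' : y' ⟶ y'') (h' : a' ≫ f'' = f' ≫ b') :
    F.lift F' a b h ≫ᵥ F'.lift F'' a' b' h' =
      F.lift F'' (a ≫ a') (b ≫ b') (by rw [Category.assoc, h', ← Category.assoc, h,
        Category.assoc]) :=
  F.toHOp.lift_comp F'.toHOp a b h F''.toHOp a' b' h'

end

/-- For conjoints `F` of `f` and `G` of `g`, the globular cell `f^* ⊙ m → n ⊙ g^*` obtained from a
cell `α : m → n` by sliding its boundary arrows `f` and `g` along their conjoints: up to coherence
the cell `α^*`, see `conjointReshape_eq_slide`. -/
def slide {x y w z : D} {f : x ⟶ w} {g : y ⟶ z} (F : Conjoint f) (G : Conjoint g)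
    {m : Pro x y} {n : Pro w z} (α : Cell m n) (hl : left α = f) (hr : right α = g) :
    Cell (F.pro ⊙ m) (n ⊙ G.pro) :=
  G.toHOp.slide (m := m) (n := n) F.toHOp α hr hl

section Slide

variable {x y w z : D} {f : x ⟶ w} {g : y ⟶ z} (F : Conjoint f) (G : Conjoint g)
  {m : Pro x y} {n : Pro w z} (α : Cell m n) (hl : left α = f) (hr : right α = g)

@[simp] theorem left_slide : left (F.slide G α hl hr) = 𝟙 w :=
  G.toHOp.right_slide (m := m) (n := n) F.toHOp α hr hl

@[simp] theorem right_slide : right (F.slide G α hl hr) = 𝟙 y :=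
  G.toHOp.left_slide (m := m) (n := n) F.toHOp α hr hl

theorem hcomp_η_slide : hcomp F.η (cid m) (by simp) ≫ᵥ F.slide G α hl hr =
    lunitHom m ≫ᵥ runitInv m ≫ᵥ hcomp α G.η (by simp [hr]) :=
  G.toHOp.hcomp_η_slide (m := m) (n := n) F.toHOp α hr hl

theorem slide_hcomp_ε : F.slide G α hl hr ≫ᵥ hcomp (cid n) G.ε (by simp) =
    hcomp F.ε α (by simp [hl]) ≫ᵥ lunitHom n ≫ᵥ runitInv n :=
  G.toHOp.slide_hcomp_ε (m := m) (n := n) F.toHOp α hr hl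

variable {F G α}

theorem eq_slide {Φ : Cell (F.pro ⊙ m) (n ⊙ G.pro)} (hΦ : left Φ = 𝟙 w)
    (h : hcomp F.η (cid m) (by simp) ≫ᵥ Φ =
      lunitHom m ≫ᵥ runitInv m ≫ᵥ hcomp α G.η (by simp [hr])) : Φ = F.slide G α hl hr :=
  Companion.eq_slide (F := G.toHOp) (G := F.toHOp) (m := m) (n := n) (α := α) hr hl hΦ h

theorem slide_natural {x' y' w' z' : D} {f' : x' ⟶ w'} {g' : y' ⟶ z'} {F' : Conjoint f'}
    {G' : Conjoint g'} {m' : Pro x' y'} {n' : Pro w' z'} {α' : Cell m' n'}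
    (hl' : left α' = f') (hr' : right α' = g') {σ : Cell m m'} {τ : Cell n n'}
    {φ : Cell F.pro F'.pro} {ψ : Cell G.pro G'.pro} (e : σ ≫ᵥ α' = α ≫ᵥ τ)
    (hφ : φ ≫ᵥ F'.ε = F.ε ≫ᵥ unitCell (left τ)) (hψ : G.η ≫ᵥ ψ = unitCell (right σ) ≫ᵥ G'.η)
    (hφσ : right φ = left σ) (hτψ : right τ = left ψ) :
    hcomp φ σ hφσ ≫ᵥ F'.slide G' α' hl' hr' = F.slide G α hl hr ≫ᵥ hcomp τ ψ hτψ :=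
  Companion.slide_natural (F := G.toHOp) (G := F.toHOp) (F' := G'.toHOp) (G' := F'.toHOp)
    (m := m) (n := n) (m' := m') (n' := n') (α := α) (α' := α') (σ := σ) (τ := τ) (φ := ψ) (ψ := φ)
    hr hl hr' hl' e hψ hφ hφσ.symm hτψ.symm

theorem slide_unitCell (F : Conjoint f) :
    F.slide F (unitCell f) (by simp) (by simp) = runitHom F.pro ≫ᵥ lunitInv F.pro :=
  Companion.slide_unitCell F.toHOp

end Slide

theorem slide_hcomp {x y z x' y' z' : D} {f : x ⟶ x'} {g : y ⟶ y'} {k : z ⟶ z'}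
    (F : Conjoint f) (G : Conjoint g) (K : Conjoint k) {m : Pro x y} {n : Pro y z}
    {m' : Pro x' y'} {n' : Pro y' z'} {α : Cell m m'} {β : Cell n n'} (hα : left α = f)
    (hα' : right α = g) (hβ : left β = g) (hβ' : right β = k) :
    F.slide K (hcomp α β (by rw [hα', hβ])) (by simp [hα]) (by simp [hβ']) =
      assocInv F.pro m n ≫ᵥ hcomp (F.slide G α hα hα') (cid n) (by simp) ≫ᵥ
        assocHom m' G.pro n ≫ᵥ hcomp (cid m') (G.slide K β hβ hβ') (by simp) ≫ᵥ
          assocInv m' n' K.pro :=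
  Companion.slide_hcomp K.toHOp G.toHOp F.toHOp (α := β) (β := α) hβ' hβ hα' hα

theorem conjointReshape_eq_slide {x y w z : D} {m : Pro x y} {n : Pro w z} (α : Cell m n)
    (F : Conjoint (left α)) (G : Conjoint (right α)) :
    conjointReshape α F G = F.slide G α rfl rfl := by
  refine eq_slide _ _ (by simp [conjointReshape]) ?_
  have runit_lunit : runitInv (unit x ⊙ m) ≫ᵥ hcomp (lunitHom m) (cid (unit y)) (by simp) =
      lunitHom m ≫ᵥ runitInv m := by
    simpa using (runitInv_natural (lunitHom m) (right_lunitHom m)).symm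
  have unit_counit : hcomp F.η (cid m) (by simp) ≫ᵥ hcomp F.ε α F.right_ε ≫ᵥ lunitHom n =
      lunitHom m ≫ᵥ α := by
    rw [hcomp_vcomp_hcomp_assoc, hcomp_congr F.vcomp_eq (cid_vcomp _), ← lunitHom_natural α rfl]
  rw [conjointReshape, vcomp_eq_vcomp_assoc (runitInv_natural _ (right_hcomp _ _ _)),
    hcomp_vcomp_hcomp_assoc, hcomp_vcomp_hcomp, ← vcomp_eq_vcomp_assoc runit_lunit,
    hcomp_vcomp_hcomp (lunitHom m)]
  exact congrArg _ (hcomp_congr (by rw [vcomp_assoc, unit_counit]) (by simp) _)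

end Conjoint

theorem isCommuter_hOp_iff_isCocommuter {x y w z : D} {m : Pro x y} {n : Pro w z}
    {α : Cell m n} :
    IsCommuter (D := HOp D) (x := y) (y := x) (w := z) (z := w) (m := m) (n := n) α ↔
      IsCocommuter α := by
  constructor
  · rintro ⟨⟨G⟩, ⟨F⟩, h⟩
    refine ⟨⟨.ofHOp F⟩, ⟨.ofHOp G⟩, fun F' G' => ?_⟩
    rw [Conjoint.conjointReshape_eq_slide]
    exact h G'.toHOp F'.toHOp
  · rintro ⟨⟨F⟩, ⟨G⟩, h⟩
    refine ⟨⟨G.toHOp⟩, ⟨F.toHOp⟩, fun G' F' => ?_⟩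
    have slide_invertible := h (.ofHOp F') (.ofHOp G')
    rw [Conjoint.conjointReshape_eq_slide] at slide_invertible
    exact slide_invertible

theorem Conjoint.isCocommuter_iff {x y w z : D} {f : x ⟶ w} {g : y ⟶ z} (F : Conjoint f)
    (G : Conjoint g) {m : Pro x y} {n : Pro w z} {α : Cell m n} (hl : left α = f)
    (hr : right α = g) : IsCocommuter α ↔ IsInvertible (F.slide G α hl hr) :=
  isCommuter_hOp_iff_isCocommuter.symm.trans
    (Companion.isCommuter_iff (D := HOp D) (m := m) (n := n) G.toHOp F.toHOp hr hl)

end Conjoints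

end DoubleCategory

namespace DoubleNatTrans

variable {D : Type u₁} [DoubleCategory.{u₁, v₁, p₁, c₁} D]
  {E : Type u₂} [DoubleCategory.{u₂, v₂, p₂, c₂} E] {F G : LaxDoubleFunctor D E} (α : F ⟶ G)

section Companion

variable (C : ∀ x, Companion (DoubleNatTrans.app α x))

/-- The globular cell `F m ⊙ (α y)_! → (α x)_! ⊙ G m` obtained by sliding the component of `α` at a
proarrow `m : x ⇸ y`. -/
def companionSlide {x y : D} (m : Pro x y) :
    Cell (F.mapPro m ⊙ (C y).pro) ((C x).pro ⊙ G.mapPro m) :=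
  (C x).slide (C y) (DoubleNatTrans.cell α m) (left_cell α m) (right_cell α m)

@[simp] theorem left_companionSlide {x y : D} (m : Pro x y) :
    left (companionSlide α C m) = 𝟙 (F.obj x) :=
  (C x).left_slide (C y) _ _ _

@[simp] theorem right_companionSlide {x y : D} (m : Pro x y) :
    right (companionSlide α C m) = 𝟙 (G.obj y) :=
  (C x).right_slide (C y) _ _ _

theorem companionSlide_natural {x y x' y' : D} {m : Pro x y} {n : Pro x' y'} (a : Cell m n) :
    hcomp (F.mapCell a) ((C y).lift (C y') _ _ (naturality α (right a))) (by simp) ≫ᵥ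
        companionSlide α C n =
      companionSlide α C m ≫ᵥ
        hcomp ((C x).lift (C x') _ _ (naturality α (left a))) (G.mapCell a) (by simp) :=
  Companion.slide_natural _ _ _ _ (cell_naturality α a)
    (by rw [Companion.η_lift, F.left_mapCell]) (by rw [Companion.lift_ε, G.right_mapCell]) _ _

theorem comp_companionSlide {x y z : D} (m : Pro x y) (n : Pro y z) :
    hcomp (F.comp m n) (cid (C z).pro) (by simp) ≫ᵥ companionSlide α C (m ⊙ n) =
      (assocHom _ _ _ ≫ᵥ hcomp (cid _) (companionSlide α C n) (by simp) ≫ᵥ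
        assocInv _ _ _ ≫ᵥ hcomp (companionSlide α C m) (cid _) (by simp) ≫ᵥ assocHom _ _ _) ≫ᵥ
          hcomp (cid (C x).pro) (G.comp m n) (by simp) := by
  have natural_comp := Companion.slide_natural (F := C x) (G := C z) (F' := C x) (G' := C z)
    (by simp) (by simp) (left_cell α (m ⊙ n)) (right_cell α (m ⊙ n)) (φ := cid _) (ψ := cid _)
    (comp_cell α m n (by simp)) (by simp) (by simp) (by simp) (by simp)
  rwa [Companion.slide_hcomp (C x) (C y) (C z) (left_cell α m) (right_cell α m) (left_cell α n)
    (right_cell α n)] at natural_comp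

theorem idn_companionSlide (x : D) :
    hcomp (F.idn x) (cid (C x).pro) (by simp) ≫ᵥ companionSlide α C (unit x) =
      (lunitHom _ ≫ᵥ runitInv _) ≫ᵥ hcomp (cid (C x).pro) (G.idn x) (by simp) := by
  have natural_idn := Companion.slide_natural (F := C x) (G := C x) (F' := C x) (G' := C x)
    (by simp) (by simp) (left_cell α (unit x)) (right_cell α (unit x)) (φ := cid _) (ψ := cid _)
    (idn_cell α x) (by simp) (by simp) (by simp) (by simp)
  rwa [Companion.slide_unitCell] at natural_idn

variable (hα : ∀ {x y : D} (m : Pro x y), IsCommuter (DoubleNatTrans.cell α m))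

include hα in
theorem isInvertible_companionSlide {x y : D} (m : Pro x y) :
    IsInvertible (companionSlide α C m) :=
  (Companion.isCommuter_iff _ _ _ _).1 (hα m)

/-- The protransformation formed by companions of the components of a natural transformation whose
component cells are commuters: it compares proarrows by the inverses of the slid cells. -/
noncomputable def companionProtransformation : Protransformation F G where
  app x := (C x).pro
  map {x y} f := (C x).lift (C y) (F.map f) (G.map f) (naturality α f)
  left_map f := by simp
  right_map f := by simp
  map_id x := by
    simp only [CategoryTheory.Functor.map_id]
    exact (C x).lift_id
  map_comp f g := by
    rw [Companion.lift_comp]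
    simp only [CategoryTheory.Functor.map_comp]
  nat m := (isInvertible_companionSlide α C hα m).inv
  left_nat m := left_eq_id_of_inv (IsInvertible.hom_inv _) (left_companionSlide α C m)
  right_nat m := right_eq_id_of_inv (IsInvertible.hom_inv _) (right_companionSlide α C m)
  nat_invertible m := ⟨companionSlide α C m, IsInvertible.inv_hom _, IsInvertible.hom_inv _⟩
  nat_cell a _ _ :=
    swap_inv (companionSlide_natural α C a) (IsInvertible.inv_hom _) (IsInvertible.hom_inv _)
  nat_comp m n _ h₂ h₃ _ := by
    have inv_m := (isInvertible_companionSlide α C hα m).inv_hom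
    have inv_n := (isInvertible_companionSlide α C hα n).inv_hom
    refine (swap_inv (comp_companionSlide α C m n) (μ' := assocInv _ _ _ ≫ᵥ
      hcomp (IsInvertible.inv _) (cid _) h₂ ≫ᵥ assocHom _ _ _ ≫ᵥ
        hcomp (cid _) (IsInvertible.inv _) h₃ ≫ᵥ assocInv _ _ _) ?_
      (IsInvertible.hom_inv _)).symm.trans (by simp only [vcomp_assoc])
    simp only [vcomp_assoc, assocInv_hom_assoc]
    rw [hcomp_vcomp_hcomp_assoc, hcomp_eq_cid (cid_vcomp _) inv_n, cid_vcomp, assocHom_inv_assoc,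
      hcomp_vcomp_hcomp_assoc, hcomp_eq_cid inv_m (cid_vcomp _), cid_vcomp, assocInv_hom]
  nat_unit x _ _ :=
    (swap_inv (idn_companionSlide α C x) (μ' := runitHom _ ≫ᵥ lunitInv _) (by simp)
      (IsInvertible.hom_inv _)).symm.trans (vcomp_assoc _ _ _)

/-- The unit of the companion of a natural transformation whose component cells are commuters. -/
noncomputable def companionUnit :
    Modification (Protransformation.idn F) (companionProtransformation α C hα) where
  src := 𝟙 F
  tgt := α
  app x := (C x).η
  left_app x := (C x).left_η
  right_app x := (C x).right_η
  app_map f := (C _).η_lift (C _) _ _ (naturality α f)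
  app_nat {x y} m _ _ :=
    (swap_inv (((C x).hcomp_η_slide (C y) (cell α m) (left_cell α m) (right_cell α m)).trans
      (vcomp_assoc _ _ _).symm) (μ' := lunitHom _ ≫ᵥ runitInv _) (by simp)
      (IsInvertible.hom_inv _)).symm

/-- The counit of the companion of a natural transformation whose component cells are commuters. -/
noncomputable def companionCounit :
    Modification (companionProtransformation α C hα) (Protransformation.idn G) where
  src := α
  tgt := 𝟙 G
  app x := (C x).ε
  left_app x := (C x).left_ε
  right_app x := (C x).right_ε
  app_map f := ((C _).lift_ε (C _) _ _ (naturality α f)).symm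
  app_nat {x y} m _ _ :=
    (swap_inv ((C x).slide_hcomp_ε (C y) (cell α m) (left_cell α m) (right_cell α m)).symm
      (μ := lunitHom _ ≫ᵥ runitInv _) (IsInvertible.inv_hom _) (by simp)).symm

/-- The companion of a natural transformation whose component cells are commuters. -/
noncomputable def companion : Companion (D := LaxDoubleFunctor D E) α where
  pro := companionProtransformation α C hα
  η := companionUnit α C hα
  ε := companionCounit α C hα
  left_η := rfl
  right_η := rfl
  left_ε := rfl
  right_ε := rfl
  hcomp_eq := Modification.ext ((Category.id_comp _).trans (Category.id_comp _))
    ((Category.id_comp _).trans (Category.id_comp _)) (funext fun x => (C x).hcomp_eq)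
  vcomp_eq := Modification.ext (Category.id_comp _) (Category.comp_id _)
    (funext fun x => (C x).vcomp_eq)

end Companion

section Conjoint

variable (C : ∀ x, Conjoint (DoubleNatTrans.app α x))
  (hα : ∀ {x y : D} (m : Pro x y), IsCocommuter (DoubleNatTrans.cell α m))

/-- The protransformation formed by conjoints of the components of a natural transformation whose
component cells are cocommuters: it compares proarrows by the slid cells. -/
def conjointProtransformation : Protransformation G F where
  app x := (C x).pro
  map {x y} f := (C x).lift (C y) (F.map f) (G.map f) (naturality α f)
  left_map f := by simp
  right_map f := by simp
  map_id x := by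
    simp only [CategoryTheory.Functor.map_id]
    exact (C x).lift_id
  map_comp f g := by
    rw [Conjoint.lift_comp]
    simp only [CategoryTheory.Functor.map_comp]
  nat {x y} m := (C x).slide (C y) (cell α m) (left_cell α m) (right_cell α m)
  left_nat m := Conjoint.left_slide _ _ _ _ _
  right_nat m := Conjoint.right_slide _ _ _ _ _
  nat_invertible m := (Conjoint.isCocommuter_iff _ _ _ _).1 (hα m)
  nat_cell a _ _ :=
    (Conjoint.slide_natural _ _ _ _ (cell_naturality α a)
      (by rw [Conjoint.lift_ε, G.left_mapCell]) (by rw [Conjoint.η_lift, F.right_mapCell])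
      _ _).symm
  nat_comp {x y z} m n _ _ _ _ := by
    have natural_comp := Conjoint.slide_natural (F := C x) (G := C z) (F' := C x) (G' := C z)
      (by simp) (by simp) (left_cell α (m ⊙ n)) (right_cell α (m ⊙ n)) (φ := cid _) (ψ := cid _)
      (comp_cell α m n (by simp)) (by simp) (by simp) (by simp) (by simp)
    rw [Conjoint.slide_hcomp (C x) (C y) (C z) (left_cell α m) (right_cell α m) (left_cell α n)
      (right_cell α n)] at natural_comp
    simpa only [vcomp_assoc] using natural_comp
  nat_unit x _ _ := by
    have natural_idn := Conjoint.slide_natural (F := C x) (G := C x) (F' := C x) (G' := C x)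
      (by simp) (by simp) (left_cell α (unit x)) (right_cell α (unit x)) (φ := cid _) (ψ := cid _)
      (idn_cell α x) (by simp) (by simp) (by simp) (by simp)
    rw [Conjoint.slide_unitCell] at natural_idn
    simpa only [vcomp_assoc] using natural_idn

/-- The unit of the conjoint of a natural transformation whose component cells are cocommuters. -/
def conjointUnit : Modification (Protransformation.idn F) (conjointProtransformation α C hα) where
  src := α
  tgt := 𝟙 F
  app x := (C x).η
  left_app x := (C x).left_η
  right_app x := (C x).right_η
  app_map f := (C _).η_lift (C _) _ _ (naturality α f)
  app_nat m _ _ :=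
    ((C _).hcomp_η_slide (C _) (cell α m) (left_cell α m) (right_cell α m)).trans
      (vcomp_assoc _ _ _).symm

/-- The counit of the conjoint of a natural transformation whose component cells are
cocommuters. -/
def conjointCounit : Modification (conjointProtransformation α C hα) (Protransformation.idn G) where
  src := 𝟙 G
  tgt := α
  app x := (C x).ε
  left_app x := (C x).left_ε
  right_app x := (C x).right_ε
  app_map f := ((C _).lift_ε (C _) _ _ (naturality α f)).symm
  app_nat m _ _ :=
    ((C _).slide_hcomp_ε (C _) (cell α m) (left_cell α m) (right_cell α m)).symm

/-- The conjoint of a natural transformation whose component cells are cocommuters. -/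
def conjoint : Conjoint (D := LaxDoubleFunctor D E) α where
  pro := conjointProtransformation α C hα
  η := conjointUnit α C hα
  ε := conjointCounit α C hα
  left_η := rfl
  right_η := rfl
  left_ε := rfl
  right_ε := rfl
  hcomp_eq := Modification.ext ((Category.id_comp _).trans (Category.id_comp _))
    ((Category.id_comp _).trans (Category.id_comp _)) (funext fun x => (C x).hcomp_eq)
  vcomp_eq := Modification.ext (Category.comp_id _) (Category.id_comp _)
    (funext fun x => (C x).vcomp_eq)

end Conjoint

end DoubleNatTrans

namespace DoubleCategory

section Opcartesian

variable {D : Type u} [DoubleCategory.{u, v, p, c} D]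

/-- A family of cells `κ a : k a → W` is jointly opcartesian if cells out of `W` with prescribed
boundaries correspond uniquely to families of cells out of the `k a` with compatible boundaries.
The coprojections of a coproduct of proarrows are the main example. -/
def IsJointlyOpcartesian {A : Type w} {x y : A → D} {X Y : D} {k : ∀ a, Pro (x a) (y a)}
    {W : Pro X Y} (κ : ∀ a, Cell (k a) W) : Prop :=
  ∀ ⦃t t' : D⦄ (n : Pro t t') (g : X ⟶ t) (h : Y ⟶ t') (γ : ∀ a, Cell (k a) n),
    (∀ a, left (γ a) = left (κ a) ≫ g) → (∀ a, right (γ a) = right (κ a) ≫ h) →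
      ∃! δ : Cell W n, left δ = g ∧ right δ = h ∧ ∀ a, κ a ≫ᵥ δ = γ a

namespace IsJointlyOpcartesian

variable {A : Type w} {x y : A → D} {X Y : D} {k : ∀ a, Pro (x a) (y a)} {W : Pro X Y}
  {κ : ∀ a, Cell (k a) W}

theorem ext (hκ : IsJointlyOpcartesian κ) {t t' : D} {n : Pro t t'} {α β : Cell W n}
    (hl : left α = left β) (hr : right α = right β) (h : ∀ a, κ a ≫ᵥ α = κ a ≫ᵥ β) : α = β :=
  (hκ n (left β) (right β) (fun a => κ a ≫ᵥ β) (by simp) (by simp)).unique ⟨hl, hr, h⟩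
    ⟨rfl, rfl, fun _ => rfl⟩

section Desc

variable (hκ : IsJointlyOpcartesian κ) {t t' : D} {n : Pro t t'} (g : X ⟶ t) (h : Y ⟶ t')
  (γ : ∀ a, Cell (k a) n) (hl : ∀ a, left (γ a) = left (κ a) ≫ g)
  (hr : ∀ a, right (γ a) = right (κ a) ≫ h)

/-- The cell out of the target of a jointly opcartesian family induced by a family of cells. -/
noncomputable def desc : Cell W n := (hκ n g h γ hl hr).choose

@[simp] theorem left_desc : left (hκ.desc g h γ hl hr) = g :=
  (hκ n g h γ hl hr).choose_spec.1.1

@[simp] theorem right_desc : right (hκ.desc g h γ hl hr) = h :=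
  (hκ n g h γ hl hr).choose_spec.1.2.1

theorem vcomp_desc (a : A) : κ a ≫ᵥ hκ.desc g h γ hl hr = γ a :=
  (hκ n g h γ hl hr).choose_spec.1.2.2 a

end Desc

theorem reindex (hκ : IsJointlyOpcartesian κ) {A' : Type*} (e : A' ≃ A) :
    IsJointlyOpcartesian fun a => κ (e a) := by
  intro t t' n g h γ hl hr
  have γ_apply := Equiv.piCongrLeft_apply_apply (fun a => Cell (k a) n) e γ
  obtain ⟨δ, ⟨hlδ, hrδ, hδ⟩, unique⟩ := hκ n g h (e.piCongrLeft (fun a => Cell (k a) n) γ)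
    (e.surjective.forall.2 fun a => by rw [γ_apply, hl])
    (e.surjective.forall.2 fun a => by rw [γ_apply, hr])
  refine ⟨δ, ⟨hlδ, hrδ, fun a => by rw [hδ, γ_apply]⟩, fun δ' ⟨hl', hr', h'⟩ =>
    unique δ' ⟨hl', hr', e.surjective.forall.2 fun a => by rw [h', γ_apply]⟩⟩

theorem vcomp_isInvertible (hκ : IsJointlyOpcartesian κ) {W' : Pro X Y} {Ω : Cell W W'}
    (hΩ : IsInvertible Ω) (hl : left Ω = 𝟙 X) (hr : right Ω = 𝟙 Y) :
    IsJointlyOpcartesian fun a => κ a ≫ᵥ Ω := by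
  have hl' : left hΩ.inv = 𝟙 X := left_eq_id_of_inv hΩ.hom_inv hl
  have hr' : right hΩ.inv = 𝟙 Y := right_eq_id_of_inv hΩ.hom_inv hr
  intro t t' n g h γ hlγ hrγ
  refine ⟨hΩ.inv ≫ᵥ hκ.desc g h γ (by simpa [hl] using hlγ) (by simpa [hr] using hrγ),
    ⟨by simp [hl'], by simp [hr'], fun a => ?_⟩, fun δ ⟨hlδ, hrδ, hδ⟩ => ?_⟩
  · rw [vcomp_assoc, vcomp_eq_assoc hΩ.hom_inv, cid_vcomp, vcomp_desc]
  · have desc_eq : hκ.desc g h γ (by simpa [hl] using hlγ) (by simpa [hr] using hrγ) = Ω ≫ᵥ δ :=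
      hκ.ext (by simp [hl, hlδ]) (by simp [hr, hrδ]) fun a => by
        rw [vcomp_desc, ← vcomp_assoc, hδ]
    rw [desc_eq, vcomp_eq_assoc hΩ.inv_hom, cid_vcomp]

theorem isInvertible (hκ : IsJointlyOpcartesian κ) {x' y' : A → D} {k' : ∀ a, Pro (x' a) (y' a)}
    {W' : Pro X Y} {κ' : ∀ a, Cell (k' a) W'} (hκ' : IsJointlyOpcartesian κ')
    {θ : ∀ a, Cell (k a) (k' a)} (hθ : ∀ a, IsInvertible (θ a)) {Φ : Cell W W'}
    (hl : left Φ = 𝟙 X) (hr : right Φ = 𝟙 Y) (e : ∀ a, κ a ≫ᵥ Φ = θ a ≫ᵥ κ' a) :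
    IsInvertible Φ := by
  have e' : ∀ a, (hθ a).inv ≫ᵥ κ a ≫ᵥ Φ = κ' a := fun a => by
    rw [e, vcomp_eq_assoc (hθ a).inv_hom, cid_vcomp]
  let Ψ : Cell W' W := hκ'.desc (𝟙 X) (𝟙 Y) (fun a => (hθ a).inv ≫ᵥ κ a)
    (fun a => by simp [← e' a, hl]) (fun a => by simp [← e' a, hr])
  have κ'_Ψ : ∀ a, κ' a ≫ᵥ Ψ = (hθ a).inv ≫ᵥ κ a := hκ'.vcomp_desc _ _ _ _ _
  refine ⟨Ψ, hκ.ext (by simp [Ψ, hl]) (by simp [Ψ, hr]) fun a => ?_,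
    hκ'.ext (by simp [Ψ, hl]) (by simp [Ψ, hr]) fun a => ?_⟩
  · rw [vcomp_eq_assoc (e a), vcomp_assoc, κ'_Ψ, vcomp_eq_assoc (hθ a).hom_inv, cid_vcomp,
      vcomp_cid]
  · rw [vcomp_eq_assoc (κ'_Ψ a), vcomp_assoc, e', vcomp_cid]

theorem hOp (hκ : IsJointlyOpcartesian κ) :
    IsJointlyOpcartesian (D := HOp D) (x := y) (y := x) (X := Y) (Y := X) (k := k) (W := W) κ := by
  intro t t' n g h γ hl hr
  obtain ⟨δ, ⟨hlδ, hrδ, hδ⟩, unique⟩ := hκ n h g γ hr hl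
  exact ⟨δ, ⟨hrδ, hlδ, hδ⟩, fun δ' ⟨hl', hr', h'⟩ => unique δ' ⟨hr', hl', h'⟩⟩

end IsJointlyOpcartesian

namespace Companion

/-- The external identity as a companion of an identity arrow. -/
abbrev id (x : D) : Companion (𝟙 x) where
  pro := unit x
  η := cid _
  ε := cid _
  left_η := left_cid _
  right_η := right_cid _
  left_ε := left_cid _
  right_ε := right_cid _
  hcomp_eq := by simp [lunitInv_hom, ← lunitHom_unit]
  vcomp_eq := by simp

theorem isCommuter_cid {x y : D} (m : Pro x y) : IsCommuter (cid m) := by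
  have unitors : (id x).slide (id y) (cid m) (left_cid m) (right_cid m) =
      runitHom m ≫ᵥ lunitInv m :=
    (eq_slide _ _ (by simp) (by simp)).symm
  rw [isCommuter_iff (id x) (id y) (left_cid m) (right_cid m), unitors]
  exact .vcomp ⟨_, runitHom_inv m, runitInv_hom m⟩ ⟨_, lunitInv_hom m, lunitHom_inv m⟩

section Glue

variable {A : Type w} {x y : A → D} {X Y : D} {g : ∀ a, x a ⟶ y a} (F : ∀ a, Companion (g a))
  {i : ∀ a, x a ⟶ X} {j : ∀ a, y a ⟶ Y} {f : X ⟶ Y} (hf : ∀ a, i a ≫ f = g a ≫ j a)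
  (hi : IsJointlyOpcartesian fun a => unitCell (i a)) {W : Pro X Y} {κ : ∀ a, Cell (F a).pro W}
  (hκ : IsJointlyOpcartesian κ) (hl : ∀ a, left (κ a) = i a) (hr : ∀ a, right (κ a) = j a)

/-- The companion, with underlying proarrow `W`, of an arrow `f : X ⟶ Y` glued from companions of
arrows `g a`, where `W` is glued from their underlying proarrows along `κ` and the external
identity of `X` is glued from external identities along the `i a`. -/
noncomputable def glue : Companion f where
  pro := W
  η := hi.desc (𝟙 X) f (fun a => (F a).η ≫ᵥ κ a) (by simp [hl]) (by simp [hr, hf])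
  ε := hκ.desc f (𝟙 Y) (fun a => (F a).ε ≫ᵥ unitCell (j a)) (by simp [hl, hf]) (by simp [hr])
  left_η := hi.left_desc _ _ _ _ _
  right_η := hi.right_desc _ _ _ _ _
  left_ε := hκ.left_desc _ _ _ _ _
  right_ε := hκ.right_desc _ _ _ _ _
  hcomp_eq := hκ.ext (by simp) (by simp) fun a => by
    rw [vcomp_eq_vcomp_assoc (lunitInv_natural (κ a) (hl a)), hcomp_vcomp_hcomp_assoc,
      hcomp_congr (hi.vcomp_desc _ _ _ _ _ a) (hκ.vcomp_desc _ _ _ _ _ a),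
      ← hcomp_vcomp_hcomp _ _ _ _ (by simp) (by simp [hr]), vcomp_assoc,
      ← runitHom_natural (κ a) (hr a), vcomp_cid, ← vcomp_assoc, ← vcomp_assoc,
      vcomp_assoc (lunitInv _), (F a).hcomp_eq, cid_vcomp]
  vcomp_eq := hi.ext (by simp) (by simp) fun a => by
    rw [vcomp_eq_assoc (hi.vcomp_desc _ _ _ _ _ a), vcomp_assoc, hκ.vcomp_desc,
      vcomp_eq_assoc (F a).vcomp_eq, ← unitCell_comp, ← unitCell_comp, hf]

theorem η_vcomp_eq_unitCell_vcomp_glue_η (a : A) :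
    (F a).η ≫ᵥ κ a = unitCell (i a) ≫ᵥ (glue F hf hi hκ hl hr).η :=
  (hi.vcomp_desc (𝟙 X) f (fun a => (F a).η ≫ᵥ κ a) (by simp [hl]) (by simp [hr, hf]) a).symm

theorem vcomp_glue_ε (a : A) :
    κ a ≫ᵥ (glue F hf hi hκ hl hr).ε = (F a).ε ≫ᵥ unitCell (j a) :=
  hκ.vcomp_desc f (𝟙 Y) (fun a => (F a).ε ≫ᵥ unitCell (j a)) (by simp [hl, hf]) (by simp [hr]) a

end Glue

end Companion

namespace Conjoint

/-- The external identity as a conjoint of an identity arrow. -/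
abbrev id (x : D) : Conjoint (𝟙 x) where
  pro := unit x
  η := cid _
  ε := cid _
  left_η := left_cid _
  right_η := right_cid _
  left_ε := left_cid _
  right_ε := right_cid _
  hcomp_eq := (Companion.id (D := HOp D) x).hcomp_eq
  vcomp_eq := (Companion.id x).vcomp_eq

theorem isCocommuter_cid {x y : D} (m : Pro x y) : IsCocommuter (cid m) :=
  isCommuter_hOp_iff_isCocommuter.1 (Companion.isCommuter_cid (D := HOp D) (x := y) (y := x) m)

section Glue

variable {A : Type w} {x y : A → D} {X Y : D} {g : ∀ a, x a ⟶ y a} (F : ∀ a, Conjoint (g a))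
  {i : ∀ a, x a ⟶ X} {j : ∀ a, y a ⟶ Y} {f : X ⟶ Y} (hf : ∀ a, i a ≫ f = g a ≫ j a)
  (hi : IsJointlyOpcartesian fun a => unitCell (i a)) {W : Pro Y X} {κ : ∀ a, Cell (F a).pro W}
  (hκ : IsJointlyOpcartesian κ) (hl : ∀ a, left (κ a) = j a) (hr : ∀ a, right (κ a) = i a)

/-- The conjoint, with underlying proarrow `W`, of an arrow `f : X ⟶ Y` glued from conjoints of
arrows `g a`: `Companion.glue` in the horizontal opposite. -/
noncomputable def glue : Conjoint f :=
  ofHOp (Companion.glue (D := HOp D) (fun a => (F a).toHOp) hf hi.hOp (W := W) hκ.hOp hr hl)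

theorem η_vcomp_eq_unitCell_vcomp_glue_η (a : A) :
    (F a).η ≫ᵥ κ a = unitCell (i a) ≫ᵥ (glue F hf hi hκ hl hr).η :=
  Companion.η_vcomp_eq_unitCell_vcomp_glue_η (D := HOp D) (fun a => (F a).toHOp) hf hi.hOp (W := W)
    hκ.hOp hr hl a

theorem vcomp_glue_ε (a : A) :
    κ a ≫ᵥ (glue F hf hi hκ hl hr).ε = (F a).ε ≫ᵥ unitCell (j a) :=
  Companion.vcomp_glue_ε (D := HOp D) (fun a => (F a).toHOp) hf hi.hOp (W := W) hκ.hOp hr hl a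

end Glue

end Conjoint

section InvertibleSlide

variable {A : Type w} {x y z t : A → D} {X Y Z T : D} {f : ∀ a, x a ⟶ z a} {g : ∀ a, y a ⟶ t a}
  {f' : X ⟶ Z} {g' : Y ⟶ T} {m : ∀ a, Pro (x a) (y a)} {n : ∀ a, Pro (z a) (t a)} {M : Pro X Y}
  {N : Pro Z T} {α : ∀ a, Cell (m a) (n a)} {β : Cell M N} {μ : ∀ a, Cell (m a) M}
  {ν : ∀ a, Cell (n a) N}

theorem isCommuter_of_isJointlyOpcartesian {F : ∀ a, Companion (f a)} {G : ∀ a, Companion (g a)}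
    {F' : Companion f'} {G' : Companion g'} (hl : ∀ a, left (α a) = f a)
    (hr : ∀ a, right (α a) = g a) (hl' : left β = f') (hr' : right β = g')
    {φ : ∀ a, Cell (F a).pro F'.pro} {ψ : ∀ a, Cell (G a).pro G'.pro}
    (e : ∀ a, μ a ≫ᵥ β = α a ≫ᵥ ν a)
    (hφ : ∀ a, (F a).η ≫ᵥ φ a = unitCell (left (μ a)) ≫ᵥ F'.η)
    (hψ : ∀ a, ψ a ≫ᵥ G'.ε = (G a).ε ≫ᵥ unitCell (right (ν a)))
    {hμψ : ∀ a, right (μ a) = left (ψ a)} {hφν : ∀ a, right (φ a) = left (ν a)}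
    (opcartesian_μψ : IsJointlyOpcartesian fun a => hcomp (μ a) (ψ a) (hμψ a))
    (opcartesian_φν : IsJointlyOpcartesian fun a => hcomp (φ a) (ν a) (hφν a))
    (hα : ∀ a, IsCommuter (α a)) : IsCommuter β :=
  (Companion.isCommuter_iff F' G' hl' hr').2 <|
    opcartesian_μψ.isInvertible opcartesian_φν
      (fun a => (Companion.isCommuter_iff (F a) (G a) (hl a) (hr a)).1 (hα a)) (by simp) (by simp)
      fun a => Companion.slide_natural (hl a) (hr a) hl' hr' (e a) (hφ a) (hψ a) (hμψ a) (hφν a)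

theorem isCocommuter_of_isJointlyOpcartesian {F : ∀ a, Conjoint (f a)} {G : ∀ a, Conjoint (g a)}
    {F' : Conjoint f'} {G' : Conjoint g'} (hl : ∀ a, left (α a) = f a)
    (hr : ∀ a, right (α a) = g a) (hl' : left β = f') (hr' : right β = g')
    {φ : ∀ a, Cell (F a).pro F'.pro} {ψ : ∀ a, Cell (G a).pro G'.pro}
    (e : ∀ a, μ a ≫ᵥ β = α a ≫ᵥ ν a)
    (hφ : ∀ a, φ a ≫ᵥ F'.ε = (F a).ε ≫ᵥ unitCell (left (ν a)))
    (hψ : ∀ a, (G a).η ≫ᵥ ψ a = unitCell (right (μ a)) ≫ᵥ G'.η)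
    {hφμ : ∀ a, right (φ a) = left (μ a)} {hνψ : ∀ a, right (ν a) = left (ψ a)}
    (opcartesian_φμ : IsJointlyOpcartesian fun a => hcomp (φ a) (μ a) (hφμ a))
    (opcartesian_νψ : IsJointlyOpcartesian fun a => hcomp (ν a) (ψ a) (hνψ a))
    (hα : ∀ a, IsCocommuter (α a)) : IsCocommuter β :=
  (Conjoint.isCocommuter_iff F' G' hl' hr').2 <|
    opcartesian_φμ.isInvertible opcartesian_νψ
      (fun a => (Conjoint.isCocommuter_iff (F a) (G a) (hl a) (hr a)).1 (hα a)) (by simp) (by simp)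
      fun a => Conjoint.slide_natural (hl a) (hr a) hl' hr' (e a) (hφ a) (hψ a) (hφμ a) (hνψ a)

end InvertibleSlide

end Opcartesian

end DoubleCategory

namespace StrongCoproducts

section StructureMaps

variable {D : Type u} [DoubleCategory.{u, v, p, c} D] {s : IndexSize}
  (S : StrongCoproducts.{w} s D) {I J K : Type w} [s.Admits I] [s.Admits J] [s.Admits K]
  {x : I → D} {y : J → D} {z : K → D}

theorem isJointlyOpcartesian_ιCell (m : SpanFamily x y) [s.Admits m.apex] :
    IsJointlyOpcartesian (S.ιCell m) := by
  intro t t' n g h γ hl hr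
  let cocone : SpanCocone m n :=
    { fst i := S.ι x i ≫ g
      snd j := S.ι y j ≫ h
      cell := γ
      left_cell a := by rw [hl, S.left_ιCell]
      right_cell a := by rw [hr, S.right_ιCell] }
  have desc_fst : S.desc cocone.fst = g := S.hom_ext _ _ fun i => S.ι_desc _ i
  have desc_snd : S.desc cocone.snd = h := S.hom_ext _ _ fun j => S.ι_desc _ j
  have left_desc := (S.left_descCell cocone).trans desc_fst
  have right_desc := (S.right_descCell cocone).trans desc_snd
  exact ⟨S.descCell cocone, ⟨left_desc, right_desc, S.ιCell_descCell cocone⟩,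
    fun δ ⟨hlδ, hrδ, hδ⟩ => S.cell_ext _ _ (hlδ.trans left_desc.symm) (hrδ.trans right_desc.symm)
      fun a => by rw [hδ, S.ιCell_descCell]⟩

theorem isJointlyOpcartesian_unitCell_ι (x : I → D) :
    IsJointlyOpcartesian fun i => unitCell (S.ι x i) := by
  simpa only [S.ι_unitComparison] using (S.isJointlyOpcartesian_ιCell (.unit x)).vcomp_isInvertible
    (S.unit_invertible x) (S.left_unitComparison x) (S.right_unitComparison x)

theorem isJointlyOpcartesian_ιCell_vcomp_compComparison (m : SpanFamily x y) (n : SpanFamily y z)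
    [s.Admits m.apex] [s.Admits n.apex] :
    IsJointlyOpcartesian fun q => S.ιCell (m.comp n) q ≫ᵥ S.compComparison m n :=
  (S.isJointlyOpcartesian_ιCell (m.comp n)).vcomp_isInvertible (S.comp_invertible m n)
    ((S.left_descCell _).trans (S.desc_ι x)) ((S.right_descCell _).trans (S.desc_ι z))

theorem isJointlyOpcartesian_hcomp_left_id (m : SpanFamily x y) [s.Admits m.apex] (q : J → K)
    (n : ∀ j, Pro (y j) (z (q j))) :
    IsJointlyOpcartesian fun a => hcomp (S.ιCell m a) (S.ιCell ⟨J, id, q, n⟩ (m.r a))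
      ((S.right_ιCell m a).trans (S.left_ιCell ⟨J, id, q, n⟩ (m.r a)).symm) := by
  let pullback : m.apex ≃ (m.comp (⟨J, id, q, n⟩ : SpanFamily y z)).apex :=
    { toFun a := ⟨(a, m.r a), rfl⟩
      invFun b := b.1.1
      left_inv _ := rfl
      right_inv b := Subtype.ext (Prod.ext rfl b.2) }
  have restricted := (S.isJointlyOpcartesian_ιCell_vcomp_compComparison m
    ⟨J, id, q, n⟩).reindex pullback
  simp only [S.ι_compComparison] at restricted
  exact restricted

theorem isJointlyOpcartesian_hcomp_right_id (q : J → I) (m : ∀ j, Pro (x (q j)) (y j))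
    (n : SpanFamily y z) [s.Admits n.apex] :
    IsJointlyOpcartesian fun a => hcomp (S.ιCell ⟨J, q, id, m⟩ (n.l a)) (S.ιCell n a)
      ((S.right_ιCell ⟨J, q, id, m⟩ (n.l a)).trans (S.left_ιCell n a).symm) := by
  let pullback : n.apex ≃ (SpanFamily.comp (⟨J, q, id, m⟩ : SpanFamily x y) n).apex :=
    { toFun a := ⟨(n.l a, a), rfl⟩
      invFun b := b.1.2
      left_inv _ := rfl
      right_inv b := Subtype.ext (Prod.ext b.2.symm rfl) }
  have restricted := (S.isJointlyOpcartesian_ιCell_vcomp_compComparison ⟨J, q, id, m⟩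
    n).reindex pullback
  simp only [S.ι_compComparison] at restricted
  exact restricted

variable (f : I → J)

/-- The external identities `id_{x (f i)}` as a family indexed by the span `(1, f)`. Its coproduct
is the companion of `S.structArrow f x`. -/
abbrev companionFamily (x : J → D) : SpanFamily (fun i => x (f i)) x where
  apex := I
  l := id
  r := f
  pro i := unit (x (f i))

/-- The external identities `id_{x (f i)}` as a family indexed by the span `(f, 1)`. Its coproduct
is the conjoint of `S.structArrow f x`. -/
abbrev conjointFamily (x : J → D) : SpanFamily x (fun i => x (f i)) where
  apex := I
  l := f
  r := id
  pro i := unit (x (f i))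

section CompanionConjoint

variable (x : J → D)

/-- The companion of a structure arrow, glued from the companions of identity arrows. -/
noncomputable def structCompanion : Companion (S.structArrow f x) :=
  Companion.glue (fun i => Companion.id (x (f i))) (j := fun i => S.ι x (f i)) (by simp)
    (S.isJointlyOpcartesian_unitCell_ι _) (S.isJointlyOpcartesian_ιCell (companionFamily f x))
    (S.left_ιCell (companionFamily f x)) (S.right_ιCell (companionFamily f x))

theorem ιCell_eq_unitCell_vcomp_structCompanion_η (i : I) :
    S.ιCell (companionFamily f x) i =
      unitCell (S.ι (fun i => x (f i)) i) ≫ᵥ (S.structCompanion f x).η :=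
  (cid_vcomp _).symm.trans <|
    Companion.η_vcomp_eq_unitCell_vcomp_glue_η (fun i => Companion.id (x (f i)))
      (j := fun i => S.ι x (f i)) (by simp) (S.isJointlyOpcartesian_unitCell_ι _)
      (S.isJointlyOpcartesian_ιCell (companionFamily f x)) (S.left_ιCell (companionFamily f x))
      (S.right_ιCell (companionFamily f x)) i

theorem ιCell_vcomp_structCompanion_ε (i : I) :
    S.ιCell (companionFamily f x) i ≫ᵥ (S.structCompanion f x).ε = unitCell (S.ι x (f i)) :=
  (Companion.vcomp_glue_ε (fun i => Companion.id (x (f i))) (j := fun i => S.ι x (f i)) (by simp)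
    (S.isJointlyOpcartesian_unitCell_ι _) (S.isJointlyOpcartesian_ιCell (companionFamily f x))
    (S.left_ιCell (companionFamily f x)) (S.right_ιCell (companionFamily f x)) i).trans
    (cid_vcomp _)

/-- The conjoint of a structure arrow, glued from the conjoints of identity arrows. -/
noncomputable def structConjoint : Conjoint (S.structArrow f x) :=
  Conjoint.glue (fun i => Conjoint.id (x (f i))) (j := fun i => S.ι x (f i)) (by simp)
    (S.isJointlyOpcartesian_unitCell_ι _) (S.isJointlyOpcartesian_ιCell (conjointFamily f x))
    (S.left_ιCell (conjointFamily f x)) (S.right_ιCell (conjointFamily f x))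

theorem ιCell_eq_unitCell_vcomp_structConjoint_η (i : I) :
    S.ιCell (conjointFamily f x) i =
      unitCell (S.ι (fun i => x (f i)) i) ≫ᵥ (S.structConjoint f x).η :=
  (cid_vcomp _).symm.trans <|
    Conjoint.η_vcomp_eq_unitCell_vcomp_glue_η (fun i => Conjoint.id (x (f i)))
      (j := fun i => S.ι x (f i)) (by simp) (S.isJointlyOpcartesian_unitCell_ι _)
      (S.isJointlyOpcartesian_ιCell (conjointFamily f x)) (S.left_ιCell (conjointFamily f x))
      (S.right_ιCell (conjointFamily f x)) i

theorem ιCell_vcomp_structConjoint_ε (i : I) :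
    S.ιCell (conjointFamily f x) i ≫ᵥ (S.structConjoint f x).ε = unitCell (S.ι x (f i)) :=
  (Conjoint.vcomp_glue_ε (fun i => Conjoint.id (x (f i))) (j := fun i => S.ι x (f i)) (by simp)
    (S.isJointlyOpcartesian_unitCell_ι _) (S.isJointlyOpcartesian_ιCell (conjointFamily f x))
    (S.left_ιCell (conjointFamily f x)) (S.right_ιCell (conjointFamily f x)) i).trans
    (cid_vcomp _)

end CompanionConjoint

variable {x y : J → D} (m : ∀ j, Pro (x j) (y j))

theorem isCommuter_structCell : IsCommuter (S.structCell f m) :=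
  isCommuter_of_isJointlyOpcartesian (F := fun i => Companion.id (x (f i)))
    (G := fun i => Companion.id (y (f i)))
    (F' := S.structCompanion f x) (G' := S.structCompanion f y)
    (φ := S.ιCell (companionFamily f x)) (ψ := S.ιCell (companionFamily f y))
    (ν := fun i => S.ιCell (.parallel m) (f i))
    (fun _ => left_cid _) (fun _ => right_cid _) (S.left_structCell f m) (S.right_structCell f m)
    (fun i => (S.ι_structCell f m i).trans (cid_vcomp _).symm)
    (fun i => by
      rw [S.left_ιCell]
      exact (cid_vcomp _).trans (S.ιCell_eq_unitCell_vcomp_structCompanion_η f x i))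
    (fun i => by
      rw [S.right_ιCell, cid_vcomp]
      exact S.ιCell_vcomp_structCompanion_ε f y i)
    (S.isJointlyOpcartesian_hcomp_left_id (.parallel fun i => m (f i)) f fun i => unit (y (f i)))
    (S.isJointlyOpcartesian_hcomp_left_id (companionFamily f x) id m)
    fun i => Companion.isCommuter_cid (m (f i))

theorem isCocommuter_structCell : IsCocommuter (S.structCell f m) :=
  isCocommuter_of_isJointlyOpcartesian (F := fun i => Conjoint.id (x (f i)))
    (G := fun i => Conjoint.id (y (f i)))
    (F' := S.structConjoint f x) (G' := S.structConjoint f y)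
    (φ := S.ιCell (conjointFamily f x)) (ψ := S.ιCell (conjointFamily f y))
    (ν := fun i => S.ιCell (.parallel m) (f i))
    (fun _ => left_cid _) (fun _ => right_cid _) (S.left_structCell f m) (S.right_structCell f m)
    (fun i => (S.ι_structCell f m i).trans (cid_vcomp _).symm)
    (fun i => by
      rw [S.left_ιCell, cid_vcomp]
      exact S.ιCell_vcomp_structConjoint_ε f x i)
    (fun i => by
      rw [S.right_ιCell]
      exact (cid_vcomp _).trans (S.ιCell_eq_unitCell_vcomp_structConjoint_η f y i))
    (S.isJointlyOpcartesian_hcomp_left_id (z := fun i => y (f i)) (conjointFamily f x) id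
      fun i => m (f i))
    (S.isJointlyOpcartesian_hcomp_right_id id m (conjointFamily f y))
    fun i => Conjoint.isCocommuter_cid (m (f i))

end StructureMaps

end StrongCoproducts

theorem mainTheorem11 {D : Type u} [DoubleCategory.{u, v, p, c} D] (s : IndexSize)
    (S : StrongCoproducts.{w} s D) {I J : Type w} [s.Admits I] [s.Admits J] (f : I → J) :
    Nonempty (Companion (D := LaxDoubleFunctor (J → D) D) (S.sigmaTrans f)) ∧
      Nonempty (Conjoint (D := LaxDoubleFunctor (J → D) D) (S.sigmaTrans f)) ∧
      ∀ {x y : J → D} (m : Pro x y),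
        IsCommuter (DoubleNatTrans.cell (S.sigmaTrans f) m) ∧
          IsCocommuter (DoubleNatTrans.cell (S.sigmaTrans f) m) :=
  ⟨⟨DoubleNatTrans.companion (S.sigmaTrans f) (S.structCompanion f) (S.isCommuter_structCell f)⟩,
    ⟨DoubleNatTrans.conjoint (S.sigmaTrans f) (S.structConjoint f) (S.isCocommuter_structCell f)⟩,
    fun m => ⟨S.isCommuter_structCell f m, S.isCocommuter_structCell f m⟩⟩
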